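/- Let $M$ be a unital $C^*$-algebra endowed with a continuous action $(g,x)\mapsto g\cdot x$, by $*$-automorphisms, of the group $G=K\times\mathbb R$, where $K$ is a compact (Hausdorff) group. Let $\widehat M$ be the spectrum of $M$, that is, the set of unitary equivalence classes $[\pi]$ of irreducible $*$-representations of $M$ with its usual (hull-kernel) topology; for a closed two-sided ideal $J\subseteq M$ identify $\widehat J$ with the open set $\{[\pi]\in\widehat M : \pi|_J\ne 0\}$, and let $G$ act on $\widehat M$ from the right by $[\pi]\cdot g=[\pi(g\cdot{})]$. Assume that there are closed two-sided $G$-invariant ideals $J_1,J_2\subseteq M$ with the following properties: 1. $J_1+J_2=M$. 2. The closed two-sided $G$-invariant ideal $J:=J_1\cap J_2$ has no unit element. Moreover, the open $\mathbb R$-invariant subset $Y:=\widehat J\subseteq\widehat M$ is metrizable and Hausdorff in the relative topology, and there is a $*$-isomorphism $J\simeq C_0(Y,\mathcal K(H_0))$ for a suitable separable complex Hilbert space $H_0$, where $\mathcal K(H_0)$ denotes the compact operators on $H_0$. 3. The action of $\mathbb R$ on $Y$ is proper (for every compact set $C\subseteq Y$ the set $\{t\in\mathbb R : (C\cdot t)\cap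 C\neq\emptyset\}$ is compact), and the orbit space $Y/\mathbb R$ is quasi-compact (every open cover has a finite subcover). 4. There exists $a\in J_1$ with $0\le a\le 1$ and $1-a\in J_2$ such that $k\cdot a=a$ for every $k\in K$ and such that, for every irreducible $*$-representation $\pi\colon M\to\mathcal B(H_0)$ with $[\pi]\in Y$, one has $$\pi(t\cdot a)\in\mathbb C 1+\mathcal K(H_0)\ \text{ for all } t\in\mathbb R,\qquad \lim_{t\to\infty}\|\pi(t\cdot(1-a))\|=\lim_{t\to-\infty}\|\pi(t\cdot a)\|=0 .$$ Then there exists a nonunitary isometry in the unital $C^*$-algebra $((K\times\mathbb R)\ltimes M)^1$, i.e. an element $v$ with $v^*v=1\neq vv^*$. Here $(K\times\mathbb R)\ltimes M$ is the crossed product of $M$ by the given action, and $A^1$ denotes $A$ if the $C^*$-algebra $A$ is unital, and the unitization $A\oplus\mathbb C1$ of $A$ otherwise. -/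

import Mathlib

open MeasureTheory Filter Topology
open scoped CompactlySupported ZeroAtInfty ENNReal

universe u v

noncomputable section

/-! ### Continuous actions and crossed products -/

/-- A continuous action of a topological group `G` on a unital C*-algebra `M` by
`*`-automorphisms, i.e. a C*-dynamical system. -/
structure CStarAction (G : Type v) [Group G] [TopologicalSpace G]
    (M : Type u) [CStarAlgebra M] where
  /-- The automorphism `x ↦ g · x` of `M`. -/
  toHom : G →* (M ≃⋆ₐ[ℂ] M)
  /-- The map `(g, x) ↦ g · x` is jointly continuous. -/
  continuous_act : Continuous fun p : G × M => toHom p.1 p.2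

/-- A covariant representation `(π, U)` of a C*-dynamical system: a unital (i.e. nondegenerate)
`*`-representation `π` of `M` and a strongly continuous unitary representation `U` of `G` on the
same Hilbert space, with `U_g π(x) U_g* = π(g · x)`.
Cyclic covariant representations live on Hilbert spaces that fit in `Type (max u v)`, so no
representation relevant for the universal norm below is lost. -/
structure CovariantRep {G : Type v} [Group G] [TopologicalSpace G]
    {M : Type u} [CStarAlgebra M] (α : CStarAction G M) where
  H : Type (max u v)
  [normedAddCommGroup : NormedAddCommGroup H]
  [innerProductSpace : InnerProductSpace ℂ H]
  [completeSpace : CompleteSpace H]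
  π : M →⋆ₐ[ℂ] (H →L[ℂ] H)
  U : G →* unitary (H →L[ℂ] H)
  continuous_U : ∀ ξ : H, Continuous fun g => (U g : H →L[ℂ] H) ξ
  covariant : ∀ g x, (U g : H →L[ℂ] H) * π x * star (U g : H →L[ℂ] H) = π (α.toHom g x)

attribute [instance] CovariantRep.normedAddCommGroup CovariantRep.innerProductSpace
  CovariantRep.completeSpace

section CrossedProduct

theorem integrable_norm_of_compactlySupported {G : Type v} [TopologicalSpace G] {M : Type u} [CStarAlgebra M]
    [MeasurableSpace G] [BorelSpace G] (μ : Measure G) [IsFiniteMeasureOnCompacts μ]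
    (f : C_c(G, M)) : Integrable (fun s => ‖f s‖) μ :=
  ((map_continuous f).integrable_of_hasCompactSupport f.hasCompactSupport).norm

variable {G : Type v} [Group G] [TopologicalSpace G] {M : Type u} [CStarAlgebra M]
  {α : CStarAction G M}

theorem CovariantRep.continuous_integrand (ρ : CovariantRep α) (f : C_c(G, M)) (ξ : ρ.H) :
    Continuous fun s => ρ.π (f s) ((ρ.U s : ρ.H →L[ℂ] ρ.H) ξ) := by
  have h1 : Continuous fun s => ρ.π (f s) := 
    (AddMonoidHomClass.continuous_of_bound ρ.π 1 fun x => by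
      rw [one_mul]; exact NonUnitalStarAlgHom.norm_apply_le ρ.π x).comp (map_continuous f)
  exact h1.clm_apply (ρ.continuous_U ξ)

theorem CovariantRep.norm_integrand_le (ρ : CovariantRep α) (f : C_c(G, M)) (ξ : ρ.H) (s : G) :
    ‖ρ.π (f s) ((ρ.U s : ρ.H →L[ℂ] ρ.H) ξ)‖ ≤ ‖f s‖ * ‖ξ‖ := by
  have h1 : ‖(ρ.U s : ρ.H →L[ℂ] ρ.H)‖ ≤ 1 := by
    rw [← mul_one (ρ.U s : ρ.H →L[ℂ] ρ.H), CStarRing.norm_coe_unitary_mul]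
    exact ContinuousLinearMap.norm_id_le
  calc ‖ρ.π (f s) ((ρ.U s : ρ.H →L[ℂ] ρ.H) ξ)‖
      ≤ ‖ρ.π (f s)‖ * ‖(ρ.U s : ρ.H →L[ℂ] ρ.H) ξ‖ := ContinuousLinearMap.le_opNorm _ _
    _ ≤ ‖f s‖ * ‖ξ‖ := by
        gcongr
        · exact NonUnitalStarAlgHom.norm_apply_le ρ.π (f s)
        · calc _ ≤ ‖(ρ.U s : ρ.H →L[ℂ] ρ.H)‖ * ‖ξ‖ := ContinuousLinearMap.le_opNorm _ _
            _ ≤ 1 * ‖ξ‖ := by gcongr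
            _ = ‖ξ‖ := one_mul _

variable [MeasurableSpace G] [BorelSpace G]

theorem CovariantRep.integrable_integrand (μ : Measure G) [IsFiniteMeasureOnCompacts μ]
    (ρ : CovariantRep α) (f : C_c(G, M)) (ξ : ρ.H) :
    Integrable (fun s => ρ.π (f s) ((ρ.U s : ρ.H →L[ℂ] ρ.H) ξ)) μ := by
  refine (ρ.continuous_integrand f ξ).integrable_of_hasCompactSupport ?_
  refine f.hasCompactSupport.mono fun s hs => ?_
  contrapose! hs
  have : f s = 0 := by simpa using hs
  simp [this]

/-- The integrated form `π ⋊ U` of a covariant representation `(π, U)`, evaluated at a compactly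
supported continuous function `f : G → M`: the operator `∫ π(f(s)) U_s ds`, the integral being
understood in the strong sense. -/
def CovariantRep.integrated (μ : Measure G) [IsFiniteMeasureOnCompacts μ]
    (ρ : CovariantRep α) (f : C_c(G, M)) : ρ.H →L[ℂ] ρ.H :=
  LinearMap.mkContinuous
    { toFun := fun ξ => ∫ s, ρ.π (f s) ((ρ.U s : ρ.H →L[ℂ] ρ.H) ξ) ∂μ
      map_add' := fun ξ η => by
        simp only [map_add]
        exact integral_add (ρ.integrable_integrand μ f ξ) (ρ.integrable_integrand μ f η)
      map_smul' := fun c ξ => by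
        simp only [map_smul, RingHom.id_apply]
        exact integral_smul c _ }
    (∫ s, ‖f s‖ ∂μ)
    (fun ξ => by
      rw [← integral_mul_const]
      exact norm_integral_le_of_norm_le
        ((integrable_norm_of_compactlySupported μ f).mul_const _)
        (ae_of_all _ (ρ.norm_integrand_le f ξ)))

theorem CovariantRep.norm_integrated_le (μ : Measure G) [IsFiniteMeasureOnCompacts μ]
    (ρ : CovariantRep α) (f : C_c(G, M)) : ‖ρ.integrated μ f‖ ≤ ∫ s, ‖f s‖ ∂μ :=
  LinearMap.mkContinuous_norm_le _ (integral_nonneg fun _ => norm_nonneg _) _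

/-- The universal integrated form: the family of all the operators `(π ⋊ U)(f)`, where `(π, U)`
runs over all covariant representations, as an element of the `ℓ^∞`-product of the algebras of
bounded operators. Its norm is the universal norm `sup ‖(π ⋊ U)(f)‖` of `f`. -/
def universalIntegrated (α : CStarAction G M) (μ : Measure G) [IsFiniteMeasureOnCompacts μ]
    (f : C_c(G, M)) : lp (fun ρ : CovariantRep α => ρ.H →L[ℂ] ρ.H) ∞ :=
  ⟨fun ρ => ρ.integrated μ f, memℓp_infty ⟨∫ s, ‖f s‖ ∂μ, by
    rintro _ ⟨ρ, rfl⟩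
    exact ρ.norm_integrated_le μ f⟩⟩

/-- The (full) crossed product `G ⋉ M`: the completion of (the convolution algebra) `C_c(G, M)`
in the universal norm, realised as a norm-closed `*`-algebra of families of operators indexed by
all covariant representations. The Haar measure `μ` matters only up to a rescaling of the
functions `f`, hence not at all for the resulting algebra. (The elements
`universalIntegrated α μ f` form a `*`-subalgebra, by the usual formulas for the
convolution product and the involution, so that `adjoin` adds nothing to them.) -/
def crossedProduct (α : CStarAction G M) (μ : Measure G) [μ.IsHaarMeasure] :
    NonUnitalStarSubalgebra ℂ (lp (fun ρ : CovariantRep α => ρ.H →L[ℂ] ρ.H) ∞) :=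
  (NonUnitalStarAlgebra.adjoin ℂ (Set.range (universalIntegrated α μ))).topologicalClosure

end CrossedProduct

/-- `e` is a (two-sided) unit element of `A`. -/
def IsUnitElement {A : Type*} [Mul A] (e : A) : Prop := ∀ x : A, e * x = x ∧ x * e = x

/-- The algebra `A¹` contains a nonunitary isometry, where `A¹ = A` if `A` has a unit element, and
`A¹ = A ⊕ ℂ 1` is the unitization of `A` otherwise. -/
def UnitizationHasNonunitaryIsometry (A : Type*) [NonUnitalRing A] [StarRing A] [Module ℂ A]
    [IsScalarTower ℂ A A] [SMulCommClass ℂ A A] [StarModule ℂ A] : Prop :=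
  (∃ e : A, IsUnitElement e ∧ ∃ v : A, star v * v = e ∧ v * star v ≠ e) ∨
  ((¬ ∃ e : A, IsUnitElement e) ∧ ∃ v : Unitization ℂ A, star v * v = 1 ∧ v * star v ≠ 1)

/-! ### The spectrum of a C*-algebra -/

/-- Irreducibility of a unital `*`-representation: the Hilbert space is nonzero and has no closed
invariant subspaces except `0` and the whole space. -/
def IsIrreducibleRep {M : Type*} [CStarAlgebra M] {H : Type*} [NormedAddCommGroup H]
    [InnerProductSpace ℂ H] [CompleteSpace H] (π : M →⋆ₐ[ℂ] (H →L[ℂ] H)) : Prop :=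
  Nontrivial H ∧ ∀ V : Submodule ℂ H, IsClosed (V : Set H) →
    (∀ x : M, ∀ ξ ∈ V, π x ξ ∈ V) → V = ⊥ ∨ V = ⊤

/-- Irreducible `*`-representations of `M`. (If `M : Type u`, then their Hilbert spaces are
quotients of `M`, hence fit in `Type u`.) -/
structure IrrRep (M : Type u) [CStarAlgebra M] where
  H : Type u
  [normedAddCommGroup : NormedAddCommGroup H]
  [innerProductSpace : InnerProductSpace ℂ H]
  [completeSpace : CompleteSpace H]
  π : M →⋆ₐ[ℂ] (H →L[ℂ] H)
  irreducible : IsIrreducibleRep π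

attribute [instance] IrrRep.normedAddCommGroup IrrRep.innerProductSpace IrrRep.completeSpace

section Spectrum

variable {M : Type u} [CStarAlgebra M]

/-- Unitary equivalence of irreducible representations. -/
instance IrrRep.unitaryEquivalence (M : Type u) [CStarAlgebra M] : Setoid (IrrRep M) where
  r ρ σ := ∃ W : ρ.H ≃ₗᵢ[ℂ] σ.H, ∀ (x : M) (ξ : ρ.H), W (ρ.π x ξ) = σ.π x (W ξ)
  iseqv :=
    { refl := fun ρ => ⟨LinearIsometryEquiv.refl ℂ ρ.H, fun _ _ => rfl⟩
      symm := by
        rintro ρ σ ⟨W, hW⟩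
        refine ⟨W.symm, fun x ξ => W.injective ?_⟩
        rw [hW]
        simp
      trans := by
        rintro ρ σ τ ⟨W, hW⟩ ⟨W', hW'⟩
        refine ⟨W.trans W', fun x ξ => ?_⟩
        simp [hW, hW'] }

/-- The spectrum of `M`: the set of unitary equivalence classes of irreducible
`*`-representations. -/
def CStarSpectrum (M : Type u) [CStarAlgebra M] : Type (u + 1) :=
  Quotient (IrrRep.unitaryEquivalence M)

/-- The class `[π]` of an irreducible representation. -/
def IrrRep.toSpectrum (ρ : IrrRep M) : CStarSpectrum M := Quotient.mk _ ρ

/-- The class `[π]` of an irreducible representation `π : M → B(H)`. -/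
def spectrumClass {H : Type u} [NormedAddCommGroup H] [InnerProductSpace ℂ H] [CompleteSpace H]
    (π : M →⋆ₐ[ℂ] (H →L[ℂ] H)) (h : IsIrreducibleRep π) : CStarSpectrum M :=
  IrrRep.toSpectrum ⟨H, π, h⟩

/-- The set of all `[π]` in the spectrum of `M` with `π|_J ≠ 0`; this is the usual
identification of the spectrum of a closed two-sided ideal `J` with a subset of the
spectrum of `M`. -/
def idealSpectrum (J : TwoSidedIdeal M) : Set (CStarSpectrum M) :=
  {p | ∃ ρ : IrrRep M, ρ.toSpectrum = p ∧ ∃ x ∈ J, ρ.π x ≠ 0}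

/-- The usual (hull-kernel) topology of the spectrum: the open sets are the spectra of the
closed two-sided ideals. -/
instance : TopologicalSpace (CStarSpectrum M) :=
  TopologicalSpace.generateFrom
    {O | ∃ J : TwoSidedIdeal M, IsClosed (J : Set M) ∧ O = idealSpectrum J}

/-- The irreducible representation `x ↦ π(σ(x))`, for an automorphism `σ` of `M`. -/
def IrrRep.comp (ρ : IrrRep M) (σ : M ≃⋆ₐ[ℂ] M) : IrrRep M where
  H := ρ.H
  π := ρ.π.comp (σ : M →⋆ₐ[ℂ] M)
  irreducible := by
    refine ⟨ρ.irreducible.1, fun V hV h => ρ.irreducible.2 V hV fun x ξ hξ => ?_⟩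
    have h2 := h (σ.symm x) ξ hξ
    simpa using h2

/-- The right action `[π] · g = [x ↦ π(g · x)]` of `G` on the spectrum of `M`. -/
def CStarAction.spectrumAct {G : Type v} [Group G] [TopologicalSpace G] (α : CStarAction G M)
    (p : CStarSpectrum M) (g : G) : CStarSpectrum M :=
  Quotient.map (fun ρ : IrrRep M => ρ.comp (α.toHom g))
    (fun ρ σ h => by
      obtain ⟨W, hW⟩ := h
      exact ⟨W, fun x ξ => hW (α.toHom g x) ξ⟩) p

end Spectrum

/-! ### Compact operators -/

section Compact

variable {H : Type*} [NormedAddCommGroup H] [InnerProductSpace ℂ H] [CompleteSpace H]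

theorem isCompactOperator_star {T : H →L[ℂ] H} (hT : IsCompactOperator T) :
    IsCompactOperator (star T : H →L[ℂ] H) := by
  set S : H →L[ℂ] H := star T with hS
  have hTS : IsCompactOperator (T ∘L S) := hT.comp_clm S
  have h1 : TotallyBounded ((T ∘L S) '' Metric.closedBall 0 1) :=
    (IsCompactOperator.isCompact_closure_image_closedBall hTS 1).totallyBounded.subset
      subset_closure
  have key : ∀ x ∈ Metric.closedBall (0 : H) 1, ∀ y ∈ Metric.closedBall (0 : H) 1,
      dist (S x) (S y) ^ 2 ≤ 2 * dist ((T ∘L S) x) ((T ∘L S) y) := by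
    intro x hx y hy
    rw [dist_eq_norm, dist_eq_norm, ← map_sub, ← map_sub]
    have hxy : ‖x - y‖ ≤ 2 := by
      have := norm_sub_le x y
      rw [mem_closedBall_zero_iff] at hx hy
      linarith
    have h2 : ‖S (x - y)‖ ^ 2 = RCLike.re (inner ℂ ((T ∘L S) (x - y)) (x - y)) := by
      rw [← inner_self_eq_norm_sq (𝕜 := ℂ)]
      congr 1
      conv_lhs => rw [hS, ContinuousLinearMap.star_eq_adjoint]
      rw [ContinuousLinearMap.adjoint_inner_right, ← ContinuousLinearMap.star_eq_adjoint, ← hS]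
      rfl
    rw [h2]
    calc _ ≤ ‖(T ∘L S) (x - y)‖ * ‖x - y‖ := re_inner_le_norm _ _
      _ ≤ ‖(T ∘L S) (x - y)‖ * 2 := by gcongr
      _ = _ := mul_comm _ _
  have h3 : TotallyBounded (S '' Metric.closedBall 0 1) := by
    rw [Metric.totallyBounded_iff]
    intro ε hε
    obtain ⟨t, htsub, htfin, htcov⟩ := Metric.finite_approx_of_totallyBounded h1 (ε ^ 2 / 2)
      (by positivity)
    choose! z hz hz' using fun y (hy : y ∈ t) => htsub hy
    refine ⟨(fun y => S (z y)) '' t, htfin.image _, ?_⟩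
    rintro _ ⟨x, hx, rfl⟩
    obtain ⟨y, hy, hxy⟩ := Set.mem_iUnion₂.1 (htcov ⟨x, hx, rfl⟩)
    refine Set.mem_iUnion₂.2 ⟨S (z y), ⟨y, hy, rfl⟩, ?_⟩
    rw [Metric.mem_ball] at hxy ⊢
    have h4 := key x hx (z y) (hz y hy)
    rw [hz' y hy] at h4
    have h5 : dist (S x) (S (z y)) ^ 2 < ε ^ 2 := by linarith
    exact lt_of_pow_lt_pow_left₀ 2 hε.le h5
  exact (isCompactOperator_iff_isCompact_closure_image_closedBall (S : H →ₗ[ℂ] H) one_pos).2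
    (h3.closure.isCompact_of_isClosed isClosed_closure)

/-- The C*-algebra `K(H)` of compact operators on a Hilbert space. -/
def compactOperators (H : Type*) [NormedAddCommGroup H] [InnerProductSpace ℂ H]
    [CompleteSpace H] : NonUnitalStarSubalgebra ℂ (H →L[ℂ] H) where
  carrier := {T | IsCompactOperator T}
  add_mem' := fun hS hT => hS.add hT
  zero_mem' := isCompactOperator_zero
  smul_mem' := fun c _ hT => hT.smul c
  mul_mem' := fun {_ T} hS _ => hS.comp_clm T
  star_mem' := fun hT => isCompactOperator_star hT

instance : NonUnitalCStarAlgebra (compactOperators H) :=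
  NonUnitalStarSubalgebra.nonUnitalCStarAlgebra _
    (h_closed := isClosed_setOfPred_isCompactOperator)

end Compact

/-! ### Actions of `K × ℝ` -/

section RealAction

variable {K : Type v} [Group K] [TopologicalSpace K] {M : Type u} [CStarAlgebra M]

/-- The element `k` of the factor `K` of `K × ℝ` acting on `x ∈ M`. -/
def CStarAction.actK (α : CStarAction (K × Multiplicative ℝ) M) (k : K) (x : M) : M :=
  α.toHom (k, 1) x

/-- The element `t` of the factor `ℝ` of `K × ℝ` acting on `x ∈ M`. -/
def CStarAction.actR (α : CStarAction (K × Multiplicative ℝ) M) (t : ℝ) (x : M) : M :=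
  α.toHom (1, Multiplicative.ofAdd t) x

/-- The right action of the factor `ℝ` of `K × ℝ` on the spectrum of `M`. -/
def CStarAction.spectrumActR (α : CStarAction (K × Multiplicative ℝ) M)
    (p : CStarSpectrum M) (t : ℝ) : CStarSpectrum M :=
  α.spectrumAct p (1, Multiplicative.ofAdd t)

theorem CStarAction.spectrumAct_one {G : Type v} [Group G] [TopologicalSpace G]
    (α : CStarAction G M) (p : CStarSpectrum M) : α.spectrumAct p 1 = p := by
  induction p using Quotient.inductionOn with
  | h ρ => exact Quotient.sound ⟨LinearIsometryEquiv.refl ℂ ρ.H, fun x ξ => by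
      change ρ.π (α.toHom 1 x) ξ = ρ.π x ξ
      rw [map_one]; rfl⟩

theorem CStarAction.spectrumAct_mul {G : Type v} [Group G] [TopologicalSpace G]
    (α : CStarAction G M) (p : CStarSpectrum M) (g h : G) :
    α.spectrumAct p (g * h) = α.spectrumAct (α.spectrumAct p g) h := by
  induction p using Quotient.inductionOn with
  | h ρ => exact Quotient.sound ⟨LinearIsometryEquiv.refl ℂ ρ.H, fun x ξ => by
      change ρ.π (α.toHom (g * h) x) ξ = ρ.π (α.toHom g (α.toHom h x)) ξ
      rw [map_mul]; rfl⟩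

/-- The action of `ℝ` on the subset `Y` of the spectrum is proper: for every compact `C ⊆ Y` the
set `{t | (C · t) ∩ C ≠ ∅}` is compact. -/
def CStarAction.IsProperOn (α : CStarAction (K × Multiplicative ℝ) M)
    (Y : Set (CStarSpectrum M)) : Prop :=
  ∀ C ⊆ Y, IsCompact C → IsCompact {t : ℝ | ∃ p ∈ C, α.spectrumActR p t ∈ C}

/-- The relation of lying on the same `ℝ`-orbit, on a subset `Y` of the spectrum. -/
def CStarAction.orbitSetoid (α : CStarAction (K × Multiplicative ℝ) M)
    (Y : Set (CStarSpectrum M)) : Setoid Y where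
  r p q := ∃ t : ℝ, α.spectrumActR p t = q
  iseqv :=
    { refl := fun p => ⟨0, α.spectrumAct_one _⟩
      symm := by
        rintro p q ⟨t, h⟩
        refine ⟨-t, ?_⟩
        rw [← h, CStarAction.spectrumActR, CStarAction.spectrumActR,
          ← CStarAction.spectrumAct_mul]
        convert α.spectrumAct_one _ using 2
        simp [Prod.ext_iff]
      trans := by
        rintro p q r ⟨t, h⟩ ⟨s, h'⟩
        refine ⟨t + s, ?_⟩
        rw [← h', ← h]
        simp only [CStarAction.spectrumActR]
        rw [← CStarAction.spectrumAct_mul]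
        congr 1
        simp }

/-- The orbit space `Y/ℝ`. -/
abbrev CStarAction.OrbitSpace (α : CStarAction (K × Multiplicative ℝ) M)
    (Y : Set (CStarSpectrum M)) : Type (u + 1) :=
  Quotient (α.orbitSetoid Y)

end RealAction

end

/-!
The isometry is the phase of an explicit operator of Callias type: the generator of the flow plus a
potential that changes its sign along every orbit.

*The element `b`.* Write `J = J₁ ⊓ J₂`. Along every `ℝ`-orbit in the spectrum of `J` the element `a`
passes from `0` at `-∞` to `1` at `+∞`. As `a (1 - a)` belongs to `J`, it is small off a compact set
of the spectrum; as the action is proper and a compact set meets all orbits, the passage takes place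
within a time `2 L` that does not depend on the orbit (`CStarAction.exists_uniform_transition`). Hence
the average `b` of `t · a` over a time `N` much longer than `L` is differentiable, with derivative
`d`, and satisfies `lam² (1 - 2 b)² + 2 lam d ≥ lam² / 2` for `lam = 1 / (64 N)`: where `b` is not
close to `0` or `1`, it increases with slope about `1 / N`. Modulo `J` the element `b` is a
projection, so this inequality needs to be checked only in the representations belonging to points
of the spectrum of `J` (`nonneg_of_forall_rep_nonneg`, `CStarAction.exists_smooth_transition`). That
these representations live on `H₀` and form compact sets comes from `J ≃ C₀(Y, K(H₀))`
(`exists_eval_of_mem_idealSpectrum`, `isCompact_norm_ge_idealSpectrum`).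

*The operator `T`.* In a covariant representation let `δ` be the generator of the action of `ℝ`, and
`P` the projection to the vectors fixed by `K`. Put `T = 1 - 2 lam b (lam + δ)⁻¹ P`. On the fixed
vectors this is `(δ + lam (1 - 2 b)) (δ + lam)⁻¹`. As `δ` is skew-adjoint and `[δ, b] = d`, the
inequality above gives `‖T ξ‖² ≥ ‖ξ‖² / 2`, uniformly in all covariant representations
(`CovariantRep.half_norm_sq_le_transitionOp`). The resolvent is the integral of the unitary group
against an `L¹`-function, and `P` is the integral over `K`; so `T - 1` belongs to the crossed product
(`transitionElement_mem_crossedProduct`).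

*The isometry.* `V = T (T* T)^(-1/2)` is an isometry, and `V - 1` belongs to the crossed product, by
functional calculus. It is not unitary if `T` is not surjective in some covariant representation
(`crossedProduct_hasNonunitaryIsometry`). This holds for the regular representation on `L²(G, H₀)`
induced by an irreducible representation in the spectrum of `J`, which is nonempty because the zero
ideal is unital. There `b` acts by multiplication with a function of `r ∈ ℝ` that falls from `1` to
`0` near a point `-r₀`, and the adjoint of `δ + lam (1 - 2 b)` almost annihilates the function
`exp(-lam |r + r₀|) ξ₀`. By the lower bound on `T`, this function is not in the range of `T`
(`CovariantRep.sq_norm_le_of_transitionOp_eq`, `CStarAction.StepLike.not_surjective_transitionOp`).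
-/

/-! ### Extension of representations from ideals and irreducible representations -/

section IdealReps

variable {M : Type*} [CStarAlgebra M] [PartialOrder M] [StarOrderedRing M]
  {A : Type*} [NonUnitalRing A] [StarRing A] [Module ℂ A]
  {H : Type*} [NormedAddCommGroup H] [InnerProductSpace ℂ H] [CompleteSpace H]

theorem inner_apply_star_mul (S T : H →L[ℂ] H) (ξ η : H) :
    inner ℂ ((star S * T) ξ) η = inner ℂ (T ξ) (S η) := by
  rw [ContinuousLinearMap.star_eq_adjoint, mul_apply_eq_comp,
    ContinuousLinearMap.adjoint_inner_left]

/-- A representation `σ` of an ideal of `M` is contractive with respect to multiplication by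
elements of `M`. This is what makes `σ` extend to `M`. -/
theorem norm_apply_le_of_eq_mul (φ : A →⋆ₙₐ[ℂ] M) (hφ : Function.Injective φ)
    (hideal : ∀ m x, ∃ x', φ x' = m * φ x) (σ : A →⋆ₙₐ[ℂ] (H →L[ℂ] H)) {m : M} {x x' : A}
    (h : φ x' = m * φ x) (ζ : H) : ‖σ x' ζ‖ ≤ ‖m‖ * ‖σ x ζ‖ := by
  have hle : star m * m ≤ algebraMap ℝ M (‖m‖ ^ 2) :=
    CStarAlgebra.star_mul_le_algebraMap_norm_sq
  have hnn : 0 ≤ algebraMap ℝ M (‖m‖ ^ 2) - star m * m := sub_nonneg.2 hle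
  set c := CFC.sqrt (algebraMap ℝ M (‖m‖ ^ 2) - star m * m) with hc
  have hcc : star c * c = algebraMap ℝ M (‖m‖ ^ 2) - star m * m := by
    rw [(IsSelfAdjoint.of_nonneg (CFC.sqrt_nonneg _)).star_eq]
    exact CFC.sqrt_mul_sqrt_self _ hnn
  obtain ⟨y, hy⟩ := hideal c x
  have key : star y * y = ((‖m‖ ^ 2 : ℝ) : ℂ) • (star x * x) - star x' * x' := by
    apply hφ
    have e1 : star (φ x) * (star c * c) * φ x
        = ((‖m‖ ^ 2 : ℝ) : ℂ) • (star (φ x) * φ x) - star (φ x) * (star m * m) * φ x := by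
      rw [hcc, mul_sub, sub_mul, Algebra.algebraMap_eq_smul_one, mul_smul_comm, mul_one,
        smul_mul_assoc]
      rfl
    rw [map_sub, map_smul, map_mul, map_mul, map_mul, map_star, map_star, map_star, hy, h,
      star_mul, star_mul]
    simpa [mul_assoc] using e1
  have h2 := congrArg (fun a => RCLike.re (inner ℂ (σ a ζ) ζ)) key
  simp only [map_sub, map_smul, map_mul, map_star] at h2
  rw [sub_apply, smul_apply, inner_sub_left,
    inner_smul_left, inner_apply_star_mul, inner_apply_star_mul, inner_apply_star_mul, map_sub,
    inner_self_eq_norm_sq_to_K, inner_self_eq_norm_sq_to_K, inner_self_eq_norm_sq_to_K] at h2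
  have h3 : ‖σ y ζ‖ ^ 2 = ‖m‖ ^ 2 * ‖σ x ζ‖ ^ 2 - ‖σ x' ζ‖ ^ 2 := by
    have h4 : ∀ r : ℝ, RCLike.re ((RCLike.ofReal r : ℂ) ^ 2) = r ^ 2 := fun r => by
      rw [← RCLike.ofReal_pow, RCLike.ofReal_re]
    have h5 : ∀ r s : ℝ, RCLike.re ((starRingEnd ℂ) ((r : ℝ) : ℂ) * (RCLike.ofReal s : ℂ) ^ 2)
        = r * s ^ 2 := by
      intro r s
      rw [Complex.conj_ofReal, ← RCLike.ofReal_pow]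
      exact RCLike.re_ofReal_mul r _ |>.trans (by rw [RCLike.ofReal_re])
    rwa [h5, h4, h4] at h2
  refine le_of_sq_le_sq ?_ (by positivity)
  rw [mul_pow]
  nlinarith [sq_nonneg ‖σ y ζ‖]

/-- A representation `σ` of an ideal with an algebraically cyclic vector extends to `M`. -/
theorem exists_extension (φ : A →⋆ₙₐ[ℂ] M) (hφ : Function.Injective φ)
    (hideal : ∀ m x, ∃ x', φ x' = m * φ x) (σ : A →⋆ₙₐ[ℂ] (H →L[ℂ] H))
    (ξ : H) (hξ : ∀ η, ∃ x, σ x ξ = η) :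
    ∃ π : M →⋆ₐ[ℂ] (H →L[ℂ] H), ∀ x, π (φ x) = σ x := by
  choose j hj using hξ
  choose μ hμ using hideal
  have hideal : ∀ m x, ∃ x', φ x' = m * φ x := fun m x => ⟨_, hμ m x⟩
  -- the value of `σ (m x) ξ` depends on `σ x ξ` only
  have wd : ∀ (m : M) (x y x' y' : A), φ x' = m * φ x → φ y' = m * φ y → σ x ξ = σ y ξ →
      σ x' ξ = σ y' ξ := by
    intro m x y x' y' hx hy hxy
    have := norm_apply_le_of_eq_mul φ hφ hideal σ (m := m) (x := x - y) (x' := x' - y')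
      (by rw [map_sub, map_sub, hx, hy, mul_sub]) ξ
    rw [map_sub, map_sub, sub_apply, sub_apply, hxy,
      sub_self, norm_zero, mul_zero] at this
    exact sub_eq_zero.1 (norm_le_zero_iff.1 this)
  let P : M → H →L[ℂ] H := fun m => LinearMap.mkContinuous
    { toFun := fun η => σ (μ m (j η)) ξ
      map_add' := fun η η' => by
        rw [← add_apply, ← map_add]
        refine wd m (j (η + η')) (j η + j η') _ _ (hμ _ _) ?_ ?_
        · rw [map_add, map_add, hμ, hμ, mul_add]
        · rw [map_add, add_apply, hj, hj, hj]
      map_smul' := fun c η => by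
        rw [RingHom.id_apply, ← smul_apply, ← map_smul]
        refine wd m (j (c • η)) (c • j η) _ _ (hμ _ _) ?_ ?_
        · rw [map_smul, map_smul, hμ, mul_smul_comm]
        · rw [map_smul, smul_apply, hj, hj] }
    ‖m‖ (fun η => by
      have := norm_apply_le_of_eq_mul φ hφ hideal σ (hμ m (j η)) ξ
      rwa [hj] at this)
  have hP : ∀ m x x', φ x' = m * φ x → P m (σ x ξ) = σ x' ξ := fun m x x' h =>
    wd m (j (σ x ξ)) x _ _ (hμ _ _) h (hj _)
  have hP' : ∀ m η, P m η = σ (μ m (j η)) ξ := fun m η => rfl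
  have hPmul : ∀ m n, P (m * n) = P m * P n := by
    intro m n
    ext η
    rw [mul_apply_eq_comp, hP' n, hP m _ (μ m (μ n (j η))) (hμ _ _), ← hj η,
      hP (m * n) (j η) (μ m (μ n (j η))) (by rw [hμ, hμ, mul_assoc]), hj]
  have hPone : P 1 = 1 := by
    ext η
    rw [← hj η, hP 1 _ (j η) (by rw [one_mul]), one_apply_eq_self]
  have hPsmul : ∀ (c : ℂ) m, P (c • m) = c • P m := by
    intro c m
    ext η
    rw [← hj η, smul_apply, hP m _ _ (hμ _ _), hP (c • m) _ (c • μ m (j η))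
      (by rw [map_smul, hμ, smul_mul_assoc]), map_smul, smul_apply]
  have hPadd : ∀ m n, P (m + n) = P m + P n := by
    intro m n
    ext η
    rw [← hj η, add_apply, hP m _ _ (hμ _ _), hP n _ _ (hμ _ _),
      hP (m + n) _ (μ m (j η) + μ n (j η)) (by rw [map_add, hμ, hμ, add_mul]), map_add,
      add_apply]
  have hPzero : P 0 = 0 := by simpa using hPsmul 0 0
  have hPstar : ∀ m, P (star m) = star (P m) := by
    intro m
    rw [ContinuousLinearMap.star_eq_adjoint, ContinuousLinearMap.eq_adjoint_iff]
    intro η η'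
    rw [← hj η, ← hj η', hP _ _ _ (hμ _ _), hP _ _ _ (hμ _ _)]
    have e1 : star (j η') * (μ (star m) (j η)) = star (μ m (j η')) * j η := by
      apply hφ
      rw [map_mul, map_mul, map_star, map_star, hμ, hμ, star_mul, mul_assoc]
    rw [← inner_apply_star_mul, ← inner_apply_star_mul, ← map_star, ← map_star, ← map_mul,
      ← map_mul, e1]
  refine ⟨{ toFun := P, map_one' := hPone, map_mul' := hPmul, map_zero' := hPzero,
            map_add' := hPadd, commutes' := ?_, map_star' := hPstar }, ?_⟩
  · intro c
    rw [Algebra.algebraMap_eq_smul_one, hPsmul, hPone, Algebra.algebraMap_eq_smul_one]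
  · intro x
    ext η
    change P (φ x) η = σ x η
    rw [← hj η, hP (φ x) (j η) (x * j η) (map_mul _ _ _), map_mul, mul_apply_eq_comp]

/-- The kernel of an irreducible representation is a prime ideal. -/
theorem IsIrreducibleRep.eq_zero_or_eq_zero {M : Type*} [CStarAlgebra M]
    {ρ : M →⋆ₐ[ℂ] (H →L[ℂ] H)} (hρ : IsIrreducibleRep ρ) {c d : M}
    (h : ∀ m, ρ (c * (m * d)) = 0) : ρ c = 0 ∨ ρ d = 0 := by
  let V : Submodule ℂ H := ⨅ m : M, LinearMap.ker (ρ (c * m) : H →ₗ[ℂ] H)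
  have hV : ∀ ζ, ζ ∈ V ↔ ∀ m, ρ (c * m) ζ = 0 := fun ζ => by simp [V, Submodule.mem_iInf]
  have hcl : IsClosed (V : Set H) := by
    have : (V : Set H) = ⋂ m, {ζ | ρ (c * m) ζ = 0} := by
      ext ζ; simpa using hV ζ
    rw [this]
    exact isClosed_iInter fun m => isClosed_eq (ρ (c * m)).continuous continuous_const
  rcases hρ.2 V hcl (fun x ζ hζ => by
    rw [hV] at hζ ⊢
    intro m
    rw [← mul_apply_eq_comp, ← map_mul, mul_assoc]
    exact hζ _) with h' | h'
  · right
    ext ζ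
    have : ρ d ζ ∈ V := by
      rw [hV]; intro m
      rw [← mul_apply_eq_comp, ← map_mul, mul_assoc, h]; rfl
    rw [h'] at this
    simpa using this
  · left
    ext ζ
    have : ζ ∈ V := by rw [h']; trivial
    rw [hV] at this
    simpa using this 1

end IdealReps

/-! ### Representations of algebras of functions with compact values -/

section ZeroAtInfty

variable {Y : Type*} [TopologicalSpace Y]

section Cutoff

variable {E : Type*} [NormedAddCommGroup E] [NormedSpace ℂ E]

/-- The product of a function vanishing at infinity and a continuous function with values in
`[-1, 1]`. -/
noncomputable def ZeroAtInftyContinuousMap.cutoff (g : C(Y, ℝ)) (hg : ∀ y, |g y| ≤ 1) (f : C₀(Y, E)) :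
    C₀(Y, E) where
  toFun y := ((g y : ℝ) : ℂ) • f y
  continuous_toFun := (Complex.continuous_ofReal.comp g.continuous).smul (map_continuous f)
  zero_at_infty' := by
    refine squeeze_zero_norm (fun y => ?_) (tendsto_zero_iff_norm_tendsto_zero.1 (zero_at_infty f))
    rw [norm_smul, Complex.norm_real]
    exact mul_le_of_le_one_left (norm_nonneg _) (hg y)

theorem ZeroAtInftyContinuousMap.cutoff_apply (g : C(Y, ℝ)) (hg : ∀ y, |g y| ≤ 1) (f : C₀(Y, E))
    (y : Y) : ZeroAtInftyContinuousMap.cutoff g hg f y = ((g y : ℝ) : ℂ) • f y := rfl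

/-- Uniform approximation of `f` by functions that vanish where `f` is small. -/
theorem ZeroAtInftyContinuousMap.exists_truncation (f : C₀(Y, E)) {δ : ℝ} (hδ : 0 < δ) :
    ∃ f' : C₀(Y, E), (∀ y, ‖f y - f' y‖ ≤ δ) ∧ ∀ y, ‖f y‖ ≤ δ → f' y = 0 := by
  let g : C(Y, ℝ) := ⟨fun y => max (‖f y‖ - δ) 0 / max ‖f y‖ δ, by
    refine Continuous.div₀ (((map_continuous f).norm.sub continuous_const).max continuous_const)
      ((map_continuous f).norm.max continuous_const) fun y => ?_
    exact (lt_max_of_lt_right hδ).ne'⟩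
  have hgy : ∀ y, g y = max (‖f y‖ - δ) 0 / max ‖f y‖ δ := fun y => rfl
  have hg0 : ∀ y, 0 ≤ g y := fun y => by
    rw [hgy]; exact div_nonneg (le_max_right _ _) (hδ.le.trans (le_max_right _ _))
  have hg1 : ∀ y, |g y| ≤ 1 := fun y => by
    rw [abs_of_nonneg (hg0 y), hgy, div_le_one (lt_max_of_lt_right hδ)]
    exact max_le ((sub_le_self _ hδ.le).trans (le_max_left _ _)) (hδ.le.trans (le_max_right _ _))
  refine ⟨cutoff g hg1 f, fun y => ?_, fun y hy => ?_⟩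
  · rw [cutoff_apply]
    have e : f y - ((g y : ℝ) : ℂ) • f y = ((1 - g y : ℝ) : ℂ) • f y := by
      push_cast; rw [sub_smul, one_smul]
    rw [e, norm_smul, Complex.norm_real, Real.norm_of_nonneg (by linarith [le_abs_self (g y), hg1 y])]
    rcases le_total ‖f y‖ δ with h | h
    · have : g y = 0 := by rw [hgy, max_eq_right (by linarith)]; simp
      rw [this]; linarith
    · have hpos : 0 < ‖f y‖ := hδ.trans_le h
      rw [hgy, max_eq_left (by linarith), max_eq_left h]
      have : (1 - (‖f y‖ - δ) / ‖f y‖) * ‖f y‖ = δ := by field_simp; ring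
      exact this.le
  · rw [cutoff_apply]
    have : g y = 0 := by rw [hgy, max_eq_right (by linarith)]; simp
    rw [this]; simp

omit [NormedSpace ℂ E] in
theorem ZeroAtInftyContinuousMap.isCompact_norm_ge (f : C₀(Y, E)) {ε : ℝ} (hε : 0 < ε) :
    IsCompact {y | ε ≤ ‖f y‖} := by
  have h := tendsto_zero_iff_norm_tendsto_zero.1 (zero_at_infty f)
  have h2 : ∀ᶠ y in cocompact Y, ‖f y‖ < ε := h.eventually (gt_mem_nhds hε)
  obtain ⟨C, hC, hC'⟩ := mem_cocompact.1 h2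
  refine hC.of_isClosed_subset (isClosed_le continuous_const (map_continuous f).norm) ?_
  intro y hy
  by_contra hyC
  exact absurd (show ‖f y‖ < ε from hC' hyC) (not_lt.2 hy)

omit [NormedSpace ℂ E] in
theorem ZeroAtInftyContinuousMap.norm_le_of_forall (f : C₀(Y, E)) {C : ℝ} (hC : 0 ≤ C)
    (h : ∀ y, ‖f y‖ ≤ C) : ‖f‖ ≤ C := by
  rw [← ZeroAtInftyContinuousMap.norm_toBCF_eq_norm]
  exact (BoundedContinuousFunction.norm_le hC).2 h

/-- A function vanishing at infinity is, up to a uniform error `ε`, a finite sum of functions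
supported in the members of a given open cover of `{y | ε ≤ ‖f y‖}`. -/
theorem ZeroAtInftyContinuousMap.exists_sum_subordinate [TopologicalSpace.MetrizableSpace Y]
    (f : C₀(Y, E)) {ε : ℝ} (hε : 0 < ε) (U : Y → Set Y) (hUo : ∀ y, IsOpen (U y))
    (hyU : ∀ y, y ∈ U y) : ∃ (t : Finset Y) (g : t → C₀(Y, E)),
      (∀ i : t, ∀ x ∉ U i, g i x = 0) ∧ ‖f - ∑ i, g i‖ ≤ ε := by
  obtain ⟨t, ht⟩ := (f.isCompact_norm_ge hε).elim_finite_subcover U hUo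
    (fun y _ => Set.mem_iUnion.2 ⟨y, hyU y⟩)
  have hcover : {y | ε ≤ ‖f y‖} ⊆ ⋃ i : t, U i := by
    intro y hy
    obtain ⟨i, hi, hyi⟩ := Set.mem_iUnion₂.1 (ht hy)
    exact Set.mem_iUnion.2 ⟨⟨i, hi⟩, hyi⟩
  let := TopologicalSpace.metrizableSpaceMetric Y
  obtain ⟨P, hP⟩ := PartitionOfUnity.exists_isSubordinate
    (isClosed_le continuous_const (map_continuous f).norm) (fun i : t => U i)
    (fun i => hUo i) hcover
  have hP1 : ∀ (i : t) y, |P i y| ≤ 1 := fun i y => by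
    rw [abs_of_nonneg (P.nonneg i y)]; exact P.le_one i y
  refine ⟨t, fun i => cutoff (P i) (hP1 i) f, fun i x hx => ?_, ?_⟩
  · have : P i x = 0 := by
      by_contra hne
      exact hx (hP i (subset_tsupport _ hne))
    rw [cutoff_apply, this]; simp
  · refine norm_le_of_forall _ hε.le fun y => ?_
    have hgy : (∑ i, cutoff (P i) (hP1 i) f) y = ((∑ i : t, P i y : ℝ) : ℂ) • f y := by
      push_cast
      rw [Finset.sum_smul]
      have : ∀ s : Finset t, (∑ i ∈ s, cutoff (P i) (hP1 i) f) y
          = ∑ i ∈ s, ((P i y : ℝ) : ℂ) • f y := by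
        classical
        intro s
        induction s using Finset.induction_on with
        | empty => simp
        | insert i s his ih =>
          rw [Finset.sum_insert his, Finset.sum_insert his, ← ih]; rfl
      exact this _
    have hs : ∑ᶠ i, P i y = ∑ i : t, P i y := finsum_eq_sum_of_fintype _
    have e : (f - ∑ i, cutoff (P i) (hP1 i) f) y = ((1 - ∑ i : t, P i y : ℝ) : ℂ) • f y := by
      rw [ZeroAtInftyContinuousMap.sub_apply, hgy, Complex.ofReal_sub, sub_smul]; simp
    rw [e, norm_smul, Complex.norm_real]
    by_cases hy : ε ≤ ‖f y‖
    · rw [← hs, P.sum_eq_one hy]; simp [hε.le]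
    · have h1 := P.sum_le_one y
      have h0 := P.sum_nonneg y
      rw [hs] at h1 h0
      rw [Real.norm_of_nonneg (by linarith)]
      have := norm_nonneg (f y)
      nlinarith

end Cutoff

section Ev

variable {H₀ : Type*} [NormedAddCommGroup H₀] [InnerProductSpace ℂ H₀] [CompleteSpace H₀]

/-- Evaluation at a point `y`, as a representation of `C₀(Y, K(H₀))` on `H₀`. -/
noncomputable def evalRep (y : Y) : C₀(Y, compactOperators H₀) →⋆ₙₐ[ℂ] (H₀ →L[ℂ] H₀) where
  toFun f := f y
  map_smul' _ _ := rfl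
  map_zero' := rfl
  map_add' _ _ := rfl
  map_mul' _ _ := rfl
  map_star' _ := rfl

theorem evalRep_apply (y : Y) (f : C₀(Y, compactOperators H₀)) :
    evalRep y f = (f y : H₀ →L[ℂ] H₀) := rfl

theorem evalRep_eq_zero_iff (y : Y) (f : C₀(Y, compactOperators H₀)) :
    evalRep y f = 0 ↔ f y = 0 := by
  rw [evalRep_apply]; exact ZeroMemClass.coe_eq_zero

omit [CompleteSpace H₀] in
theorem isCompactOperator_rankOne (η ξ : H₀) :
    IsCompactOperator (InnerProductSpace.rankOne ℂ η ξ : H₀ →L[ℂ] H₀) := by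
  rw [InnerProductSpace.rankOne_def']
  have h1 : IsCompactOperator (ContinuousLinearMap.toSpanSingleton ℂ η : ℂ →L[ℂ] H₀) :=
    ⟨_, (isCompact_closedBall (0 : ℂ) 1).image
      (ContinuousLinearMap.toSpanSingleton ℂ η : ℂ →L[ℂ] H₀).continuous,
      Filter.mem_of_superset (Metric.closedBall_mem_nhds 0 one_pos)
        (Set.subset_preimage_image _ _)⟩
  exact h1.comp_clm _

/-- Compact operators are norm limits of sums of rank one operators. -/
theorem IsCompactOperator.exists_sum_rankOne {k : H₀ →L[ℂ] H₀} (hk : IsCompactOperator k)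
    {ε : ℝ} (hε : 0 < ε) : ∃ (n : ℕ) (u v : Fin n → H₀),
      ‖k - ∑ i, InnerProductSpace.rankOne ℂ (u i) (v i)‖ ≤ ε := by
  have h1 : TotallyBounded (k '' Metric.closedBall 0 1) :=
    (IsCompactOperator.isCompact_closure_image_closedBall hk 1).totallyBounded.subset
      subset_closure
  obtain ⟨t, htfin, htcov⟩ := Metric.totallyBounded_iff.1 h1 ε hε
  let F : Submodule ℂ H₀ := Submodule.span ℂ t
  have : FiniteDimensional ℂ F := FiniteDimensional.span_of_finite ℂ htfin
  let b := stdOrthonormalBasis ℂ F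
  refine ⟨_, fun i => (b i : H₀), fun i => ContinuousLinearMap.adjoint k (b i), ?_⟩
  have e : ∑ i, InnerProductSpace.rankOne ℂ (b i : H₀) (ContinuousLinearMap.adjoint k (b i))
      = F.starProjection ∘L k := by
    rw [b.starProjection_eq_sum_rankOne, ContinuousLinearMap.finsetSum_comp]
    simp_rw [InnerProductSpace.rankOne_comp]
  rw [e]
  refine ContinuousLinearMap.opNorm_le_of_unit_norm hε.le fun x hx => ?_
  obtain ⟨y, hy, hxy⟩ := Set.mem_iUnion₂.1 (htcov ⟨x, by simp [hx], rfl⟩)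
  rw [sub_apply, ContinuousLinearMap.comp_apply,
    Submodule.starProjection_minimal]
  refine (ciInf_le ⟨0, ?_⟩ (⟨y, Submodule.subset_span hy⟩ : F)).trans ?_
  · rintro _ ⟨z, rfl⟩; exact norm_nonneg _
  · rw [Metric.mem_ball, dist_eq_norm] at hxy
    exact hxy.le

end Ev

section Factor

variable {M : Type*} [CStarAlgebra M] [PartialOrder M] [StarOrderedRing M]
  {H₀ : Type*} [NormedAddCommGroup H₀] [InnerProductSpace ℂ H₀] [CompleteSpace H₀]
  {H : Type*} [NormedAddCommGroup H] [InnerProductSpace ℂ H] [CompleteSpace H]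

omit [PartialOrder M] [StarOrderedRing M] in
theorem norm_rep_apply_le (φ : C₀(Y, compactOperators H₀) →⋆ₙₐ[ℂ] M)
    (ρ : M →⋆ₐ[ℂ] (H →L[ℂ] H)) (f : C₀(Y, compactOperators H₀)) : ‖ρ (φ f)‖ ≤ ‖f‖ := by
  let : NonUnitalCStarAlgebra C₀(Y, compactOperators H₀) := {}
  exact (NonUnitalStarAlgHom.norm_apply_le ρ (φ f)).trans (NonUnitalStarAlgHom.norm_apply_le φ f)

theorem mul_mul_eq_zero_of_disjoint {φ : C₀(Y, compactOperators H₀) →⋆ₙₐ[ℂ] M}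
    (hφ : Function.Injective φ) (hideal : ∀ m x, ∃ x', φ x' = m * φ x)
    {f f' : C₀(Y, compactOperators H₀)} (h : ∀ y, f y = 0 ∨ f' y = 0) (m : M) :
    φ f * (m * φ f') = 0 := by
  obtain ⟨g, hg⟩ := hideal m f'
  rw [← hg, ← map_mul]
  have : f * g = 0 := by
    ext1 y
    change f y * g y = 0
    rcases h y with h | h
    · rw [h, zero_mul]
    · have : g y = 0 := by
        rw [← evalRep_eq_zero_iff]
        ext ζ
        have := norm_apply_le_of_eq_mul φ hφ hideal (evalRep y) hg ζ
        rw [(evalRep_eq_zero_iff y f').2 h] at this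
        simpa using this
      rw [this, mul_zero]
  rw [this, map_zero]

/-- The restriction of an irreducible representation to an ideal `C₀(Y, K(H₀))` factors through
the evaluation at some point: otherwise every point has a neighbourhood `U` such that all
functions supported in `U` are annihilated, by primeness of the kernel, and a partition of unity
shows that everything is annihilated. -/
theorem IsIrreducibleRep.exists_factor_eval [TopologicalSpace.MetrizableSpace Y]
    {φ : C₀(Y, compactOperators H₀) →⋆ₙₐ[ℂ] M}
    (hφ : Function.Injective φ) (hideal : ∀ m x, ∃ x', φ x' = m * φ x)
    {ρ : M →⋆ₐ[ℂ] (H →L[ℂ] H)} (hρ : IsIrreducibleRep ρ)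
    (hne : ∃ f, ρ (φ f) ≠ 0) : ∃ y, ∀ f, f y = 0 → ρ (φ f) = 0 := by
  by_contra! hcon
  obtain ⟨f₀, hf₀⟩ := hne
  have hclose : ∀ (f f' : C₀(Y, compactOperators H₀)) (δ : ℝ), 0 ≤ δ → (∀ y, ‖f y - f' y‖ ≤ δ) →
      ‖ρ (φ f)‖ ≤ ‖ρ (φ f')‖ + δ := by
    intro f f' δ hδ h
    have h1 := norm_rep_apply_le φ ρ (f - f')
    have h2 : ‖f - f'‖ ≤ δ := ZeroAtInftyContinuousMap.norm_le_of_forall _ hδ h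
    rw [map_sub, map_sub] at h1
    have h3 := norm_le_norm_add_norm_sub' (ρ (φ f)) (ρ (φ f'))
    linarith
  have hloc : ∀ y, ∃ U : Set Y, IsOpen U ∧ y ∈ U ∧
      ∀ f : C₀(Y, compactOperators H₀), (∀ x ∉ U, f x = 0) → ρ (φ f) = 0 := by
    intro y
    obtain ⟨f, hfy, hf⟩ := hcon y
    have hpos : 0 < ‖ρ (φ f)‖ := norm_pos_iff.2 hf
    obtain ⟨f', hf', hf'0⟩ := f.exists_truncation (half_pos hpos)
    have hne' : ρ (φ f') ≠ 0 := by
      intro h0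
      have := hclose f f' _ (half_pos hpos).le hf'
      rw [h0, norm_zero] at this
      linarith
    refine ⟨{x | ‖f x‖ < ‖ρ (φ f)‖ / 2}, isOpen_lt (map_continuous f).norm continuous_const,
      by simp [hfy, hf], fun g hg => ?_⟩
    refine (hρ.eq_zero_or_eq_zero (c := φ f') (d := φ g) fun m => ?_).resolve_left hne'
    rw [mul_mul_eq_zero_of_disjoint hφ hideal, map_zero]
    intro x
    by_cases hx : ‖f x‖ < ‖ρ (φ f)‖ / 2
    · exact Or.inl (hf'0 x hx.le)
    · exact Or.inr (hg x hx)
  choose U hUo hyU hU using hloc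
  have hpos : 0 < ‖ρ (φ f₀)‖ := norm_pos_iff.2 hf₀
  set ε := ‖ρ (φ f₀)‖ / 2 with hε
  have hεpos : 0 < ε := half_pos hpos
  obtain ⟨t, g, hg, hfg⟩ := f₀.exists_sum_subordinate hεpos U hUo hyU
  have hg0 : ρ (φ (∑ i, g i)) = 0 := by
    rw [map_sum, map_sum]
    exact Finset.sum_eq_zero fun i _ => hU i _ (hg i)
  have h1 := norm_rep_apply_le φ ρ (f₀ - ∑ i, g i)
  rw [map_sub, map_sub, hg0, sub_zero] at h1
  linarith

end Factor

end ZeroAtInfty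

/-! ### Representations given by evaluation at points -/

section IdealSpectrum

variable {Y : Type*} [TopologicalSpace Y] {M : Type*} [CStarAlgebra M]
  {H₀ : Type*} [NormedAddCommGroup H₀] [InnerProductSpace ℂ H₀] [CompleteSpace H₀]
  {H : Type*} [NormedAddCommGroup H] [InnerProductSpace ℂ H] [CompleteSpace H]

/-- The rank one operator `ζ ↦ ⟪ξ, ζ⟫ η`, as an element of the algebra of compact operators. -/
noncomputable def compactRankOne (η ξ : H₀) : compactOperators H₀ :=
  ⟨InnerProductSpace.rankOne ℂ η ξ, isCompactOperator_rankOne η ξ⟩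

theorem coe_compactRankOne (η ξ : H₀) :
    (compactRankOne η ξ : H₀ →L[ℂ] H₀) = InnerProductSpace.rankOne ℂ η ξ := rfl

theorem exists_zeroAtInfty_apply_eq {E F : Type*} [NormedAddCommGroup E] [NormedAddCommGroup F]
    [NormedSpace ℂ F] {y : Y} {f : C₀(Y, E)} (hf : f y ≠ 0) (k : F) :
    ∃ g : C₀(Y, F), g y = k := by
  have hpos : ‖f y‖ ≠ 0 := norm_ne_zero_iff.2 hf
  refine ⟨⟨⟨fun x => ((‖f x‖ / ‖f y‖ : ℝ) : ℂ) • k, ?_⟩, ?_⟩, ?_⟩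
  · exact (Complex.continuous_ofReal.comp ((map_continuous f).norm.div_const _)).smul
      continuous_const
  · have h := tendsto_zero_iff_norm_tendsto_zero.1 (zero_at_infty f)
    have h2 : Tendsto (fun x => ((‖f x‖ / ‖f y‖ : ℝ) : ℂ) • k) (cocompact Y)
        (𝓝 (((0 / ‖f y‖ : ℝ) : ℂ) • k)) :=
      ((Complex.continuous_ofReal.tendsto _).comp (h.div_const _)).smul_const k
    simpa using h2
  · change ((‖f y‖ / ‖f y‖ : ℝ) : ℂ) • k = k
    rw [div_self hpos, Complex.ofReal_one, one_smul]

/-- A representation of `M` that restricts to the evaluation at a point on an ideal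
`C₀(Y, K(H₀))` is irreducible. -/
theorem isIrreducibleRep_of_eval {φ : C₀(Y, compactOperators H₀) →⋆ₙₐ[ℂ] M} {y : Y}
    (hy : ∃ f : C₀(Y, compactOperators H₀), f y ≠ 0) {π : M →⋆ₐ[ℂ] (H₀ →L[ℂ] H₀)}
    (hπ : ∀ f, π (φ f) = f y) : IsIrreducibleRep π := by
  obtain ⟨f, hf⟩ := hy
  have hnt : Nontrivial H₀ := by
    by_contra h
    rw [not_nontrivial_iff_subsingleton] at h
    exact hf (Subtype.ext (Subsingleton.elim _ _))
  refine ⟨hnt, fun V _ hV => ?_⟩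
  by_cases hbot : V = ⊥
  · exact Or.inl hbot
  right
  obtain ⟨ζ, hζV, hζ⟩ := (Submodule.ne_bot_iff V).1 hbot
  rw [eq_top_iff]
  intro η _
  obtain ⟨g, hg⟩ := exists_zeroAtInfty_apply_eq hf (compactRankOne η ζ)
  have h := hV (φ g) ζ hζV
  rw [hπ, hg, coe_compactRankOne, InnerProductSpace.rankOne_apply] at h
  exact (V.smul_mem_iff (inner_self_ne_zero.2 hζ)).1 h

/-- Every point at which the algebra `C₀(Y, K(H₀))` does not vanish gives an irreducible
representation of `M`. -/
theorem exists_rep_eval [PartialOrder M] [StarOrderedRing M]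
    {φ : C₀(Y, compactOperators H₀) →⋆ₙₐ[ℂ] M}
    (hφ : Function.Injective φ) (hideal : ∀ m x, ∃ x', φ x' = m * φ x) {y : Y}
    (hy : ∃ f : C₀(Y, compactOperators H₀), f y ≠ 0) :
    ∃ π : M →⋆ₐ[ℂ] (H₀ →L[ℂ] H₀), IsIrreducibleRep π ∧ ∀ f, π (φ f) = f y := by
  obtain ⟨f, hf⟩ := hy
  have : ∃ ξ : H₀, ξ ≠ 0 := by
    by_contra! h
    exact hf (Subtype.ext (by ext ζ; rw [h ζ]; simp))
  obtain ⟨ξ, hξ⟩ := this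
  obtain ⟨π, hπ⟩ := exists_extension φ hφ hideal (evalRep y) ((inner ℂ ξ ξ)⁻¹ • ξ) (fun η => by
    obtain ⟨g, hg⟩ := exists_zeroAtInfty_apply_eq hf (compactRankOne η ξ)
    refine ⟨g, ?_⟩
    rw [evalRep_apply, hg, coe_compactRankOne, InnerProductSpace.rankOne_apply, inner_smul_right,
      inv_mul_cancel₀ (inner_self_ne_zero.2 hξ), one_smul])
  exact ⟨π, isIrreducibleRep_of_eval ⟨f, hf⟩ hπ, hπ⟩

omit [CompleteSpace H₀] in
theorem rankOne_mul_rankOne (a b c d : H₀) :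
    (InnerProductSpace.rankOne ℂ a b * InnerProductSpace.rankOne ℂ c d : H₀ →L[ℂ] H₀)
      = inner ℂ b c • InnerProductSpace.rankOne ℂ a d :=
  InnerProductSpace.rankOne_comp_rankOne a b c d

theorem exists_factor_compactOperators {φ : C₀(Y, compactOperators H₀) →⋆ₙₐ[ℂ] M} {y : Y}
    {ρ : M →⋆ₐ[ℂ] (H →L[ℂ] H)} (hne : ∃ f, ρ (φ f) ≠ 0) (hy : ∀ f, f y = 0 → ρ (φ f) = 0) :
    ∃ τ : compactOperators H₀ →⋆ₙₐ[ℂ] (H →L[ℂ] H), ∀ f, ρ (φ f) = τ (f y) := by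
  obtain ⟨f₀, hf₀⟩ := hne
  have hf₀y : f₀ y ≠ 0 := fun h => hf₀ (hy _ h)
  have hex : ∀ k : compactOperators H₀, ∃ g : C₀(Y, compactOperators H₀), g y = k := fun k =>
    exists_zeroAtInfty_apply_eq hf₀y k
  choose e he using hex
  let τ : compactOperators H₀ → (H →L[ℂ] H) := fun k => ρ (φ (e k))
  have hτ : ∀ f, ρ (φ f) = τ (f y) := by
    intro f
    rw [← sub_eq_zero, ← map_sub, ← map_sub]
    refine hy _ ?_
    rw [ZeroAtInftyContinuousMap.sub_apply, he, sub_self]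
  have hτadd : ∀ k l, τ (k + l) = τ k + τ l := fun k l => by
    have := hτ (e k + e l)
    rw [ZeroAtInftyContinuousMap.add_apply, he, he, map_add, map_add] at this
    exact this.symm
  have hτsmul : ∀ (c : ℂ) k, τ (c • k) = c • τ k := fun c k => by
    have := hτ (c • e k)
    rw [ZeroAtInftyContinuousMap.smul_apply, he, map_smul, map_smul] at this
    exact this.symm
  have hτmul : ∀ k l, τ (k * l) = τ k * τ l := fun k l => by
    have := hτ (e k * e l)
    rw [ZeroAtInftyContinuousMap.mul_apply, he, he, map_mul, map_mul] at this
    exact this.symm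
  have hτstar : ∀ k, τ (star k) = star (τ k) := fun k => by
    have := hτ (star (e k))
    rw [ZeroAtInftyContinuousMap.star_apply, he, map_star, map_star] at this
    exact this.symm
  have hτzero : τ 0 = 0 := by simpa using hτsmul 0 0
  let τ' : compactOperators H₀ →⋆ₙₐ[ℂ] (H →L[ℂ] H) :=
    { toFun := τ, map_smul' := hτsmul, map_zero' := hτzero, map_add' := hτadd,
      map_mul' := hτmul, map_star' := hτstar }
  exact ⟨τ', hτ⟩

/-- A nonzero representation of the compact operators does not annihilate all rank one
operators, as these span a dense subspace. -/
theorem exists_compactRankOne_ne_zero {τ : compactOperators H₀ →⋆ₙₐ[ℂ] (H →L[ℂ] H)}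
    (hne : ∃ k, τ k ≠ 0) : ∃ u v : H₀, τ (compactRankOne u v) ≠ 0 := by
  obtain ⟨k, hk⟩ := hne
  have hτnorm : ∀ k, ‖τ k‖ ≤ ‖(k : H₀ →L[ℂ] H₀)‖ := fun k =>
    NonUnitalStarAlgHom.norm_apply_le τ k
  by_contra! hcon
  apply hk
  rw [← norm_le_zero_iff]
  refine le_of_forall_pos_le_add fun ε hε => ?_
  obtain ⟨n, u, v, huv⟩ := IsCompactOperator.exists_sum_rankOne k.2 hε
  have h0 : τ (∑ i, compactRankOne (u i) (v i)) = 0 := by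
    rw [map_sum]
    exact Finset.sum_eq_zero fun i _ => hcon _ _
  have h1 := hτnorm (k - ∑ i, compactRankOne (u i) (v i))
  rw [map_sub, h0, sub_zero] at h1
  rw [zero_add]
  refine h1.trans (le_trans (le_of_eq ?_) huv)
  congr 1
  simp [coe_compactRankOne]

/-- A nonzero representation `τ` of the compact operators contains the identity representation:
for suitable `u` and `ζ`, the map `η ↦ τ(η ⊗ u*) ζ` is isometric. -/
theorem exists_isometric_vector {τ : compactOperators H₀ →⋆ₙₐ[ℂ] (H →L[ℂ] H)}
    (hne : ∃ k, τ k ≠ 0) : ∃ u : H₀, u ≠ 0 ∧ ∃ ζ : H, ∀ η η' : H₀,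
      inner ℂ (τ (compactRankOne η u) ζ) (τ (compactRankOne η' u) ζ) = (inner ℂ η η' : ℂ) := by
  obtain ⟨u, v, huv⟩ := exists_compactRankOne_ne_zero hne
  have hu : u ≠ 0 := by
    rintro rfl
    apply huv
    have : compactRankOne (0 : H₀) v = 0 := Subtype.ext (by simp [coe_compactRankOne])
    rw [this, map_zero]
  obtain ⟨ζ', hζ'⟩ : ∃ ζ', τ (compactRankOne u v) ζ' ≠ 0 := by
    by_contra! h
    exact huv (by ext ζ'; simpa using h ζ')
  obtain ⟨ζ, hζ, hζn⟩ : ∃ ζ, τ (compactRankOne u u) ζ = (inner ℂ u u : ℂ) • ζ ∧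
      inner ℂ ζ ζ * inner ℂ u u = (1 : ℂ) := by
    have hmul : compactRankOne u u * compactRankOne u v = (inner ℂ u u : ℂ) • compactRankOne u v :=
      Subtype.ext (rankOne_mul_rankOne _ _ _ _)
    set ζ₁ := τ (compactRankOne u v) ζ' with hζ₁
    have h1 : τ (compactRankOne u u) ζ₁ = (inner ℂ u u : ℂ) • ζ₁ := by
      rw [hζ₁, ← mul_apply_eq_comp, ← map_mul, hmul, map_smul]; rfl
    refine ⟨(((‖ζ₁‖ * ‖u‖)⁻¹ : ℝ) : ℂ) • ζ₁, ?_, ?_⟩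
    · rw [map_smul, h1, smul_comm]
    · have hn : (‖ζ₁‖ : ℂ) ≠ 0 := by simpa using hζ'
      have hun : (‖u‖ : ℂ) ≠ 0 := by simpa using hu
      rw [inner_smul_left, inner_smul_right, Complex.conj_ofReal, inner_self_eq_norm_sq_to_K,
        inner_self_eq_norm_sq_to_K]
      push_cast
      have hr : (RCLike.ofReal ‖ζ₁‖ : ℂ) = (‖ζ₁‖ : ℂ) := rfl
      have hr' : (RCLike.ofReal ‖u‖ : ℂ) = (‖u‖ : ℂ) := rfl
      rw [hr, hr']
      generalize (‖ζ₁‖ : ℂ) = x at *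
      generalize (‖u‖ : ℂ) = z at *
      field_simp
  refine ⟨u, hu, ζ, fun η η' => ?_⟩
  have hm : star (compactRankOne η' u) * compactRankOne η u
      = (inner ℂ η' η : ℂ) • compactRankOne u u := by
    apply Subtype.ext
    change star (InnerProductSpace.rankOne ℂ η' u) * InnerProductSpace.rankOne ℂ η u = _
    rw [ContinuousLinearMap.star_eq_adjoint, InnerProductSpace.adjoint_rankOne,
      rankOne_mul_rankOne]
    rfl
  rw [← inner_apply_star_mul, ← map_star, ← map_mul, hm, map_smul, smul_apply, hζ,
    inner_smul_left, inner_smul_left, inner_conj_symm, inner_conj_symm, mul_comm (inner ℂ u u),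
    hζn, mul_one]

/-- An irreducible representation of `M` whose restriction to the ideal `C₀(Y, K(H₀))` factors
through the evaluation at `y` is unitarily equivalent to the representation on `H₀` given by
`y`: the intertwining unitary maps `η` to `(η ⊗ ξ*) ζ` for suitable vectors `ξ` and `ζ`. -/
theorem exists_unitary_of_factor_eval {φ : C₀(Y, compactOperators H₀) →⋆ₙₐ[ℂ] M}
    (hideal : ∀ m x, ∃ x', φ x' = m * φ x) {y : Y}
    {π : M →⋆ₐ[ℂ] (H₀ →L[ℂ] H₀)} (hπ : ∀ f, π (φ f) = f y)
    {ρ : M →⋆ₐ[ℂ] (H →L[ℂ] H)} (hρ : IsIrreducibleRep ρ)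
    (hne : ∃ f, ρ (φ f) ≠ 0) (hy : ∀ f, f y = 0 → ρ (φ f) = 0) :
    ∃ W : H₀ ≃ₗᵢ[ℂ] H, ∀ m η, W (π m η) = ρ m (W η) := by
  obtain ⟨f₀, hf₀⟩ := hne
  have hf₀y : f₀ y ≠ 0 := fun h => hf₀ (hy _ h)
  obtain ⟨τ, hτ⟩ := exists_factor_compactOperators ⟨f₀, hf₀⟩ hy
  obtain ⟨u, hu, ζ, hinner⟩ := exists_isometric_vector ⟨f₀ y, by rwa [← hτ]⟩
  choose e he using fun k : compactOperators H₀ =>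
    exists_zeroAtInfty_apply_eq (F := compactOperators H₀) hf₀y k
  let W₀ : H₀ →ₗ[ℂ] H :=
    { toFun := fun η => τ (compactRankOne η u) ζ
      map_add' := fun η η' => by
        have : compactRankOne (η + η') u = compactRankOne η u + compactRankOne η' u :=
          Subtype.ext (by simp [coe_compactRankOne])
        rw [this, map_add, add_apply]
      map_smul' := fun c η => by
        have : compactRankOne (c • η) u = c • compactRankOne η u :=
          Subtype.ext (by simp [coe_compactRankOne])
        rw [this, map_smul, smul_apply, RingHom.id_apply] }
  let W₁ : H₀ →ₗᵢ[ℂ] H := LinearMap.isometryOfInner W₀ hinner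
  have hW₁ : ∀ η, W₁ η = τ (compactRankOne η u) ζ := fun _ => rfl
  have hint : ∀ m η, W₁ (π m η) = ρ m (W₁ η) := by
    intro m η
    obtain ⟨g, hg⟩ := hideal m (e (compactRankOne η u))
    have h1 : (g y : H₀ →L[ℂ] H₀) = InnerProductSpace.rankOne ℂ (π m η) u := by
      rw [← hπ, hg, map_mul, hπ, he, coe_compactRankOne]
      exact InnerProductSpace.comp_rankOne _ _ _
    have h2 : g y = compactRankOne (π m η) u := Subtype.ext h1
    rw [hW₁, hW₁, ← h2, ← hτ, hg, map_mul, hτ (e _), he, mul_apply_eq_comp]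
  have hsurj : Function.Surjective W₁ := by
    have hcl : IsClosed ((LinearMap.range W₁.toLinearMap : Submodule ℂ H) : Set H) := by
      rw [LinearMap.coe_range]
      exact W₁.isometry.isClosedEmbedding.isClosed_range
    rcases hρ.2 _ hcl (by
      rintro m _ ⟨η, rfl⟩
      exact ⟨π m η, hint m η⟩) with h | h
    · exfalso
      have h3 : W₁ u ∈ LinearMap.range W₁.toLinearMap := ⟨u, rfl⟩
      rw [h, Submodule.mem_bot] at h3
      exact hu (W₁.injective (by rw [h3, map_zero]))
    · exact LinearMap.range_eq_top.1 h
  exact ⟨LinearIsometryEquiv.ofSurjective W₁ hsurj, hint⟩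

end IdealSpectrum

/-! ### The spectrum of an ideal of functions with compact values -/

section IdealSpectrumOfIso

variable {M : Type u} [CStarAlgebra M] {H₀ : Type u} [NormedAddCommGroup H₀]
  [InnerProductSpace ℂ H₀] [CompleteSpace H₀]

theorem norm_apply_eq_of_spectrumClass_eq {H H' : Type u} [NormedAddCommGroup H]
    [InnerProductSpace ℂ H] [CompleteSpace H] [NormedAddCommGroup H']
    [InnerProductSpace ℂ H'] [CompleteSpace H'] {π : M →⋆ₐ[ℂ] (H →L[ℂ] H)}
    {hπ : IsIrreducibleRep π} {π' : M →⋆ₐ[ℂ] (H' →L[ℂ] H')} {hπ' : IsIrreducibleRep π'}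
    (h : spectrumClass π hπ = spectrumClass π' hπ') (x : M) : ‖π x‖ = ‖π' x‖ := by
  obtain ⟨W, hW⟩ := Quotient.exact h
  change ∀ x ξ, W (π x ξ) = π' x (W ξ) at hW
  refine le_antisymm ?_ ?_
  · refine ContinuousLinearMap.opNorm_le_bound _ (norm_nonneg _) fun ξ => ?_
    rw [← W.norm_map, hW, ← W.norm_map ξ]
    exact (π' x).le_opNorm _
  · refine ContinuousLinearMap.opNorm_le_bound _ (norm_nonneg _) fun ξ => ?_
    obtain ⟨ξ, rfl⟩ := W.surjective ξ
    rw [← hW, W.norm_map, W.norm_map]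
    exact (π x).le_opNorm _

theorem spectrumClass_mem_idealSpectrum {I : TwoSidedIdeal M} {H : Type u} [NormedAddCommGroup H]
    [InnerProductSpace ℂ H] [CompleteSpace H] {π : M →⋆ₐ[ℂ] (H →L[ℂ] H)}
    {hπ : IsIrreducibleRep π} :
    spectrumClass π hπ ∈ idealSpectrum I ↔ ∃ x ∈ I, π x ≠ 0 := by
  constructor
  · rintro ⟨ρ, hρ, x, hx, hne⟩
    refine ⟨x, hx, ?_⟩
    rw [← norm_ne_zero_iff] at hne ⊢
    rwa [← norm_apply_eq_of_spectrumClass_eq (π := ρ.π) (hπ := ρ.irreducible) (hπ' := hπ) hρ]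
  · rintro ⟨x, hx, hne⟩
    exact ⟨⟨H, π, hπ⟩, rfl, x, hx, hne⟩

variable [PartialOrder M] [StarOrderedRing M] {Y : Type*} [TopologicalSpace Y]
  {φ : C₀(Y, compactOperators H₀) →⋆ₙₐ[ℂ] M} {I : TwoSidedIdeal M}

omit [PartialOrder M] [StarOrderedRing M] in
theorem exists_eq_mul_of_range_eq (hrange : Set.range φ = (I : Set M)) (m : M)
    (f : C₀(Y, compactOperators H₀)) : ∃ g, φ g = m * φ f := by
  have h : φ f ∈ (I : Set M) := hrange ▸ ⟨f, rfl⟩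
  have h2 : m * φ f ∈ (I : Set M) := I.mul_mem_left _ _ h
  rwa [← hrange] at h2

/-- If `φ : C₀(Y, K(H₀)) ≃ I`, then every point of the spectrum of `I` is given by the evaluation
at some point of `Y`. -/
theorem exists_eval_of_mem_idealSpectrum [TopologicalSpace.MetrizableSpace Y]
    (hφ : Function.Injective φ) (hrange : Set.range φ = (I : Set M))
    {p : CStarSpectrum M} (hp : p ∈ idealSpectrum I) :
    ∃ (y : Y) (π : M →⋆ₐ[ℂ] (H₀ →L[ℂ] H₀)) (hπ : IsIrreducibleRep π),
      spectrumClass π hπ = p ∧ ∀ f, π (φ f) = f y := by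
  have hideal := exists_eq_mul_of_range_eq hrange
  obtain ⟨ρ, rfl, x, hx, hne⟩ := hp
  have hx' : x ∈ Set.range φ := by rw [hrange]; exact hx
  obtain ⟨f, rfl⟩ := hx'
  obtain ⟨y, hy⟩ := ρ.irreducible.exists_factor_eval hφ hideal ⟨f, hne⟩
  have hfy : f y ≠ 0 := fun h => hne (hy f h)
  obtain ⟨π, hπ, hπφ⟩ := exists_rep_eval hφ hideal ⟨f, hfy⟩
  obtain ⟨W, hW⟩ := exists_unitary_of_factor_eval hideal hπφ ρ.irreducible ⟨f, hne⟩ hy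
  exact ⟨y, π, hπ, Quotient.sound ⟨W, hW⟩, hπφ⟩

/-- The elements of an ideal `I ≃ C₀(Y, K(H₀))` are separated from zero by the irreducible
representations on `H₀`. -/
theorem eq_zero_of_forall_rep_eq_zero
    (hφ : Function.Injective φ) (hrange : Set.range φ = (I : Set M)) {x : M} (hx : x ∈ I)
    (h : ∀ (π : M →⋆ₐ[ℂ] (H₀ →L[ℂ] H₀)) (hπ : IsIrreducibleRep π),
      spectrumClass π hπ ∈ idealSpectrum I → π x = 0) : x = 0 := by
  have hx' : x ∈ Set.range φ := by rw [hrange]; exact hx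
  obtain ⟨f, rfl⟩ := hx'
  have : f = 0 := by
    ext1 y
    by_contra hne
    obtain ⟨π, hπ, hπφ⟩ := exists_rep_eval hφ (exists_eq_mul_of_range_eq hrange) ⟨f, hne⟩
    have hne' : π (φ f) ≠ 0 := by
      rw [hπφ]; exact fun h0 => hne (ZeroMemClass.coe_eq_zero.1 h0)
    exact hne' (h π hπ (spectrumClass_mem_idealSpectrum.2 ⟨_, hx, hne'⟩))
  rw [this, map_zero]

/-- For `x` in an ideal `I ≃ C₀(Y, K(H₀))`, the points of the spectrum of `I` at which `x` has
norm at least `ε` form a compact set: it is the image of a compact subset of `Y`. -/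
theorem isCompact_norm_ge_idealSpectrum [TopologicalSpace.MetrizableSpace Y]
    (hφ : Function.Injective φ) (hrange : Set.range φ = (I : Set M)) {x : M} (hx : x ∈ I)
    {ε : ℝ} (hε : 0 < ε) :
    IsCompact {p | p ∈ idealSpectrum I ∧ ∃ (π : M →⋆ₐ[ℂ] (H₀ →L[ℂ] H₀))
      (hπ : IsIrreducibleRep π), spectrumClass π hπ = p ∧ ε ≤ ‖π x‖} := by
  have hideal := exists_eq_mul_of_range_eq hrange
  set E := {p | p ∈ idealSpectrum I ∧ ∃ (π : M →⋆ₐ[ℂ] (H₀ →L[ℂ] H₀))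
      (hπ : IsIrreducibleRep π), spectrumClass π hπ = p ∧ ε ≤ ‖π x‖} with hE
  rcases E.eq_empty_or_nonempty with h | ⟨p₀, -⟩
  · rw [h]; exact isCompact_empty
  have hx' : x ∈ Set.range φ := by rw [hrange]; exact hx
  obtain ⟨f, rfl⟩ := hx'
  set C : Set Y := {y | ε ≤ ‖f y‖} with hC
  have hCne : ∀ y ∈ C, f y ≠ 0 := fun y hy h => by
    rw [hC, Set.mem_ofPred_eq, h, norm_zero] at hy; linarith
  have hex : ∀ y, ∃ p : CStarSpectrum M, y ∈ C → ∃ (π : M →⋆ₐ[ℂ] (H₀ →L[ℂ] H₀))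
      (hπ : IsIrreducibleRep π), spectrumClass π hπ = p ∧ ∀ f, π (φ f) = f y := by
    intro y
    by_cases hy : y ∈ C
    · obtain ⟨π, hπ, hπφ⟩ := exists_rep_eval hφ hideal ⟨f, hCne y hy⟩
      exact ⟨_, fun _ => ⟨π, hπ, rfl, hπφ⟩⟩
    · exact ⟨p₀, fun h => absurd h hy⟩
  choose θ hθ using hex
  have hcont : ContinuousOn θ C := by
    refine continuousOn_to_generateFrom_iff.2 ?_
    rintro y hy _ ⟨I', -, rfl⟩ hyO
    obtain ⟨π, hπ, hπy, hπφ⟩ := hθ y hy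
    rw [← hπy, spectrumClass_mem_idealSpectrum] at hyO
    obtain ⟨x', hx'I, hx'⟩ := hyO
    obtain ⟨η, hη⟩ : ∃ η, π x' η ≠ 0 := by
      by_contra! h
      exact hx' (by ext η; simpa using h η)
    have hη0 : η ≠ 0 := by rintro rfl; simp at hη
    obtain ⟨g, hg⟩ := exists_zeroAtInfty_apply_eq (hCne y hy) (compactRankOne η η)
    obtain ⟨g', hg'⟩ := hideal x' g
    have hg'y : g' y ≠ 0 := by
      intro h0
      have h1 : π (φ g') = 0 := by rw [hπφ, h0]; rfl
      rw [hg', map_mul, hπφ, hg] at h1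
      have h2 := congrArg (fun T : H₀ →L[ℂ] H₀ => T η) h1
      simp only [mul_apply_eq_comp, coe_compactRankOne, InnerProductSpace.rankOne_apply, map_smul,
        zero_apply, smul_eq_zero] at h2
      exact h2.elim (inner_self_ne_zero.2 hη0) hη
    have hopen : IsOpen {y | g' y ≠ 0} := isOpen_ne_fun (map_continuous g') continuous_const
    filter_upwards [mem_nhdsWithin_of_mem_nhds (hopen.mem_nhds hg'y), self_mem_nhdsWithin]
      with z hz hzC
    obtain ⟨π', hπ', hπ'z, hπ'φ⟩ := hθ z hzC
    rw [Set.mem_preimage, ← hπ'z, spectrumClass_mem_idealSpectrum]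
    refine ⟨x', hx'I, fun h0 => hz (ZeroMemClass.coe_eq_zero.1 ?_)⟩
    rw [← hπ'φ, hg', map_mul, h0, zero_mul]
  have himage : E = θ '' C := by
    ext p
    constructor
    · rintro ⟨hp, π, hπ, rfl, hπx⟩
      obtain ⟨y, π', hπ', hcl, hπ'φ⟩ := exists_eval_of_mem_idealSpectrum hφ hrange hp
      have hyC : y ∈ C := by
        rw [← norm_apply_eq_of_spectrumClass_eq hcl, hπ'φ] at hπx
        exact hπx
      refine ⟨y, hyC, ?_⟩
      obtain ⟨π'', hπ'', hy, hπ''φ⟩ := hθ y hyC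
      obtain ⟨W, hW⟩ := exists_unitary_of_factor_eval hideal hπ''φ hπ'
        ⟨f, by rw [hπ'φ]; exact fun h0 => hCne y hyC (ZeroMemClass.coe_eq_zero.1 h0)⟩
        (fun g hg => by rw [hπ'φ, hg]; rfl)
      rw [← hy, ← hcl]
      exact Quotient.sound ⟨W, hW⟩
    · rintro ⟨y, hy, rfl⟩
      obtain ⟨π, hπ, hπy, hπφ⟩ := hθ y hy
      refine ⟨?_, π, hπ, hπy, by rw [hπφ]; exact hy⟩
      rw [← hπy, spectrumClass_mem_idealSpectrum]
      exact ⟨_, hx, by rw [hπφ]; exact fun h0 => hCne y hy (ZeroMemClass.coe_eq_zero.1 h0)⟩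
  rw [himage]
  exact (f.isCompact_norm_ge hε).image_of_continuousOn hcont

/-- The points of the spectrum at which a given element does not vanish form an open set. -/
theorem isOpen_setOf_rep_ne_zero (h : M) :
    IsOpen {p : CStarSpectrum M | ∃ ρ : IrrRep M, ρ.toSpectrum = p ∧ ρ.π h ≠ 0} := by
  let S : Set M := {m | ∀ σ : IrrRep M, σ.π h = 0 → σ.π m = 0}
  let J : TwoSidedIdeal M := TwoSidedIdeal.mk' S (fun σ _ => map_zero _)
    (fun {x y} hx hy σ hσ => by rw [map_add, hx σ hσ, hy σ hσ, add_zero])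
    (fun {x} hx σ hσ => by rw [map_neg, hx σ hσ, neg_zero])
    (fun {x y} hy σ hσ => by rw [map_mul, hy σ hσ, mul_zero])
    (fun {x y} hx σ hσ => by rw [map_mul, hx σ hσ, zero_mul])
  have hJ : (J : Set M) = S := by
    ext x; exact TwoSidedIdeal.mem_mk' ..
  refine TopologicalSpace.isOpen_generateFrom_of_mem ⟨J, ?_, ?_⟩
  · rw [hJ]
    have : S = ⋂ (σ : IrrRep M) (_ : σ.π h = 0), {m | σ.π m = 0} := by
      ext m; simp [S]
    rw [this]
    exact isClosed_iInter fun σ => isClosed_iInter fun _ =>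
      isClosed_eq (map_continuous σ.π) continuous_const
  · ext p
    constructor
    · rintro ⟨ρ, hρ, hne⟩
      refine ⟨ρ, hρ, h, ?_, hne⟩
      change h ∈ (J : Set M)
      rw [hJ]
      exact fun _ h => h
    · rintro ⟨ρ, hρ, x, hx, hne⟩
      refine ⟨ρ, hρ, fun h0 => hne ?_⟩
      have : x ∈ S := by rw [← hJ]; exact hx
      exact this ρ h0

end IdealSpectrumOfIso

/-! ### Positivity, and uniform transition along the orbits -/

section Positivity

variable {M : Type u} [CStarAlgebra M] [PartialOrder M] [StarOrderedRing M]

theorem nonneg_smul_one_add_of_norm_le {X : M} (hX : IsSelfAdjoint X) {c : ℝ} (h : ‖X‖ ≤ c) :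
    0 ≤ c • (1 : M) + X := by
  have h1 := hX.neg_algebraMap_norm_le_self
  have h2 : algebraMap ℝ M ‖X‖ ≤ algebraMap ℝ M c := algebraMap_mono M h
  rw [← Algebra.algebraMap_eq_smul_one]
  calc (0 : M) ≤ algebraMap ℝ M c - algebraMap ℝ M ‖X‖ := sub_nonneg.2 h2
    _ = algebraMap ℝ M c + -algebraMap ℝ M ‖X‖ := sub_eq_add_neg _ _
    _ ≤ algebraMap ℝ M c + X := by gcongr

/-- A selfadjoint element that equals `1/2` modulo an ideal `I` and is positive in all the
irreducible representations attached to `I` is positive: its negative part belongs to `I`. -/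
theorem nonneg_of_forall_rep_nonneg {H₀ : Type u} [NormedAddCommGroup H₀]
    [InnerProductSpace ℂ H₀] [CompleteSpace H₀] {Y : Type*} [TopologicalSpace Y]
    {φ : C₀(Y, compactOperators H₀) →⋆ₙₐ[ℂ] M} {I : TwoSidedIdeal M}
    (hφ : Function.Injective φ) (hrange : Set.range φ = (I : Set M)) {z : M}
    (hz : IsSelfAdjoint z) (hzI : z - (1 / 2 : ℝ) • (1 : M) ∈ I)
    (h : ∀ (π : M →⋆ₐ[ℂ] (H₀ →L[ℂ] H₀)) (hπ : IsIrreducibleRep π),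
      spectrumClass π hπ ∈ idealSpectrum I → 0 ≤ π z) : 0 ≤ z := by
  have hcont : Continuous fun r : ℝ => max (-r) 0 := by fun_prop
  have hcont' : Continuous fun r : ℝ => -(max (-r) 0 / max (1 / 2 - r) (1 / 2)) := by
    refine (Continuous.div₀ hcont (by fun_prop) fun r => ?_).neg
    exact (lt_max_of_lt_right (by norm_num)).ne'
  have hn : cfc (fun r : ℝ => max (-r) 0) z = 0 := by
    refine eq_zero_of_forall_rep_eq_zero (I := I) hφ hrange ?_ fun π hπ hp => ?_
    · have e : (fun r : ℝ => max (-r) 0)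
          = fun r => (r - 1 / 2) * -(max (-r) 0 / max (1 / 2 - r) (1 / 2)) := by
        funext r
        rcases le_total r 0 with hr | hr
        · rw [max_eq_left (by linarith), max_eq_left (by linarith)]
          have : (1 / 2 - r) ≠ 0 := by linarith
          rw [← neg_sub (1 / 2) r, neg_mul_neg, mul_div_assoc', mul_div_cancel_left₀ _ this]
        · rw [max_eq_right (by linarith)]; simp
      rw [e, cfc_mul (fun r : ℝ => r - 1 / 2) _ z (by fun_prop) hcont'.continuousOn]
      refine I.mul_mem_right _ _ ?_
      rw [cfc_sub (fun r : ℝ => r) (fun _ => 1 / 2) z (by fun_prop) (by fun_prop), cfc_id' ℝ z,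
        cfc_const (1 / 2 : ℝ) z, Algebra.algebraMap_eq_smul_one]
      exact hzI
    · have hπz := h π hπ hp
      rw [StarAlgHomClass.map_cfc π (fun r : ℝ => max (-r) 0) z hcont.continuousOn
        (map_continuous π) hz hπz.isSelfAdjoint]
      rw [← cfc_const_zero ℝ (π z)]
      refine cfc_congr fun r hr => ?_
      have : 0 ≤ r := spectrum_nonneg_of_nonneg hπz hr
      exact max_eq_right (by linarith)
  have e2 : z = cfc (fun r : ℝ => max r 0) z - cfc (fun r : ℝ => max (-r) 0) z := by
    rw [← cfc_sub _ _ z (by fun_prop) (by fun_prop)]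
    conv_lhs => rw [← cfc_id' ℝ z]
    refine cfc_congr fun r _ => ?_
    change r = max r 0 - max (-r) 0
    rcases le_total r 0 with hr | hr
    · rw [max_eq_right hr, max_eq_left (by linarith)]; ring
    · rw [max_eq_left hr, max_eq_right (by linarith)]; ring
  rw [e2, hn, sub_zero]
  exact cfc_nonneg fun r _ => le_max_right _ _

end Positivity

/-- If a continuous function tends to zero at infinity, and beyond `c` it has no values between
`ε` and `1 - ε`, then it is smaller than `ε` beyond `c`. -/
theorem lt_of_tendsto_zero_of_gap {g : ℝ → ℝ} (hg : Continuous g) (hlim : Tendsto g atTop (𝓝 0))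
    {c ε : ℝ} (hε : 0 < ε) (hε2 : ε < 1 / 2)
    (hgap : ∀ u > c, g u - g u ^ 2 < ε - ε ^ 2) : ∀ u > c, g u < ε := by
  intro u hu
  by_contra! hge
  have h1 : 1 / 2 ≤ g u := by
    by_contra! hlt
    have := hgap u hu
    nlinarith
  obtain ⟨w, hw, hwu⟩ := ((hlim.eventually (gt_mem_nhds (show (0 : ℝ) < 1 / 2 by norm_num))).and
    (eventually_ge_atTop u)).exists
  obtain ⟨x, hx, hgx⟩ := intermediate_value_Icc' hwu hg.continuousOn ⟨hw.le, h1⟩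
  have := hgap x (hu.trans_le hx.1)
  rw [hgx] at this
  nlinarith [sq_nonneg (ε - 1 / 2)]

section RealAction

variable {K : Type v} [Group K] [TopologicalSpace K] {M : Type u} [CStarAlgebra M]
  (α : CStarAction (K × Multiplicative ℝ) M)

/-- The automorphism `x ↦ t · x` of `M`, for `t ∈ ℝ`. -/
def CStarAction.autR (t : ℝ) : M ≃⋆ₐ[ℂ] M := α.toHom (1, Multiplicative.ofAdd t)

theorem CStarAction.actR_eq (t : ℝ) (x : M) : α.actR t x = α.autR t x := rfl

theorem CStarAction.actR_add (s t : ℝ) (x : M) : α.actR (s + t) x = α.actR s (α.actR t x) := by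
  unfold CStarAction.actR
  rw [ofAdd_add, show ((1 : K), Multiplicative.ofAdd s * Multiplicative.ofAdd t)
    = (1, Multiplicative.ofAdd s) * (1, Multiplicative.ofAdd t) by simp, map_mul]
  rfl

theorem CStarAction.actR_zero (x : M) : α.actR 0 x = x := by
  unfold CStarAction.actR
  rw [ofAdd_zero, show ((1 : K), (1 : Multiplicative ℝ)) = 1 from rfl, map_one]
  rfl

theorem CStarAction.actK_actR (k : K) (t : ℝ) (x : M) :
    α.actK k (α.actR t x) = α.actR t (α.actK k x) := by
  have h : ((k, 1) : K × Multiplicative ℝ) * (1, Multiplicative.ofAdd t)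
      = (1, Multiplicative.ofAdd t) * (k, 1) := by simp
  change (α.toHom (k, 1) * α.toHom (1, Multiplicative.ofAdd t)) x
    = (α.toHom (1, Multiplicative.ofAdd t) * α.toHom (k, 1)) x
  rw [← map_mul, h, map_mul]

theorem CStarAction.toHom_eq (k : K) (t : Multiplicative ℝ) (x : M) :
    α.toHom (k, t) x = α.actR t.toAdd (α.actK k x) := by
  change _ = (α.toHom (1, t) * α.toHom (k, 1)) x
  rw [← map_mul]; simp

theorem CStarAction.continuous_actR (x : M) : Continuous fun t : ℝ => α.actR t x :=
  α.continuous_act.comp (f := fun t : ℝ => (((1 : K), Multiplicative.ofAdd t), x)) (by fun_prop)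

theorem CStarAction.spectrumActR_add (p : CStarSpectrum M) (s t : ℝ) :
    α.spectrumActR p (s + t) = α.spectrumActR (α.spectrumActR p s) t := by
  unfold CStarAction.spectrumActR
  rw [← α.spectrumAct_mul]; simp

theorem CStarAction.spectrumActR_mem_idealSpectrum {I : TwoSidedIdeal M}
    (hI : ∀ g, ∀ x ∈ I, α.toHom g x ∈ I) {p : CStarSpectrum M} (hp : p ∈ idealSpectrum I)
    (t : ℝ) : α.spectrumActR p t ∈ idealSpectrum I := by
  obtain ⟨ρ, rfl, x, hx, hne⟩ := hp
  refine ⟨ρ.comp (α.autR t), rfl, α.actR (-t) x, hI _ _ hx, ?_⟩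
  change ρ.π (α.actR t (α.actR (-t) x)) ≠ 0
  rwa [← α.actR_add, add_neg_cancel, α.actR_zero]

variable [PartialOrder M] [StarOrderedRing M] {H₀ : Type u} [NormedAddCommGroup H₀]
  [InnerProductSpace ℂ H₀] [CompleteSpace H₀] {Y : Type*} [TopologicalSpace Y]
  {φ : C₀(Y, compactOperators H₀) →⋆ₙₐ[ℂ] M} {I : TwoSidedIdeal M}

variable {α} in
/-- If the orbit space of the spectrum of `I` is quasi-compact, then a compact set meets every
orbit. -/
theorem CStarAction.exists_isCompact_meets_orbits [TopologicalSpace.MetrizableSpace Y]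
    (hφ : Function.Injective φ) (hrange : Set.range φ = (I : Set M))
    (h_orbit : CompactSpace (α.OrbitSpace (idealSpectrum I))) :
    ∃ C ⊆ idealSpectrum I, IsCompact C ∧ ∀ p ∈ idealSpectrum I, ∃ t, α.spectrumActR p t ∈ C := by
  let U : M → Set (CStarSpectrum M) := fun h =>
    {p | ∃ ρ : IrrRep M, ρ.toSpectrum = p ∧ ρ.π h ≠ 0}
  let E : M → ℝ → Set (CStarSpectrum M) := fun x δ =>
    {p | p ∈ idealSpectrum I ∧ ∃ (π : M →⋆ₐ[ℂ] (H₀ →L[ℂ] H₀))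
      (hπ : IsIrreducibleRep π), spectrumClass π hπ = p ∧ δ ≤ ‖π x‖}
  have hmemI : ∀ f, φ f ∈ I := fun f => by
    have : φ f ∈ (I : Set M) := hrange ▸ ⟨f, rfl⟩
    exact this
  have hloc : ∀ p : idealSpectrum I, ∃ (h x : M) (δ : ℝ), x ∈ I ∧ 0 < δ ∧ p.1 ∈ U h ∧
      U h ⊆ E x δ := by
    rintro ⟨p, hp⟩
    obtain ⟨y, π, hπ, hpy, hπφ⟩ := exists_eval_of_mem_idealSpectrum hφ hrange hp
    obtain ⟨x, hx, hne⟩ := spectrumClass_mem_idealSpectrum.1 (hpy ▸ hp)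
    obtain ⟨f, rfl⟩ : x ∈ Set.range φ := by rw [hrange]; exact hx
    rw [hπφ] at hne
    have hpos : 0 < ‖f y‖ := norm_pos_iff.2 fun h0 => hne (by rw [h0]; rfl)
    obtain ⟨f', hf', hf'0⟩ := f.exists_truncation (half_pos hpos)
    refine ⟨φ f', φ f, ‖f y‖ / 2, hx, half_pos hpos, ⟨⟨H₀, π, hπ⟩, hpy, ?_⟩, ?_⟩
    · change π (φ f') ≠ 0
      rw [hπφ]
      intro h0
      have h1 : f' y = 0 := ZeroMemClass.coe_eq_zero.1 h0
      have := hf' y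
      rw [h1, sub_zero] at this
      linarith
    · rintro q ⟨ρ, hρ, hρne⟩
      have hq : q ∈ idealSpectrum I := ⟨ρ, hρ, _, hmemI f', hρne⟩
      obtain ⟨w, π', hπ', hqw, hπ'φ⟩ := exists_eval_of_mem_idealSpectrum hφ hrange hq
      refine ⟨hq, π', hπ', hqw, ?_⟩
      rw [hπ'φ]
      by_contra! hlt
      have h1 : π' (φ f') = 0 := by rw [hπ'φ, hf'0 w hlt.le]; rfl
      have h2 := norm_apply_eq_of_spectrumClass_eq (π := ρ.π) (hπ := ρ.irreducible)
        (hρ.trans hqw.symm) (φ f')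
      rw [h1, norm_zero, norm_eq_zero] at h2
      exact hρne h2
  choose h x δ hxI hδ hpU hUE using hloc
  -- the saturations of the open sets `U (h p)` are open
  let V : idealSpectrum I → Set (α.OrbitSpace (idealSpectrum I)) := fun p =>
    Quotient.mk _ '' {q | ∃ t, α.spectrumActR q.1 t ∈ U (h p)}
  have hVpre : ∀ p, Quotient.mk _ ⁻¹' V p = {q : idealSpectrum I | ∃ t, α.spectrumActR q.1 t ∈ U (h p)} := by
    intro p
    refine Set.Subset.antisymm ?_ (Set.subset_preimage_image _ _)
    rintro q ⟨q', ⟨t, ht⟩, hqq'⟩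
    obtain ⟨s, hs⟩ : ∃ s : ℝ, α.spectrumActR q s = q' := Quotient.exact hqq'.symm
    exact ⟨s + t, by rwa [α.spectrumActR_add, hs]⟩
  have hVo : ∀ p, IsOpen (V p) := by
    intro p
    refine isOpen_coinduced.2 ?_
    change IsOpen (Quotient.mk _ ⁻¹' V p)
    rw [hVpre]
    have : {q : idealSpectrum I | ∃ t, α.spectrumActR q.1 t ∈ U (h p)}
        = ⋃ t, Subtype.val ⁻¹' U (α.actR t (h p)) := by
      ext ⟨q, hq⟩
      rw [Set.mem_iUnion]
      refine exists_congr fun t => ?_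
      change α.spectrumActR q t ∈ U (h p) ↔ q ∈ U (α.actR t (h p))
      constructor
      · rintro ⟨ρ, hρ, hne⟩
        refine ⟨ρ.comp (α.autR (-t)), ?_, ?_⟩
        · change α.spectrumActR ρ.toSpectrum (-t) = q
          rw [hρ, ← α.spectrumActR_add, add_neg_cancel]
          exact α.spectrumAct_one q
        · change ρ.π (α.actR (-t) (α.actR t (h p))) ≠ 0
          rwa [← α.actR_add, neg_add_cancel, α.actR_zero]
      · rintro ⟨ρ, rfl, hne⟩
        exact ⟨ρ.comp (α.autR t), rfl, hne⟩
    rw [this]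
    exact isOpen_iUnion fun t => (isOpen_setOf_rep_ne_zero _).preimage continuous_subtype_val
  obtain ⟨s, hs⟩ := isCompact_univ.elim_finite_subcover V hVo (by
    rintro ⟨p⟩ -
    exact Set.mem_iUnion.2 ⟨p, p, ⟨0, by
      have : α.spectrumActR p.1 0 = p.1 := α.spectrumAct_one _
      rw [this]; exact hpU p⟩, rfl⟩)
  refine ⟨⋃ p ∈ s, E (x p) (δ p), ?_, ?_, ?_⟩
  · exact Set.iUnion₂_subset fun p _ => fun q hq => hq.1
  · exact s.finite_toSet.isCompact_biUnion fun p _ =>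
      isCompact_norm_ge_idealSpectrum hφ hrange (hxI p) (hδ p)
  · intro q hq
    obtain ⟨p, hp, hqp⟩ := Set.mem_iUnion₂.1 (hs (Set.mem_univ (Quotient.mk _ (⟨q, hq⟩ : idealSpectrum I))))
    have : (⟨q, hq⟩ : idealSpectrum I) ∈ Quotient.mk _ ⁻¹' V p := hqp
    rw [hVpre] at this
    obtain ⟨t, ht⟩ := this
    exact ⟨t, Set.mem_iUnion₂.2 ⟨p, hp, hUE p ht⟩⟩

variable {α} in
/-- Along every orbit in the spectrum of `I`, the element `a` passes from `0` to `1` within a time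
that does not depend on the orbit. -/
theorem CStarAction.exists_uniform_transition [TopologicalSpace.MetrizableSpace Y]
    (hφ : Function.Injective φ) (hrange : Set.range φ = (I : Set M))
    (hI : ∀ g, ∀ x ∈ I, α.toHom g x ∈ I)
    (h_proper : α.IsProperOn (idealSpectrum I))
    (h_orbit : CompactSpace (α.OrbitSpace (idealSpectrum I)))
    {a : M} (haI : (1 - a) * a ∈ I)
    (ha : ∀ (π : M →⋆ₐ[ℂ] (H₀ →L[ℂ] H₀)) (hπ : IsIrreducibleRep π),
      spectrumClass π hπ ∈ idealSpectrum I →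
      Tendsto (fun t : ℝ => ‖π (α.actR t (1 - a))‖) atTop (𝓝 0) ∧
      Tendsto (fun t : ℝ => ‖π (α.actR t a)‖) atBot (𝓝 0))
    {ε : ℝ} (hε : 0 < ε) (hε2 : ε < 1 / 2) :
    ∃ L > 0, ∀ (π : M →⋆ₐ[ℂ] (H₀ →L[ℂ] H₀)) (hπ : IsIrreducibleRep π),
      spectrumClass π hπ ∈ idealSpectrum I → ∃ t₀ : ℝ, ∀ t,
        (t₀ + L ≤ t → ‖π (α.actR t (1 - a))‖ ≤ ε) ∧ (t ≤ t₀ - L → ‖π (α.actR t a)‖ ≤ ε) := by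
  obtain ⟨C, hCI, hC, hCorb⟩ := exists_isCompact_meets_orbits hφ hrange h_orbit
  have hδ : 0 < ε - ε ^ 2 := by nlinarith
  have hE := isCompact_norm_ge_idealSpectrum hφ hrange haI hδ
  set E := {p | p ∈ idealSpectrum I ∧ ∃ (π : M →⋆ₐ[ℂ] (H₀ →L[ℂ] H₀))
      (hπ : IsIrreducibleRep π), spectrumClass π hπ = p ∧ ε - ε ^ 2 ≤ ‖π ((1 - a) * a)‖} with hEdef
  have hEI : E ⊆ idealSpectrum I := fun p hp => hp.1
  obtain ⟨L, hL⟩ := (h_proper (C ∪ E) (Set.union_subset hCI hEI) (hC.union hE)).isBounded.subset_closedBall 0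
  have hL' : ∀ p ∈ C, ∀ t : ℝ, L < |t| → α.spectrumActR p t ∉ E := by
    intro p hp t ht htE
    have : t ∈ Metric.closedBall (0 : ℝ) L := hL ⟨p, Or.inl hp, Or.inr htE⟩
    rw [mem_closedBall_zero_iff, Real.norm_eq_abs] at this
    linarith
  refine ⟨|L| + 1, by positivity, fun π hπ hp => ?_⟩
  obtain ⟨s, hs⟩ := hCorb _ hp
  refine ⟨s, ?_⟩
  have hsmall : ∀ t : ℝ, |L| < |t| → ‖π (α.actR (s + t) ((1 - a) * a))‖ < ε - ε ^ 2 := by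
    intro t ht
    by_contra! hge
    refine hL' _ hs t ((le_abs_self L).trans_lt ht) ?_
    rw [← α.spectrumActR_add]
    refine ⟨α.spectrumActR_mem_idealSpectrum hI hp _, π.comp (α.autR (s + t) : M →⋆ₐ[ℂ] M),
      (IrrRep.comp ⟨H₀, π, hπ⟩ (α.autR (s + t))).irreducible, rfl, hge⟩
  have htri : ∀ B : H₀ →L[ℂ] H₀, ‖B‖ - ‖B‖ ^ 2 ≤ ‖B * (1 - B)‖ := by
    intro B
    have h1 := norm_sub_norm_le B (B * B)
    have h2 : ‖B * B‖ ≤ ‖B‖ ^ 2 := by rw [sq]; exact norm_mul_le _ _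
    rw [mul_sub, mul_one]
    linarith
  have hgap1 : ∀ t, |L| < |t| → ‖π (α.actR (s + t) (1 - a))‖ - ‖π (α.actR (s + t) (1 - a))‖ ^ 2
      < ε - ε ^ 2 := by
    intro t ht
    refine (htri _).trans_lt ((le_of_eq ?_).trans_lt (hsmall t ht))
    simp only [α.actR_eq, map_mul, map_sub, map_one, sub_sub_cancel]
  have hgap2 : ∀ t, |L| < |t| → ‖π (α.actR (s + t) a)‖ - ‖π (α.actR (s + t) a)‖ ^ 2
      < ε - ε ^ 2 := by
    intro t ht
    refine (htri _).trans_lt ((le_of_eq ?_).trans_lt (hsmall t ht))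
    have : (1 - a) * a = a * (1 - a) := by noncomm_ring
    rw [this]
    simp only [α.actR_eq, map_mul, map_sub, map_one]
  have hcont : ∀ x, Continuous fun t => ‖π (α.actR t x)‖ := fun x =>
    ((map_continuous π).comp (α.continuous_actR x)).norm
  obtain ⟨hlim1, hlim2⟩ := ha π hπ hp
  intro t
  constructor
  · intro ht
    refine (lt_of_tendsto_zero_of_gap (hcont (1 - a)) hlim1 hε hε2 (c := s + |L|) ?_ t
      (by linarith)).le
    intro u hu
    have := hgap1 (u - s) ((by linarith : |L| < u - s).trans_le (le_abs_self _))
    rwa [add_sub_cancel] at this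
  · intro ht
    have := lt_of_tendsto_zero_of_gap (g := fun t => ‖π (α.actR (-t) a)‖)
      ((hcont a).comp continuous_neg) (hlim2.comp tendsto_neg_atTop_atBot) hε hε2
      (c := -s + |L|) ?_ (-t) (by linarith)
    · simp only [neg_neg] at this
      exact this.le
    intro u hu
    have := hgap2 (-u - s) ((by linarith : |L| < -(-u - s)).trans_le (neg_le_abs _))
    rwa [add_sub_cancel] at this

end RealAction

/-! ### Averages along the flow -/

section Average

theorem StarAlgHom.map_intervalIntegral {A B : Type*} [CStarAlgebra A] [CStarAlgebra B]
    (f : A →⋆ₐ[ℂ] B) {F : ℝ → A} (hF : Continuous F) (x y : ℝ) :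
    f (∫ s in x..y, F s) = ∫ s in x..y, f (F s) := by
  have hf : Continuous f := AddMonoidHomClass.continuous_of_bound f 1 fun x => by
    rw [one_mul]; exact NonUnitalStarAlgHom.norm_apply_le f x
  let ℓ : A →L[ℂ] B := ⟨f.toAlgHom.toLinearMap, hf⟩
  exact (ContinuousLinearMap.intervalIntegral_comp_comm ℓ (hF.intervalIntegrable x y)).symm

/-- An average over `[t, t + N]` is small if the function is small except on an initial piece. -/
theorem norm_average_le_of_small_right {E : Type*} [NormedAddCommGroup E] [NormedSpace ℝ E]
    {F : ℝ → E} (hF : Continuous F) (h1 : ∀ s, ‖F s‖ ≤ 1) {t c N ε : ℝ} (hc : 0 ≤ c)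
    (hcN : c ≤ N) (hN : 0 < N) (hε : 0 ≤ ε) (h : ∀ s, t + c ≤ s → s ≤ t + N → ‖F s‖ ≤ ε) :
    ‖N⁻¹ • ∫ s in t..(t + N), F s‖ ≤ ε + c / N := by
  rw [← intervalIntegral.integral_add_adjacent_intervals (hF.intervalIntegrable t (t + c))
    (hF.intervalIntegrable (t + c) (t + N)), norm_smul, norm_inv, Real.norm_of_nonneg hN.le]
  have e1 : ‖∫ s in t..(t + c), F s‖ ≤ c := by
    have := intervalIntegral.norm_integral_le_of_norm_le_const (a := t) (b := t + c) (f := F)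
      (fun s _ => h1 s)
    rwa [add_sub_cancel_left, abs_of_nonneg hc, one_mul] at this
  have e2 : ‖∫ s in (t + c)..(t + N), F s‖ ≤ ε * N := by
    have := intervalIntegral.norm_integral_le_of_norm_le_const (a := t + c) (b := t + N) (f := F)
      (C := ε) (fun s hs => by
        rw [Set.uIoc_of_le (by linarith)] at hs
        exact h s hs.1.le hs.2)
    refine this.trans ?_
    rw [add_sub_add_left_eq_sub, abs_of_nonneg (by linarith)]
    nlinarith
  have e3 := norm_add_le (∫ s in t..(t + c), F s) (∫ s in (t + c)..(t + N), F s)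
  rw [inv_mul_le_iff₀ hN, mul_add, mul_div_cancel₀ _ hN.ne']
  linarith

/-- An average over `[t, t + N]` is small if the function is small except on a final piece. -/
theorem norm_average_le_of_small_left {E : Type*} [NormedAddCommGroup E] [NormedSpace ℝ E]
    {F : ℝ → E} (hF : Continuous F) (h1 : ∀ s, ‖F s‖ ≤ 1) {t c N ε : ℝ} (hc : 0 ≤ c)
    (hcN : c ≤ N) (hN : 0 < N) (hε : 0 ≤ ε) (h : ∀ s, t ≤ s → s ≤ t + N - c → ‖F s‖ ≤ ε) :
    ‖N⁻¹ • ∫ s in t..(t + N), F s‖ ≤ ε + c / N := by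
  have e : ∫ s in t..(t + N), F s = ∫ s in (-t - N)..(-t - N + N), F (-s) := by
    rw [intervalIntegral.integral_comp_neg]
    congr 1 <;> ring
  rw [e]
  exact norm_average_le_of_small_right (hF.comp continuous_neg) (fun s => h1 _) hc hcN hN hε
    fun s hs hs' => h (-s) (by linarith) (by linarith)

end Average

section RealAction

variable {K : Type v} [Group K] [TopologicalSpace K] {M : Type u} [CStarAlgebra M]
  (α : CStarAction (K × Multiplicative ℝ) M)

/-- The average of `s · x` over `s ∈ [0, N]`. -/
noncomputable def CStarAction.average (N : ℝ) (x : M) : M := N⁻¹ • ∫ s in (0 : ℝ)..N, α.actR s x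

theorem CStarAction.map_actR_average {B : Type*} [CStarAlgebra B] (f : M →⋆ₐ[ℂ] B) (N t : ℝ)
    (x : M) : f (α.actR t (α.average N x)) = N⁻¹ • ∫ s in t..(t + N), f (α.actR s x) := by
  have h : f (α.actR t (α.average N x))
      = (N⁻¹ : ℂ) • (f.comp (α.autR t : M →⋆ₐ[ℂ] M)) (∫ s in (0 : ℝ)..N, α.actR s x) := by
    rw [← map_smul, CStarAction.average, ← Complex.ofReal_inv]
    rfl
  rw [h, StarAlgHom.map_intervalIntegral _ (α.continuous_actR x), ← Complex.ofReal_inv]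
  have h2 : ∀ s, (f.comp (α.autR t : M →⋆ₐ[ℂ] M)) (α.actR s x) = f (α.actR (t + s) x) := fun s => by
    rw [α.actR_add]; rfl
  simp_rw [h2]
  rw [intervalIntegral.integral_comp_add_left (fun s => f (α.actR s x)) t, add_zero]
  rfl

theorem CStarAction.actR_average (N t : ℝ) (x : M) :
    α.actR t (α.average N x) = N⁻¹ • ∫ s in t..(t + N), α.actR s x :=
  α.map_actR_average (StarAlgHom.id ℂ M) N t x

theorem CStarAction.average_one_sub {N : ℝ} (hN : 0 < N) (x : M) :
    α.average N (1 - x) = 1 - α.average N x := by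
  unfold CStarAction.average
  have : ∀ s, α.actR s (1 - x) = 1 - α.actR s x := fun s => by
    simp only [α.actR_eq, map_sub, map_one]
  simp_rw [this]
  rw [intervalIntegral.integral_sub (by simp) ((α.continuous_actR x).intervalIntegrable _ _),
    smul_sub, intervalIntegral.integral_const, sub_zero, smul_smul, inv_mul_cancel₀ hN.ne', one_smul]

theorem CStarAction.actK_average (k : K) (N : ℝ) (x : M) (hx : α.actK k x = x) :
    α.actK k (α.average N x) = α.average N x := by
  have h : α.actK k (α.average N x)
      = (N⁻¹ : ℂ) • (α.toHom (k, 1) : M →⋆ₐ[ℂ] M) (∫ s in (0 : ℝ)..N, α.actR s x) := by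
    rw [← map_smul, CStarAction.average, ← Complex.ofReal_inv]
    rfl
  rw [h, StarAlgHom.map_intervalIntegral _ (α.continuous_actR x), ← Complex.ofReal_inv]
  have h2 : ∀ s, (α.toHom (k, 1) : M →⋆ₐ[ℂ] M) (α.actR s x) = α.actR s x := fun s => by
    change α.actK k _ = _
    rw [α.actK_actR, hx]
  simp_rw [h2]
  rfl

theorem CStarAction.isSelfAdjoint_average (N : ℝ) {x : M} (hx : IsSelfAdjoint x) :
    IsSelfAdjoint (α.average N x) := by
  unfold CStarAction.average
  refine IsSelfAdjoint.smul (by simp [IsSelfAdjoint]) ?_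
  rw [IsSelfAdjoint]
  have := ContinuousLinearMap.intervalIntegral_comp_comm
    ((starL' ℝ : M ≃L[ℝ] M) : M →L[ℝ] M) ((α.continuous_actR x).intervalIntegrable (μ := volume) 0 N)
  refine this.symm.trans ?_
  congr 1
  funext s
  change star (α.actR s x) = α.actR s x
  rw [α.actR_eq, ← map_star, hx.star_eq]

/-- The orbit of an average is differentiable. -/
theorem CStarAction.hasDerivAt_actR_average (N : ℝ) (x : M) :
    HasDerivAt (fun t => α.actR t (α.average N x)) (N⁻¹ • (α.actR N x - x)) 0 := by
  have hc := α.continuous_actR x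
  have h1 : (fun t => α.actR t (α.average N x))
      = fun t => N⁻¹ • ((∫ s in (0 : ℝ)..(t + N), α.actR s x) - ∫ s in (0 : ℝ)..t, α.actR s x) := by
    funext t
    rw [α.actR_average, intervalIntegral.integral_interval_sub_left
      (hc.intervalIntegrable _ _) (hc.intervalIntegrable _ _)]
  rw [h1]
  have h2 : ∀ t, HasDerivAt (fun t => ∫ s in (0 : ℝ)..t, α.actR s x) (α.actR t x) t := fun t =>
    intervalIntegral.integral_hasDerivAt_right (hc.intervalIntegrable _ _)
      (hc.stronglyMeasurableAtFilter _ _) hc.continuousAt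
  have h3 : HasDerivAt (fun t => ∫ s in (0 : ℝ)..(t + N), α.actR s x) (α.actR (0 + N) x) 0 :=
    (h2 (0 + N)).comp_add_const 0 N
  have h4 := (h3.sub (h2 0)).const_smul N⁻¹
  rw [zero_add, α.actR_zero] at h4
  exact h4

theorem TwoSidedIdeal.real_smul_mem {I : TwoSidedIdeal M} {x : M} (hx : x ∈ I) (r : ℝ) :
    r • x ∈ I := by
  have : r • x = (r • (1 : M)) * x := by rw [smul_mul_assoc, one_mul]
  rw [this]
  exact I.mul_mem_left _ _ hx

theorem CStarAction.average_sub_mem {I : TwoSidedIdeal M} (hI : IsClosed (I : Set M)) {N : ℝ}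
    (hN : 0 < N) {x : M} (hx : ∀ s, α.actR s x - x ∈ I) : α.average N x - x ∈ I := by
  have hconv : Convex ℝ (I : Set M) := by
    intro y hy z hz r s _ _ _
    exact I.add_mem (I.real_smul_mem hy r) (I.real_smul_mem hz s)
  have hc : Continuous fun s => α.actR s x - x := (α.continuous_actR x).sub continuous_const
  have h := hconv.set_average_mem (t := Set.Ioc 0 N) (μ := volume) (f := fun s => α.actR s x - x) hI
    (by simpa using hN) (by simp) (ae_of_all _ hx) (hc.integrableOn_Icc.mono_set Set.Ioc_subset_Icc_self)
  have e : α.average N x - x = ⨍ s in Set.Ioc 0 N, (α.actR s x - x) := by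
    rw [← Set.uIoc_of_le hN.le, interval_average_eq, intervalIntegral.integral_sub
      ((α.continuous_actR x).intervalIntegrable _ _) (by simp), intervalIntegral.integral_const,
      smul_sub, sub_zero, smul_smul, inv_mul_cancel₀ hN.ne', one_smul]
    rfl
  rw [e]
  exact h

end RealAction

/-! ### The smooth transition element -/

section TransitionElement

variable {K : Type v} [Group K] [TopologicalSpace K] {M : Type u} [CStarAlgebra M]

/-- In the representation `π`, the orbit of `b` is close to a step function: it passes from
small values to values close to `1` within the interval of radius `W` around `r₀`. -/
structure CStarAction.StepLike {H : Type*} [NormedAddCommGroup H] [InnerProductSpace ℂ H]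
    [CompleteSpace H] (α : CStarAction (K × Multiplicative ℝ) M)
    (π : M →⋆ₐ[ℂ] (H →L[ℂ] H)) (b : M) (W r₀ : ℝ) : Prop where
  norm_le : ∀ r, ‖π (α.actR r b)‖ ≤ 1
  norm_one_sub_le : ∀ r, ‖1 - π (α.actR r b)‖ ≤ 1
  left : ∀ r ≤ r₀ - W, ‖π (α.actR r b)‖ ≤ 1 / 8
  right : ∀ r ≥ r₀ + W, ‖1 - π (α.actR r b)‖ ≤ 1 / 8

variable (α : CStarAction (K × Multiplicative ℝ) M) [PartialOrder M] [StarOrderedRing M]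

/-- If `a` is close to a step function along the orbit of `π` and `N` is large, then the average
`b` of `a` over the time `N` is either far from `1 / 2` or increasing: in the representation `π`,
the element `(1 - 2 b)² + 128 (N · a - a)` is at least `1 / 2`. Namely, either the transition takes
place within `[0, N]`, or `b` is close to `0` or `1` at time `0`. The constants make the error
terms, of norm at most `128 / 2048 + 4 (1 / 2048 + 1 / 32)`, smaller than `1 / 2`. -/
theorem CStarAction.half_le_of_transition {H : Type*} [NormedAddCommGroup H]
    [InnerProductSpace ℂ H] [CompleteSpace H] {a : M} (ha0 : 0 ≤ a) (ha1 : a ≤ 1)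
    (π : M →⋆ₐ[ℂ] (H →L[ℂ] H)) {L t₀ N : ℝ} (hL : 0 < L) (hN : N = 64 * L)
    (hleft : ∀ t ≤ t₀ - L, ‖π (α.actR t a)‖ ≤ 1 / 2048)
    (hright : ∀ t, t₀ + L ≤ t → ‖π (α.actR t (1 - a))‖ ≤ 1 / 2048)
    (hn : ∀ t, ‖π (α.actR t a)‖ ≤ 1) (hn' : ∀ t, ‖π (α.actR t (1 - a))‖ ≤ 1) :
    0 ≤ π ((1 - (2 : ℝ) • α.average N a) * (1 - (2 : ℝ) • α.average N a)
      + (128 : ℝ) • (α.actR N a - a) - (1 / 2 : ℝ) • 1) := by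
  have hNpos : 0 < N := by linarith
  have hmapr : ∀ (r : ℝ) (x : M), π (r • x) = r • π x := fun r x => by
    rw [← Complex.coe_smul, map_smul, Complex.coe_smul]
  set B := π (α.average N a) with hB
  set A₀ := π a with hA₀
  set A₁ := π (α.actR N a) with hA₁
  have hBsa : IsSelfAdjoint B :=
    (α.isSelfAdjoint_average N (IsSelfAdjoint.of_nonneg ha0)).map π
  have hA₀sa : IsSelfAdjoint A₀ := (IsSelfAdjoint.of_nonneg ha0).map π
  have hA₁sa : IsSelfAdjoint A₁ := ((IsSelfAdjoint.of_nonneg ha0).map (α.autR N)).map π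
  have hA₀0 : 0 ≤ A₀ := map_nonneg π ha0
  have hA₁0 : 0 ≤ A₁ := map_nonneg π (map_nonneg (α.autR N) ha0)
  have hA₀1 : 0 ≤ 1 - A₀ := by
    have := map_nonneg π (sub_nonneg.2 ha1)
    rwa [map_sub, map_one] at this
  have hz : π ((1 - (2 : ℝ) • α.average N a) * (1 - (2 : ℝ) • α.average N a)
      + (128 : ℝ) • (α.actR N a - a) - (1 / 2 : ℝ) • 1)
      = (1 - (2 : ℝ) • B) * (1 - (2 : ℝ) • B) + (128 : ℝ) • (A₁ - A₀) - (1 / 2 : ℝ) • 1 := by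
    simp only [map_sub, map_add, map_mul, map_one, hmapr]
    rfl
  rw [hz]
  have hsq : ∀ X : H →L[ℂ] H, IsSelfAdjoint X → 0 ≤ X * X := fun X hX => by
    have := star_mul_self_nonneg X
    rwa [hX.star_eq] at this
  have hone : IsSelfAdjoint (1 : H →L[ℂ] H) := IsSelfAdjoint.one _
  have hsm : ∀ (r : ℝ) {X : H →L[ℂ] H}, IsSelfAdjoint X → IsSelfAdjoint (r • X) := fun r X hX =>
    IsSelfAdjoint.smul (by simp [IsSelfAdjoint]) hX
  have hzero : α.actR 0 a = a := α.actR_zero a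
  have hone_sub : ∀ t, π (α.actR t (1 - a)) = 1 - π (α.actR t a) := fun t => by
    simp only [α.actR_eq, map_sub, map_one]
  have hBavg : B = N⁻¹ • ∫ s in (0 : ℝ)..(0 + N), π (α.actR s a) := by
    rw [← α.map_actR_average, α.actR_zero]
  have hBavg' : 1 - B = N⁻¹ • ∫ s in (0 : ℝ)..(0 + N), π (α.actR s (1 - a)) := by
    rw [← α.map_actR_average, α.actR_zero, α.average_one_sub hNpos, map_sub, map_one]
  have hcont : ∀ x, Continuous fun s => π (α.actR s x) := fun x =>
    (map_continuous π).comp (α.continuous_actR x)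
  have h2LN : 2 * L / N = 1 / 32 := by rw [hN]; field_simp; norm_num
  have hns : ∀ (r : ℝ) (X : H →L[ℂ] H), ‖r • X‖ = |r| * ‖X‖ := fun r X => norm_smul r X
  by_cases h0 : t₀ - L < 0
  · -- the transition takes place before time `2 L`
    have hb : ‖1 - B‖ ≤ 1 / 2048 + 1 / 32 := by
      rw [hBavg', ← h2LN]
      exact norm_average_le_of_small_right (hcont _) hn' (by linarith) (by linarith) hNpos
        (by norm_num) fun s hs _ => hright s (by linarith)
    have hA : ‖1 - A₁‖ ≤ 1 / 2048 := by
      have := hright N (by linarith)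
      rwa [hone_sub] at this
    have e : (1 - (2 : ℝ) • B) * (1 - (2 : ℝ) • B) + (128 : ℝ) • (A₁ - A₀) - (1 / 2 : ℝ) • 1
        = (4 : ℝ) • ((1 - B) * (1 - B)) + (128 : ℝ) • (1 - A₀)
          + ((1 / 2 : ℝ) • 1 + ((-4 : ℝ) • (1 - B) + (-128 : ℝ) • (1 - A₁))) := by
      simp only [mul_sub, sub_mul, mul_one, one_mul, smul_mul_assoc, mul_smul_comm]
      module
    rw [e]
    refine add_nonneg (add_nonneg (smul_nonneg (by norm_num) (hsq _ (hone.sub hBsa)))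
      (smul_nonneg (by norm_num) hA₀1)) ?_
    refine nonneg_smul_one_add_of_norm_le
      ((hsm _ (hone.sub hBsa)).add (hsm _ (hone.sub hA₁sa))) ?_
    refine (norm_add_le _ _).trans ?_
    rw [hns, hns, abs_neg, abs_neg, abs_of_pos (by norm_num), abs_of_pos (by norm_num)]
    linarith
  · have hA0 : ‖A₀‖ ≤ 1 / 2048 := by
      have := hleft 0 (by linarith)
      rwa [hzero] at this
    by_cases h1 : t₀ + L ≤ N
    · -- the transition takes place within `[0, N]`
      have hA : ‖1 - A₁‖ ≤ 1 / 2048 := by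
        have := hright N (by linarith)
        rwa [hone_sub] at this
      have e : (1 - (2 : ℝ) • B) * (1 - (2 : ℝ) • B) + (128 : ℝ) • (A₁ - A₀) - (1 / 2 : ℝ) • 1
          = (1 - (2 : ℝ) • B) * (1 - (2 : ℝ) • B)
            + ((127.5 : ℝ) • 1 + ((-128 : ℝ) • (1 - A₁) + (-128 : ℝ) • A₀)) := by
        module
      rw [e]
      refine add_nonneg (hsq _ (hone.sub (hsm _ hBsa))) ?_
      refine nonneg_smul_one_add_of_norm_le ((hsm _ (hone.sub hA₁sa)).add (hsm _ hA₀sa)) ?_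
      refine (norm_add_le _ _).trans ?_
      rw [hns, hns, abs_neg, abs_of_pos (by norm_num)]
      linarith
    · -- the transition takes place after time `N - 2 L`
      have hb : ‖B‖ ≤ 1 / 2048 + 1 / 32 := by
        rw [hBavg, ← h2LN]
        exact norm_average_le_of_small_left (hcont _) hn (by linarith) (by linarith) hNpos
          (by norm_num) fun s _ hs => hleft s (by linarith)
      have e : (1 - (2 : ℝ) • B) * (1 - (2 : ℝ) • B) + (128 : ℝ) • (A₁ - A₀) - (1 / 2 : ℝ) • 1
          = (4 : ℝ) • (B * B) + (128 : ℝ) • A₁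
            + ((1 / 2 : ℝ) • 1 + ((-4 : ℝ) • B + (-128 : ℝ) • A₀)) := by
        simp only [mul_sub, sub_mul, mul_one, one_mul, smul_mul_assoc, mul_smul_comm]
        module
      rw [e]
      refine add_nonneg (add_nonneg (smul_nonneg (by norm_num) (hsq _ hBsa))
        (smul_nonneg (by norm_num) hA₁0)) ?_
      refine nonneg_smul_one_add_of_norm_le ((hsm _ hBsa).add (hsm _ hA₀sa)) ?_
      refine (norm_add_le _ _).trans ?_
      rw [hns, hns, abs_neg, abs_neg, abs_of_pos (by norm_num), abs_of_pos (by norm_num)]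
      linarith

variable {α} {H₀ : Type u} [NormedAddCommGroup H₀] [InnerProductSpace ℂ H₀] [CompleteSpace H₀]
  {Y : Type*} [TopologicalSpace Y] {φ : C₀(Y, compactOperators H₀) →⋆ₙₐ[ℂ] M}

/-- The smoothed transition element: `b` is differentiable along the flow, `d` is its derivative,
and the "Callias potential" `lam² (1 - 2 b)² + 2 lam d` is bounded below, whereas `b` is close to a
step function on the time scale `1 / lam`. -/
theorem CStarAction.exists_smooth_transition [TopologicalSpace.MetrizableSpace Y]
    {J₁ J₂ : TwoSidedIdeal M} (hJ₁_closed : IsClosed (J₁ : Set M))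
    (hJ₂_closed : IsClosed (J₂ : Set M))
    (hJ₁_inv : ∀ g, ∀ x ∈ J₁, α.toHom g x ∈ J₁) (hJ₂_inv : ∀ g, ∀ x ∈ J₂, α.toHom g x ∈ J₂)
    (hφ : Function.Injective φ) (hrange : Set.range φ = ((J₁ ⊓ J₂ : TwoSidedIdeal M) : Set M))
    (h_proper : α.IsProperOn (idealSpectrum (J₁ ⊓ J₂)))
    (h_orbit : CompactSpace (α.OrbitSpace (idealSpectrum (J₁ ⊓ J₂))))
    {a : M} (ha_mem : a ∈ J₁) (ha0 : 0 ≤ a) (ha1 : a ≤ 1) (ha_mem' : 1 - a ∈ J₂)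
    (ha : ∀ (π : M →⋆ₐ[ℂ] (H₀ →L[ℂ] H₀)) (hπ : IsIrreducibleRep π),
      spectrumClass π hπ ∈ idealSpectrum (J₁ ⊓ J₂) →
      Tendsto (fun t : ℝ => ‖π (α.actR t (1 - a))‖) atTop (𝓝 0) ∧
      Tendsto (fun t : ℝ => ‖π (α.actR t a)‖) atBot (𝓝 0))
    (ha_inv : ∀ k : K, α.actK k a = a) :
    ∃ (b d : M) (lam W : ℝ), 0 < lam ∧ 0 < W ∧ lam * W = 1 / 64 ∧ IsSelfAdjoint b ∧
      (∀ k, α.actK k b = b) ∧ HasDerivAt (fun t => α.actR t b) d 0 ∧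
      0 ≤ (lam ^ 2) • ((1 - (2 : ℝ) • b) * (1 - (2 : ℝ) • b)) + (2 * lam) • d
        - (lam ^ 2 / 2) • (1 : M) ∧
      ∀ (π : M →⋆ₐ[ℂ] (H₀ →L[ℂ] H₀)) (hπ : IsIrreducibleRep π),
        spectrumClass π hπ ∈ idealSpectrum (J₁ ⊓ J₂) → ∃ r₀, α.StepLike π b W r₀ := by
  have hIcl : IsClosed ((J₁ ⊓ J₂ : TwoSidedIdeal M) : Set M) := hJ₁_closed.inter hJ₂_closed
  have hI : ∀ g, ∀ x ∈ J₁ ⊓ J₂, α.toHom g x ∈ J₁ ⊓ J₂ := fun g x hx =>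
    ⟨hJ₁_inv g x hx.1, hJ₂_inv g x hx.2⟩
  have haI : (1 - a) * a ∈ J₁ ⊓ J₂ := ⟨J₁.mul_mem_left _ _ ha_mem, J₂.mul_mem_right _ _ ha_mem'⟩
  have hsub : ∀ s, α.actR s a - a ∈ J₁ ⊓ J₂ := fun s => by
    refine ⟨J₁.sub_mem (hJ₁_inv _ _ ha_mem) ha_mem, ?_⟩
    have h : α.actR s a - a = (1 - a) - α.actR s (1 - a) := by
      simp only [α.actR_eq, map_sub, map_one]
      abel
    rw [h]
    exact J₂.sub_mem ha_mem' (hJ₂_inv _ _ ha_mem')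
  obtain ⟨L, hL, htrans⟩ := exists_uniform_transition hφ hrange hI h_proper h_orbit haI ha
    (show (0 : ℝ) < 1 / 2048 by norm_num) (by norm_num)
  set N := 64 * L with hN
  have hNpos : 0 < N := by positivity
  have hasa : IsSelfAdjoint a := IsSelfAdjoint.of_nonneg ha0
  have hnorm : ∀ {x : M}, 0 ≤ x → x ≤ 1 → ∀ (π : M →⋆ₐ[ℂ] (H₀ →L[ℂ] H₀)) t,
      ‖π (α.actR t x)‖ ≤ 1 := fun {x} h0 h1 π t => by
    refine (NonUnitalStarAlgHom.norm_apply_le π _).trans ?_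
    refine (NonUnitalStarAlgHom.norm_apply_le (α.autR t : M →⋆ₐ[ℂ] M) x).trans ?_
    exact (CStarAlgebra.norm_le_one_iff_of_nonneg x h0).2 h1
  have h1a0 : 0 ≤ 1 - a := sub_nonneg.2 ha1
  have h1a1 : 1 - a ≤ 1 := sub_le_self _ ha0
  set b := α.average N a with hb
  have hbsa : IsSelfAdjoint b := α.isSelfAdjoint_average N hasa
  have hz : 0 ≤ (1 - (2 : ℝ) • b) * (1 - (2 : ℝ) • b)
      + (128 : ℝ) • (α.actR N a - a) - (1 / 2 : ℝ) • 1 := by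
    have hsm : ∀ (r : ℝ) {x : M}, IsSelfAdjoint x → IsSelfAdjoint (r • x) := fun r x hx =>
      IsSelfAdjoint.smul (by simp [IsSelfAdjoint]) hx
    have h1b : IsSelfAdjoint (1 - (2 : ℝ) • b) := (IsSelfAdjoint.one _).sub (hsm _ hbsa)
    refine nonneg_of_forall_rep_nonneg hφ hrange ?_ ?_ fun π hπ hp => ?_
    · refine IsSelfAdjoint.sub (IsSelfAdjoint.add ?_ (hsm _ ((hasa.map (α.autR N)).sub hasa)))
        (hsm _ (IsSelfAdjoint.one _))
      have := IsSelfAdjoint.star_mul_self (1 - (2 : ℝ) • b)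
      rwa [h1b.star_eq] at this
    · -- modulo `J₁ ⊓ J₂` the element `b` agrees with `a`, whose class is a projection
      have hba : b - a ∈ J₁ ⊓ J₂ := α.average_sub_mem hIcl hNpos hsub
      have e : (1 - (2 : ℝ) • b) * (1 - (2 : ℝ) • b)
          + (128 : ℝ) • (α.actR N a - a) - (1 / 2 : ℝ) • 1 - (1 / 2 : ℝ) • 1
          = (-4 : ℝ) • (b - a - (b - a) * b - a * (b - a) + (1 - a) * a)
            + (128 : ℝ) • (α.actR N a - a) := by
        simp only [mul_sub, sub_mul, mul_one, one_mul, smul_mul_assoc, mul_smul_comm]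
        module
      rw [e]
      refine TwoSidedIdeal.add_mem _ (TwoSidedIdeal.real_smul_mem ?_ _)
        (TwoSidedIdeal.real_smul_mem (hsub N) _)
      exact TwoSidedIdeal.add_mem _ (TwoSidedIdeal.sub_mem _ (TwoSidedIdeal.sub_mem _ hba
        (TwoSidedIdeal.mul_mem_right _ _ _ hba)) (TwoSidedIdeal.mul_mem_left _ _ _ hba)) haI
    · obtain ⟨t₀, ht₀⟩ := htrans π hπ hp
      exact α.half_le_of_transition ha0 ha1 π hL hN (fun t ht => (ht₀ t).2 ht)
        (fun t ht => (ht₀ t).1 ht) (hnorm ha0 ha1 π) (hnorm h1a0 h1a1 π)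
  -- for `lam = 1 / (64 N)` one has `2 lam / N = 128 lam²`
  refine ⟨b, N⁻¹ • (α.actR N a - a), (1 / 64) / N, N, by positivity, hNpos, by field_simp, hbsa,
    fun k => α.actK_average k N a (ha_inv k), α.hasDerivAt_actR_average N a, ?_,
    fun π hπ hp => ?_⟩
  · have e : (((1 / 64) / N) ^ 2) • ((1 - (2 : ℝ) • b) * (1 - (2 : ℝ) • b))
        + (2 * ((1 / 64) / N)) • N⁻¹ • (α.actR N a - a) - (((1 / 64) / N) ^ 2 / 2) • (1 : M)
        = (((1 / 64) / N) ^ 2) • ((1 - (2 : ℝ) • b) * (1 - (2 : ℝ) • b)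
          + (128 : ℝ) • (α.actR N a - a) - (1 / 2 : ℝ) • 1) := by
      have e1 : (2 * ((1 / 64) / N)) * N⁻¹ = ((1 / 64) / N) ^ 2 * 128 := by field_simp; norm_num
      rw [smul_smul, e1]
      module
    rw [e]
    exact smul_nonneg (by positivity) hz
  · obtain ⟨t₀, ht₀⟩ := htrans π hπ hp
    have hcont : ∀ x, Continuous fun s => π (α.actR s x) := fun x =>
      (map_continuous π).comp (α.continuous_actR x)
    have hone : ∀ r, 1 - π (α.actR r b) = π (α.actR r (α.average N (1 - a))) := fun r => by
      rw [α.average_one_sub hNpos]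
      simp only [α.actR_eq, map_sub, map_one]
      rfl
    have hsmall : ∀ {x : M}, 0 ≤ x → x ≤ 1 → ∀ r, ‖π (α.actR r (α.average N x))‖ ≤ 1 := by
      intro x hx0 hx1 r
      rw [α.map_actR_average]
      have := norm_average_le_of_small_right (hcont x) (hnorm hx0 hx1 π) (t := r) le_rfl hNpos.le
        hNpos zero_le_one fun s _ _ => hnorm hx0 hx1 π s
      simpa using this
    -- the transition of the average takes place between `t₀ - L - N` and `t₀ + L`
    refine ⟨t₀ - L, hsmall ha0 ha1, fun r => ?_, fun r hr => ?_, fun r hr => ?_⟩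
    · rw [hone]; exact hsmall h1a0 h1a1 r
    · rw [α.map_actR_average]
      have := norm_average_le_of_small_right (hcont a) (hnorm ha0 ha1 π) (t := r) le_rfl hNpos.le
        hNpos (show (0 : ℝ) ≤ 1 / 8 by norm_num)
        fun s _ hs => ((ht₀ s).2 (by linarith)).trans (by norm_num)
      simpa using this
    · rw [hone, α.map_actR_average]
      have := norm_average_le_of_small_right (hcont (1 - a)) (hnorm h1a0 h1a1 π) (t := r) le_rfl
        hNpos.le hNpos (show (0 : ℝ) ≤ 1 / 8 by norm_num)
        fun s hs _ => ((ht₀ s).1 (by linarith)).trans (by norm_num)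
      simpa using this

end TransitionElement

/-! ### Unitary flows and the resolvents of their generators -/

section Flow

variable {H : Type*} [NormedAddCommGroup H] [InnerProductSpace ℂ H] [CompleteSpace H]

/-- A strongly continuous one-parameter group of isometries of a Hilbert space. -/
structure UnitaryFlow (H : Type*) [NormedAddCommGroup H] [InnerProductSpace ℂ H] where
  /-- The operator at time `t`. -/
  op : ℝ → H →L[ℂ] H
  op_zero : op 0 = 1
  op_add : ∀ s t, op (s + t) = op s * op t
  continuous_op : ∀ ξ, Continuous fun t => op t ξ
  norm_op : ∀ t ξ, ‖op t ξ‖ = ‖ξ‖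

namespace UnitaryFlow

variable (V : UnitaryFlow H)

omit [CompleteSpace H] in
theorem inner_op (t : ℝ) (ξ η : H) : inner ℂ (V.op t ξ) (V.op t η) = inner ℂ ξ η := by
  let W : H →ₗᵢ[ℂ] H := ⟨(V.op t).toLinearMap, V.norm_op t⟩
  exact W.inner_map_map ξ η

omit [CompleteSpace H] in
theorem op_neg_op (t : ℝ) (ξ : H) : V.op (-t) (V.op t ξ) = ξ := by
  rw [← mul_apply_eq_comp, ← V.op_add, neg_add_cancel, V.op_zero]; rfl

omit [CompleteSpace H] in
theorem integrable_smul_op {h : ℝ → ℝ} (hh : Integrable h) (ξ : H) :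
    Integrable fun s => h s • V.op s ξ := by
  refine Integrable.mono' (hh.norm.mul_const ‖ξ‖)
    (hh.aestronglyMeasurable.smul (V.continuous_op ξ).aestronglyMeasurable)
    (ae_of_all _ fun s => ?_)
  rw [norm_smul, V.norm_op]

/-- The operator `∫ h(s) V_s ds`. -/
noncomputable def smear (h : ℝ → ℝ) (hh : Integrable h) : H →L[ℂ] H :=
  LinearMap.mkContinuous
    { toFun := fun ξ => ∫ s, h s • V.op s ξ
      map_add' := fun ξ η => by
        simp only [map_add, smul_add]
        exact integral_add (V.integrable_smul_op hh ξ) (V.integrable_smul_op hh η)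
      map_smul' := fun c ξ => by
        simp only [map_smul, RingHom.id_apply, smul_comm _ c]
        exact integral_smul c _ }
    (∫ s, |h s|) (fun ξ => by
      rw [← integral_mul_const]
      refine norm_integral_le_of_norm_le (hh.norm.mul_const _) (ae_of_all _ fun s => ?_)
      rw [norm_smul, V.norm_op, Real.norm_eq_abs])

omit [CompleteSpace H] in
theorem smear_apply {h : ℝ → ℝ} (hh : Integrable h) (ξ : H) :
    V.smear h hh ξ = ∫ s, h s • V.op s ξ := rfl

omit [CompleteSpace H] in
theorem norm_smear_le {h : ℝ → ℝ} (hh : Integrable h) : ‖V.smear h hh‖ ≤ ∫ s, |h s| :=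
  LinearMap.mkContinuous_norm_le _ (integral_nonneg fun _ => abs_nonneg _) _

omit [CompleteSpace H] in
theorem norm_smear_sub_apply_le {h h' : ℝ → ℝ} (hh : Integrable h) (hh' : Integrable h') (ξ : H) :
    ‖V.smear h hh ξ - V.smear h' hh' ξ‖ ≤ (∫ s, |h s - h' s|) * ‖ξ‖ := by
  rw [smear_apply, smear_apply, ← integral_sub (V.integrable_smul_op hh ξ)
    (V.integrable_smul_op hh' ξ), ← integral_mul_const]
  refine norm_integral_le_of_norm_le ((hh.sub hh').norm.mul_const _) (ae_of_all _ fun s => ?_)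
  rw [← sub_smul, norm_smul, V.norm_op]
  rfl

end UnitaryFlow

/-- The kernel `exp(lam s)` on `s ≤ 0` that represents the resolvent `(lam + δ)⁻¹` of the
generator `δ` of a flow. -/
noncomputable def resolventKernel (lam : ℝ) : ℝ → ℝ :=
  (Set.Iic 0).indicator fun s => Real.exp (lam * s)

theorem integrable_resolventKernel {lam : ℝ} (hlam : 0 < lam) :
    Integrable (resolventKernel lam) :=
  (integrable_indicator_iff measurableSet_Iic).2 (integrableOn_exp_mul_Iic hlam 0)

namespace UnitaryFlow

variable (V : UnitaryFlow H)

/-- The resolvent `(lam + δ)⁻¹` of the generator `δ` of a flow. -/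
noncomputable def resolvent {lam : ℝ} (hlam : 0 < lam) : H →L[ℂ] H :=
  V.smear (resolventKernel lam) (integrable_resolventKernel hlam)

/-- The defining property of the resolvent: `δ (R ξ) = ξ - lam R ξ`. -/
theorem hasDerivAt_op_resolvent {lam : ℝ} (hlam : 0 < lam) (ξ : H) :
    HasDerivAt (fun t => V.op t (V.resolvent hlam ξ)) (ξ - lam • V.resolvent hlam ξ) 0 := by
  set F : ℝ → H := fun s => Real.exp (lam * s) • V.op s ξ with hF
  have hFc : Continuous F := by
    exact (Real.continuous_exp.comp (continuous_const.mul continuous_id)).smul (V.continuous_op ξ)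
  have hFi : ∀ t, IntegrableOn F (Set.Iic t) := fun t => by
    refine Integrable.mono' ((integrableOn_exp_mul_Iic hlam t).norm.mul_const ‖ξ‖)
      hFc.aestronglyMeasurable (ae_of_all _ fun s => ?_)
    rw [hF, norm_smul, V.norm_op]
  have hR : V.resolvent hlam ξ = ∫ s in Set.Iic 0, F s := by
    rw [resolvent, smear_apply, ← integral_indicator measurableSet_Iic]
    congr 1
    funext s
    by_cases hs : s ∈ Set.Iic (0 : ℝ) <;> simp [resolventKernel, hs, hF]
  have hVR : ∀ t, V.op t (V.resolvent hlam ξ)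
      = Real.exp (-(lam * t)) • ((∫ s in Set.Iic 0, F s) + ∫ s in (0 : ℝ)..t, F s) := by
    intro t
    have h1 : V.op t (V.resolvent hlam ξ) = ∫ s, resolventKernel lam s • V.op (t + s) ξ := by
      rw [resolvent, smear_apply, ← ContinuousLinearMap.integral_comp_comm _
        (V.integrable_smul_op (integrable_resolventKernel hlam) ξ)]
      congr 1
      funext s
      rw [V.op_add, mul_apply_eq_comp, ← Complex.coe_smul, map_smul, Complex.coe_smul]
    have h2 : ∫ s, resolventKernel lam s • V.op (t + s) ξ
        = ∫ u, resolventKernel lam (u - t) • V.op u ξ := by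
      rw [← integral_sub_right_eq_self _ t]
      simp only [add_sub_cancel]
    have h3 : ∫ u, resolventKernel lam (u - t) • V.op u ξ
        = ∫ u in Set.Iic t, Real.exp (-(lam * t)) • F u := by
      rw [← integral_indicator measurableSet_Iic]
      congr 1
      funext u
      by_cases hu : u ≤ t
      · rw [Set.indicator_of_mem (show u ∈ Set.Iic t from hu), resolventKernel,
          Set.indicator_of_mem (show u - t ∈ Set.Iic 0 by simpa using hu), hF, smul_smul,
          ← Real.exp_add]
        congr 2
        ring
      · rw [Set.indicator_of_notMem (show u ∉ Set.Iic t from hu), resolventKernel,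
          Set.indicator_of_notMem (show u - t ∉ Set.Iic 0 by simpa using hu), zero_smul]
    rw [h1, h2, h3, integral_smul, ← intervalIntegral.integral_Iic_sub_Iic (hFi 0) (hFi t)]
    simp
  have hd1 : HasDerivAt (fun t => Real.exp (-(lam * t))) (-lam) 0 := by
    have := ((hasDerivAt_id (0 : ℝ)).const_mul lam).neg.exp
    simpa using this
  have hd2 : HasDerivAt (fun t => (∫ s in Set.Iic 0, F s) + ∫ s in (0 : ℝ)..t, F s) (F 0) 0 :=
    (intervalIntegral.integral_hasDerivAt_right (hFc.intervalIntegrable _ _)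
      (hFc.stronglyMeasurableAtFilter _ _) hFc.continuousAt).const_add _
  have hd := hd1.smul hd2
  have hfun : (fun t => V.op t (V.resolvent hlam ξ)) = fun t =>
      Real.exp (-(lam * t)) • ((∫ s in Set.Iic 0, F s) + ∫ s in (0 : ℝ)..t, F s) := funext hVR
  rw [hfun]
  refine hd.congr_deriv ?_
  have hF0 : F 0 = ξ := by simp [hF, V.op_zero]
  rw [hF0, hR]
  simp only [mul_zero, neg_zero, Real.exp_zero, one_smul, intervalIntegral.integral_same, add_zero,
    neg_smul]
  abel

omit [CompleteSpace H] in
/-- The generator of a flow is skew-adjoint. -/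
theorem re_inner_deriv_eq_zero {η ζ : H} (h : HasDerivAt (fun t => V.op t η) ζ 0) :
    RCLike.re (inner ℂ ζ η) = 0 := by
  have h1 := h.inner ℂ h
  have h2 : (fun t => inner ℂ (V.op t η) (V.op t η)) = fun _ => (inner ℂ η η : ℂ) :=
    funext fun t => V.inner_op t η η
  rw [h2] at h1
  have h3 := h1.unique (hasDerivAt_const (0 : ℝ) _)
  rw [V.op_zero, one_apply_eq_self] at h3
  have h4 := congrArg RCLike.re h3
  rw [map_add, map_zero, inner_re_symm (𝕜 := ℂ) η ζ] at h4
  linarith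

omit [CompleteSpace H] in
/-- For the generator `δ` of a flow, `‖(δ + lam) η‖² = ‖δ η‖² + lam² ‖η‖²`. -/
theorem norm_sq_eq_of_hasDerivAt {lam : ℝ} {η ζ : H} (hη : HasDerivAt (fun t => V.op t η) ζ 0) :
    ‖ζ + lam • η‖ ^ 2 = ‖ζ‖ ^ 2 + lam ^ 2 * ‖η‖ ^ 2 := by
  rw [@norm_add_sq ℂ, ← Complex.coe_smul, inner_smul_right, norm_smul]
  have : RCLike.re ((lam : ℂ) * inner ℂ ζ η) = lam * RCLike.re (inner ℂ ζ η) :=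
    RCLike.re_ofReal_mul lam _
  rw [this, V.re_inner_deriv_eq_zero hη, mul_pow, Complex.norm_real, Real.norm_eq_abs, sq_abs]
  ring

/-- The bound `‖δ η + lam (1 - 2 B) η‖² ≥ ½ ‖δ η + lam η‖²` for the generator `δ` of a flow, if
the operator `lam² (1 - 2 B)² + 2 lam [δ, B]` is at least `lam² / 2`. -/
theorem half_norm_sq_le {lam : ℝ} {η ζ : H} (hη : HasDerivAt (fun t => V.op t η) ζ 0)
    {B : ℝ → H →L[ℂ] H} {D : H →L[ℂ] H} (hB : HasDerivAt (fun t => B t η) (D η) 0)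
    (hVB : ∀ t ξ, V.op t (B (-t) ξ) = B 0 (V.op t ξ)) (hB0 : IsSelfAdjoint (B 0))
    (hpos : lam ^ 2 / 2 * ‖η‖ ^ 2 ≤ lam ^ 2 * ‖η - (2 : ℝ) • B 0 η‖ ^ 2
      + 2 * lam * RCLike.re (inner ℂ η (D η))) :
    1 / 2 * ‖ζ + lam • η‖ ^ 2 ≤ ‖ζ + lam • η - (2 * lam) • B 0 η‖ ^ 2 := by
  have hskew := V.re_inner_deriv_eq_zero hη
  have hcomm : 2 * RCLike.re (inner ℂ ζ (B 0 η)) = - RCLike.re (inner ℂ η (D η)) := by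
    have hBV : HasDerivAt (fun t => B 0 (V.op t η)) (B 0 ζ) 0 :=
      ((B 0).restrictScalars ℝ).hasFDerivAt.comp_hasDerivAt 0 hη
    have h1 := hη.inner ℂ hBV
    have h2 : (fun t => inner ℂ (V.op t η) (B 0 (V.op t η))) = fun t => inner ℂ η (B (-t) η) := by
      funext t
      rw [← hVB, V.inner_op]
    rw [h2] at h1
    have h3 : HasDerivAt (fun t => B (-t) η) (-(D η)) 0 := by
      have := (show HasDerivAt (fun t => B t η) (D η) (-0) by rwa [neg_zero]).scomp 0
        (hasDerivAt_neg (0 : ℝ))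
      simpa [Function.comp_def] using this
    have h4 := (hasDerivAt_const (0 : ℝ) η).inner ℂ h3
    have h5 := h1.unique h4
    rw [V.op_zero, one_apply_eq_self, inner_zero_left, add_zero, inner_neg_right] at h5
    have h6 : inner ℂ η (B 0 ζ) = inner ℂ (B 0 η) ζ := by
      conv_lhs => rw [← hB0.star_eq]
      rw [ContinuousLinearMap.star_eq_adjoint, ContinuousLinearMap.adjoint_inner_right]
    have h7 := congrArg RCLike.re h5
    rw [map_add, map_neg, h6, inner_re_symm (𝕜 := ℂ) (B 0 η) ζ] at h7
    linarith
  have e2 : ‖ζ + lam • η - (2 * lam) • B 0 η‖ ^ 2 = ‖ζ‖ ^ 2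
      + lam ^ 2 * ‖η - (2 : ℝ) • B 0 η‖ ^ 2 + 2 * lam * RCLike.re (inner ℂ η (D η)) := by
    have : ζ + lam • η - (2 * lam) • B 0 η = ζ + lam • (η - (2 : ℝ) • B 0 η) := by module
    rw [this, @norm_add_sq ℂ, ← Complex.coe_smul lam, inner_smul_right, norm_smul, inner_sub_right,
      ← Complex.coe_smul 2, inner_smul_right]
    have h1 : RCLike.re ((lam : ℂ) * (inner ℂ ζ η - ((2 : ℝ) : ℂ) * inner ℂ ζ (B 0 η)))
        = lam * (RCLike.re (inner ℂ ζ η) - 2 * RCLike.re (inner ℂ ζ (B 0 η))) := by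
      rw [show RCLike.re ((lam : ℂ) * (inner ℂ ζ η - ((2 : ℝ) : ℂ) * inner ℂ ζ (B 0 η)))
        = lam * RCLike.re (inner ℂ ζ η - ((2 : ℝ) : ℂ) * inner ℂ ζ (B 0 η)) from
          RCLike.re_ofReal_mul lam _, map_sub,
        show RCLike.re (((2 : ℝ) : ℂ) * inner ℂ ζ (B 0 η)) = 2 * RCLike.re (inner ℂ ζ (B 0 η)) from
          RCLike.re_ofReal_mul 2 _]
    rw [h1, hcomm, hskew, mul_pow, Complex.norm_real, Real.norm_eq_abs, sq_abs]
    ring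
  rw [V.norm_sq_eq_of_hasDerivAt hη, e2]
  nlinarith [sq_nonneg ‖ζ‖]

end UnitaryFlow

end Flow

/-! ### Covariant representations of an action of `K × ℝ` -/

section HaarProjection

variable {K : Type v} [TopologicalSpace K]

theorem continuous_snd_toAdd : Continuous fun p : K × Multiplicative ℝ => p.2.toAdd :=
  continuous_toAdd.comp continuous_snd

theorem isCompact_preimage_snd_toAdd [CompactSpace K] {C : Set ℝ} (hC : IsCompact C) :
    IsCompact ((fun p : K × Multiplicative ℝ => p.2.toAdd) ⁻¹' C) := by
  have h : (fun p : K × Multiplicative ℝ => p.2.toAdd) ⁻¹' C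
      = (Set.univ : Set K) ×ˢ (Multiplicative.ofAdd '' C) := by
    ext ⟨k, t⟩
    simp only [Set.mem_preimage, Set.mem_prod, Set.mem_univ, true_and, Set.mem_image]
    exact ⟨fun h => ⟨t.toAdd, h, rfl⟩, fun ⟨x, hx, e⟩ => e ▸ hx⟩
  rw [h]
  exact isCompact_univ.prod (hC.image continuous_ofAdd)

variable [MeasurableSpace (K × Multiplicative ℝ)] [BorelSpace (K × Multiplicative ℝ)]

/-- The image of a Haar measure of `K × ℝ` under the projection to `ℝ` is a multiple of the
Lebesgue measure. -/
theorem exists_map_snd_toAdd_eq [Group K] [IsTopologicalGroup K] [CompactSpace K]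
    (μ : Measure (K × Multiplicative ℝ)) [μ.IsHaarMeasure] :
    ∃ c : NNReal, c ≠ 0 ∧ μ.map (fun p => p.2.toAdd) = c • (volume : Measure ℝ) := by
  set ν := μ.map (fun p : K × Multiplicative ℝ => p.2.toAdd) with hν
  have hm : Measurable fun p : K × Multiplicative ℝ => p.2.toAdd := continuous_snd_toAdd.measurable
  have h1 : ν.IsAddLeftInvariant := by
    refine ⟨fun g => ?_⟩
    have h2 : Measurable fun p : K × Multiplicative ℝ => (1, Multiplicative.ofAdd g) * p :=
      (continuous_const_mul _).measurable
    conv_rhs => rw [hν, ← map_mul_left_eq_self μ (1, Multiplicative.ofAdd g)]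
    rw [hν, Measure.map_map (measurable_const_add g) hm, Measure.map_map hm h2]
    rfl
  have h2 : IsFiniteMeasureOnCompacts ν := by
    refine ⟨fun C hC => ?_⟩
    rw [hν, Measure.map_apply hm hC.measurableSet]
    exact (isCompact_preimage_snd_toAdd hC).measure_lt_top
  refine ⟨_, ?_, Measure.isAddLeftInvariant_eq_smul ν volume⟩
  intro h0
  have h3 := Measure.isAddLeftInvariant_eq_smul ν volume
  rw [h0, zero_smul] at h3
  have h4 : ν Set.univ = 0 := by rw [h3]; rfl
  rw [hν, Measure.map_apply hm MeasurableSet.univ, Set.preimage_univ] at h4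
  exact isOpen_univ.measure_ne_zero μ Set.univ_nonempty h4

theorem integral_comp_snd_toAdd {E : Type*} [NormedAddCommGroup E] [NormedSpace ℝ E]
    {μ : Measure (K × Multiplicative ℝ)} {c : NNReal}
    (hc : μ.map (fun p => p.2.toAdd) = c • (volume : Measure ℝ)) {F : ℝ → E}
    (hF : AEStronglyMeasurable F) : ∫ p, F p.2.toAdd ∂μ = (c : ℝ) • ∫ s, F s := by
  rw [← integral_map (φ := fun p : K × Multiplicative ℝ => p.2.toAdd)
    continuous_snd_toAdd.measurable.aemeasurable
    (by rw [hc]; exact hF.smul_measure c), hc, integral_smul_nnreal_measure]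
  rfl

end HaarProjection

namespace CovariantRep

section Algebra

variable {K : Type v} [Group K] [TopologicalSpace K] {M : Type u} [CStarAlgebra M]
  {α : CStarAction (K × Multiplicative ℝ) M} (ρ : CovariantRep α)

/-- The operator `U_g`. -/
noncomputable def op (g : K × Multiplicative ℝ) : ρ.H →L[ℂ] ρ.H := ρ.U g

theorem op_mul (g h : K × Multiplicative ℝ) (ξ : ρ.H) : ρ.op (g * h) ξ = ρ.op g (ρ.op h ξ) := by
  unfold op
  rw [map_mul]; rfl

theorem op_one (ξ : ρ.H) : ρ.op 1 ξ = ξ := by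
  unfold op
  rw [map_one]; rfl

theorem norm_op (g : K × Multiplicative ℝ) (ξ : ρ.H) : ‖ρ.op g ξ‖ = ‖ξ‖ :=
  ContinuousLinearMap.norm_map_of_mem_unitary (ρ.U g).2 ξ

theorem inner_op_op (g : K × Multiplicative ℝ) (ξ η : ρ.H) :
    inner ℂ (ρ.op g ξ) (ρ.op g η) = inner ℂ ξ η :=
  ContinuousLinearMap.inner_map_map_of_mem_unitary (ρ.U g).2 ξ η

theorem op_π (g : K × Multiplicative ℝ) (x : M) (ξ : ρ.H) :
    ρ.op g (ρ.π x ξ) = ρ.π (α.toHom g x) (ρ.op g ξ) := by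
  rw [← ρ.covariant g x]
  have h : star (ρ.U g : ρ.H →L[ℂ] ρ.H) * (ρ.U g : ρ.H →L[ℂ] ρ.H) = 1 := (ρ.U g).2.1
  have h2 := congrArg (fun T : ρ.H →L[ℂ] ρ.H => T ξ) h
  simp only [mul_apply_eq_comp, one_apply_eq_self] at h2
  simp only [mul_apply_eq_comp, op, h2]

/-- The restriction of the unitary representation to the factor `ℝ`. -/
noncomputable def flow : UnitaryFlow ρ.H where
  op t := ρ.op (1, Multiplicative.ofAdd t)
  op_zero := by ext ξ; exact ρ.op_one ξ
  op_add s t := by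
    ext ξ
    rw [mul_apply_eq_comp, ← ρ.op_mul]
    simp
  continuous_op ξ := (ρ.continuous_U ξ).comp
    (f := fun t : ℝ => ((1 : K), Multiplicative.ofAdd t)) (by fun_prop)
  norm_op t ξ := ρ.norm_op _ ξ

theorem flow_op (t : ℝ) (ξ : ρ.H) : ρ.flow.op t ξ = ρ.op (1, Multiplicative.ofAdd t) ξ := rfl

theorem op_eq (k : K) (t : Multiplicative ℝ) (ξ : ρ.H) :
    ρ.op (k, t) ξ = ρ.flow.op t.toAdd (ρ.op (k, 1) ξ) := by
  rw [flow_op, ← ρ.op_mul]; simp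

theorem op_flow (k : K) (t : ℝ) (ξ : ρ.H) :
    ρ.op (k, 1) (ρ.flow.op t ξ) = ρ.flow.op t (ρ.op (k, 1) ξ) := by
  rw [flow_op, flow_op, ← ρ.op_mul, ← ρ.op_mul]; simp

/-- The closed subspace of the vectors fixed by `K`. -/
def fixedSubspace : Submodule ℂ ρ.H where
  carrier := {ξ | ∀ k : K, ρ.op (k, 1) ξ = ξ}
  add_mem' := fun h h' k => by rw [map_add, h k, h' k]
  zero_mem' := fun k => map_zero _
  smul_mem' := fun c ξ h k => by rw [map_smul, h k]

theorem mem_fixedSubspace {ξ : ρ.H} : ξ ∈ ρ.fixedSubspace ↔ ∀ k : K, ρ.op (k, 1) ξ = ξ := Iff.rfl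

theorem isClosed_fixedSubspace : IsClosed (ρ.fixedSubspace : Set ρ.H) := by
  have : (ρ.fixedSubspace : Set ρ.H) = ⋂ k : K, {ξ | ρ.op (k, 1) ξ = ξ} := by
    ext ξ; simp [mem_fixedSubspace]
  rw [this]
  exact isClosed_iInter fun k => isClosed_eq (ρ.op (k, 1)).continuous continuous_id

instance : CompleteSpace ρ.fixedSubspace := ρ.isClosed_fixedSubspace.completeSpace_coe

theorem op_mem_fixedSubspace (g : K × Multiplicative ℝ) {ξ : ρ.H} (hξ : ξ ∈ ρ.fixedSubspace) :
    ρ.op g ξ ∈ ρ.fixedSubspace := by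
  obtain ⟨k, t⟩ := g
  rw [op_eq, hξ k]
  intro k'
  rw [op_flow, hξ k']

theorem smear_mem_fixedSubspace {h : ℝ → ℝ} (hh : Integrable h) {ξ : ρ.H}
    (hξ : ξ ∈ ρ.fixedSubspace) : ρ.flow.smear h hh ξ ∈ ρ.fixedSubspace := by
  intro k
  rw [UnitaryFlow.smear_apply, ← ContinuousLinearMap.integral_comp_comm _
    (ρ.flow.integrable_smul_op hh ξ)]
  congr 1
  funext s
  rw [← Complex.coe_smul, map_smul, op_flow, hξ k]

theorem π_mem_fixedSubspace {b : M} (hb : ∀ k, α.actK k b = b) {ξ : ρ.H}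
    (hξ : ξ ∈ ρ.fixedSubspace) : ρ.π b ξ ∈ ρ.fixedSubspace := by
  intro k
  rw [op_π, hξ k]
  congr 2
  exact hb k

/-- The operator `-2 lam π(b) (lam + δ)⁻¹ P`, where `δ` is the generator of the action of `ℝ` and
`P` is the projection to the vectors fixed by `K`. -/
noncomputable def transitionOp (b : M) {lam : ℝ} (hlam : 0 < lam) : ρ.H →L[ℂ] ρ.H :=
  ((-(2 * lam) : ℝ) : ℂ) • (ρ.π b * ρ.flow.resolvent hlam * ρ.fixedSubspace.starProjection)

theorem transitionOp_apply (b : M) {lam : ℝ} (hlam : 0 < lam) (ξ : ρ.H) :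
    ρ.transitionOp b hlam ξ
      = -((2 * lam) • ρ.π b (ρ.flow.resolvent hlam (ρ.fixedSubspace.starProjection ξ))) := by
  rw [transitionOp, smul_apply, mul_apply_eq_comp, mul_apply_eq_comp, Complex.coe_smul, neg_smul]

theorem continuous_π : Continuous ρ.π :=
  AddMonoidHomClass.continuous_of_bound ρ.π 1 fun x => by
    rw [one_mul]; exact NonUnitalStarAlgHom.norm_apply_le ρ.π x

theorem hasDerivAt_π_actR {b d : M} (hd : HasDerivAt (fun t => α.actR t b) d 0) (η : ρ.H) :
    HasDerivAt (fun t => ρ.π (α.actR t b) η) (ρ.π d η) 0 := by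
  let ℓ : M →L[ℂ] ρ.H :=
    (ContinuousLinearMap.apply ℂ ρ.H η).comp ⟨ρ.π.toAlgHom.toLinearMap, ρ.continuous_π⟩
  exact (ℓ.restrictScalars ℝ).hasFDerivAt.comp_hasDerivAt 0 hd

theorem π_smul_real (r : ℝ) (x : M) : ρ.π (r • x) = r • ρ.π x := by
  rw [← Complex.coe_smul, map_smul, Complex.coe_smul]

variable [PartialOrder M] [StarOrderedRing M]

/-- The operator `T = 1 - 2 lam π(b) (lam + δ)⁻¹ P` is bounded below, uniformly for all covariant
representations. -/
theorem half_norm_sq_le_transitionOp {b d : M} {lam : ℝ} (hlam : 0 < lam) (hb : IsSelfAdjoint b)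
    (hbK : ∀ k, α.actK k b = b) (hd : HasDerivAt (fun t => α.actR t b) d 0)
    (hpos : 0 ≤ (lam ^ 2) • ((1 - (2 : ℝ) • b) * (1 - (2 : ℝ) • b)) + (2 * lam) • d
        - (lam ^ 2 / 2) • (1 : M)) (ξ : ρ.H) :
    1 / 2 * ‖ξ‖ ^ 2 ≤ ‖ξ + ρ.transitionOp b hlam ξ‖ ^ 2 := by
  set P := ρ.fixedSubspace.starProjection with hP
  set η := ρ.flow.resolvent hlam (P ξ) with hη
  have hPξ : P ξ ∈ ρ.fixedSubspace := Submodule.starProjection_apply_mem _ _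
  have hηF : η ∈ ρ.fixedSubspace := ρ.smear_mem_fixedSubspace _ hPξ
  have hbηF : ρ.π b η ∈ ρ.fixedSubspace := ρ.π_mem_fixedSubspace hbK hηF
  have hder : HasDerivAt (fun t => ρ.flow.op t η) (P ξ - lam • η) 0 :=
    ρ.flow.hasDerivAt_op_resolvent hlam (P ξ)
  have hBsa : IsSelfAdjoint (ρ.π b) := hb.map ρ.π
  have hB0 : ρ.π (α.actR 0 b) = ρ.π b := by rw [α.actR_zero]
  have hq : lam ^ 2 / 2 * ‖η‖ ^ 2 ≤ lam ^ 2 * ‖η - (2 : ℝ) • ρ.π b η‖ ^ 2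
      + 2 * lam * RCLike.re (inner ℂ η (ρ.π d η)) := by
    have h1 := map_nonneg ρ.π hpos
    rw [ContinuousLinearMap.nonneg_iff_isPositive] at h1
    have h2 := h1.re_inner_nonneg_right η
    have hsa : IsSelfAdjoint (1 - (2 : ℝ) • ρ.π b) :=
      (IsSelfAdjoint.one _).sub (IsSelfAdjoint.smul (by simp [IsSelfAdjoint]) hBsa)
    have h3 : inner ℂ η (((1 - (2 : ℝ) • ρ.π b) * (1 - (2 : ℝ) • ρ.π b)) η)
        = inner ℂ ((1 - (2 : ℝ) • ρ.π b) η) ((1 - (2 : ℝ) • ρ.π b) η) := by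
      rw [mul_apply_eq_comp]
      conv_lhs => rw [← hsa.star_eq]
      rw [ContinuousLinearMap.star_eq_adjoint, ContinuousLinearMap.adjoint_inner_right,
        ← ContinuousLinearMap.star_eq_adjoint, hsa.star_eq]
    have hre : ∀ (r : ℝ) (x y : ρ.H), RCLike.re (inner ℂ x (r • y)) = r * RCLike.re (inner ℂ x y) := by
      intro r x y
      rw [← Complex.coe_smul, inner_smul_right]
      exact RCLike.re_ofReal_mul r _
    simp only [map_sub, map_add, map_mul, map_one, π_smul_real] at h2
    rw [sub_apply, add_apply, inner_sub_right, inner_add_right, smul_apply, smul_apply, smul_apply,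
      map_sub, map_add, hre, hre, hre, h3, inner_self_eq_norm_sq, one_apply_eq_self,
      inner_self_eq_norm_sq, sub_apply, one_apply_eq_self, smul_apply] at h2
    linarith
  have hcore := ρ.flow.half_norm_sq_le (lam := lam) (B := fun t => ρ.π (α.actR t b)) (D := ρ.π d)
    hder (ρ.hasDerivAt_π_actR hd η) (fun t ζ => by
      rw [flow_op, op_π, flow_op]
      congr 2
      change α.actR t (α.actR (-t) b) = α.actR 0 b
      rw [← α.actR_add, add_neg_cancel]) (by rw [hB0]; exact hBsa) (by simp only [hB0]; exact hq)
  simp only [hB0, sub_add_cancel] at hcore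
  set w := P ξ - (2 * lam) • ρ.π b η with hw
  have hwF : w ∈ ρ.fixedSubspace := by
    rw [hw, ← Complex.coe_smul]
    exact Submodule.sub_mem _ hPξ (Submodule.smul_mem _ _ hbηF)
  have hdecomp : ξ + ρ.transitionOp b hlam ξ = w + (ξ - P ξ) := by
    rw [transitionOp_apply]
    simp only [hw, hη, hP]
    abel
  have horth : ∀ x ∈ ρ.fixedSubspace, inner ℂ x (ξ - P ξ) = 0 := fun x hx =>
    (Submodule.mem_orthogonal _ _).1 (Submodule.sub_starProjection_mem_orthogonal ξ) x hx
  have hpyth : ∀ x ∈ ρ.fixedSubspace, ‖x + (ξ - P ξ)‖ ^ 2 = ‖x‖ ^ 2 + ‖ξ - P ξ‖ ^ 2 := fun x hx => by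
    rw [@norm_add_sq ℂ, horth x hx, map_zero]; ring
  have h1 := hpyth w hwF
  have h2 := hpyth (P ξ) hPξ
  rw [add_sub_cancel] at h2
  rw [hdecomp, h1, h2]
  nlinarith [sq_nonneg ‖ξ - P ξ‖]

end Algebra

end CovariantRep

/-! ### The transition element belongs to the crossed product -/

section Membership

variable {K : Type v} [Group K] [TopologicalSpace K] [CompactSpace K]
  {M : Type u} [CStarAlgebra M] {α : CStarAction (K × Multiplicative ℝ) M}

/-- The function `(k, s) ↦ h(s) b` on `K × ℝ`. -/
noncomputable def compactlySupportedTensor (K : Type v) [TopologicalSpace K] [CompactSpace K] (b : M)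
    {h : ℝ → ℝ} (hc : Continuous h) (hs : HasCompactSupport h) : C_c(K × Multiplicative ℝ, M) where
  toFun p := h p.2.toAdd • b
  continuous_toFun := (hc.comp continuous_snd_toAdd).smul continuous_const
  hasCompactSupport' := by
    refine (isCompact_preimage_snd_toAdd (K := K) hs.isCompact).of_isClosed_subset
      isClosed_closure (closure_minimal (fun p hp => ?_)
        ((isClosed_tsupport h).preimage continuous_snd_toAdd))
    refine subset_tsupport h fun h0 => hp ?_
    change h p.2.toAdd • b = 0
    rw [h0, zero_smul]

variable [IsTopologicalGroup K]
  [MeasurableSpace (K × Multiplicative ℝ)] [BorelSpace (K × Multiplicative ℝ)]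

/-- Integration over `K` projects to the vectors fixed by `K`. -/
theorem CovariantRep.integrated_compactlySupportedTensor (ρ : CovariantRep α)
    (μ : Measure (K × Multiplicative ℝ)) [μ.IsHaarMeasure] {c : NNReal}
    (hμ : μ.map (fun p => p.2.toAdd) = c • (volume : Measure ℝ)) (b : M)
    {h : ℝ → ℝ} (hc : Continuous h) (hs : HasCompactSupport h) (hh : Integrable h) (ξ : ρ.H) :
    ρ.integrated μ (compactlySupportedTensor K b hc hs) ξ
      = (c : ℝ) • ρ.π b (ρ.flow.smear h hh (ρ.fixedSubspace.starProjection ξ)) := by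
  set P := ρ.fixedSubspace.starProjection with hP
  have hint : ∀ ξ, Integrable (fun p : K × Multiplicative ℝ => h p.2.toAdd • ρ.op p ξ) μ := by
    intro ξ
    have := ρ.integrable_integrand μ (compactlySupportedTensor K (1 : M) hc hs) ξ
    refine this.congr (ae_of_all _ fun p => ?_)
    change ρ.π (h p.2.toAdd • (1 : M)) _ = _
    rw [ρ.π_smul_real, map_one]
    rfl
  have h1 : ρ.integrated μ (compactlySupportedTensor K b hc hs) ξ
      = ρ.π b (∫ p, h p.2.toAdd • ρ.op p ξ ∂μ) := by
    rw [← ContinuousLinearMap.integral_comp_comm _ (hint ξ)]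
    change ∫ p, ρ.π (h p.2.toAdd • b) (ρ.op p ξ) ∂μ = _
    congr 1
    funext p
    rw [ρ.π_smul_real, smul_apply, ← Complex.coe_smul, ← Complex.coe_smul, map_smul]
  have h2 : ∫ p, h p.2.toAdd • ρ.op p (P ξ) ∂μ = (c : ℝ) • ρ.flow.smear h hh (P ξ) := by
    rw [UnitaryFlow.smear_apply, ← integral_comp_snd_toAdd hμ
      (ρ.flow.integrable_smul_op hh (P ξ)).aestronglyMeasurable]
    congr 1
    funext p
    obtain ⟨k, t⟩ := p
    have hPF : P ξ ∈ ρ.fixedSubspace := Submodule.starProjection_apply_mem _ _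
    rw [ρ.op_eq, ρ.mem_fixedSubspace.1 hPF k]
  -- the integral maps the orthogonal complement of the fixed vectors to itself and to fixed vectors
  have h3 : ∫ p, h p.2.toAdd • ρ.op p (ξ - P ξ) ∂μ = 0 := by
    set I := ∫ p, h p.2.toAdd • ρ.op p (ξ - P ξ) ∂μ with hI
    have hfix : I ∈ ρ.fixedSubspace := by
      intro k
      rw [hI, ← ContinuousLinearMap.integral_comp_comm _ (hint _)]
      conv_rhs => rw [← integral_mul_left_eq_self _ ((k, 1) : K × Multiplicative ℝ)]
      congr 1
      funext p
      rw [ρ.op_mul, ← Complex.coe_smul, map_smul, Complex.coe_smul]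
      simp
    have horth : inner ℂ I I = 0 := by
      conv_lhs => rw [hI]
      rw [← hI, ← integral_inner (hint _)]
      refine integral_eq_zero_of_ae (ae_of_all _ fun p => ?_)
      change inner ℂ I (h p.2.toAdd • ρ.op p (ξ - P ξ)) = 0
      rw [← Complex.coe_smul, inner_smul_right]
      have e : I = ρ.op p (ρ.op p⁻¹ I) := by rw [← ρ.op_mul, mul_inv_cancel, ρ.op_one]
      rw [e, ρ.inner_op_op, (Submodule.mem_orthogonal _ _).1
        (Submodule.sub_starProjection_mem_orthogonal ξ) _ (ρ.op_mem_fixedSubspace _ hfix), mul_zero]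
    exact inner_self_eq_zero.1 horth
  have h4 : ∫ p, h p.2.toAdd • ρ.op p ξ ∂μ
      = (∫ p, h p.2.toAdd • ρ.op p (P ξ) ∂μ) + ∫ p, h p.2.toAdd • ρ.op p (ξ - P ξ) ∂μ := by
    rw [← integral_add (hint _) (hint _)]
    congr 1
    funext p
    rw [← smul_add, ← map_add, add_sub_cancel]
  rw [h1, h4, h2, h3, add_zero, ← Complex.coe_smul, map_smul, Complex.coe_smul]

/-- The family of the operators `-2 lam π(b) (lam + δ)⁻¹ P`, over all covariant representations. -/
noncomputable def transitionElement (α : CStarAction (K × Multiplicative ℝ) M) (b : M) {lam : ℝ}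
    (hlam : 0 < lam) : lp (fun ρ : CovariantRep α => ρ.H →L[ℂ] ρ.H) ∞ :=
  ⟨fun ρ => ρ.transitionOp b hlam, memℓp_infty
    ⟨2 * lam * (‖b‖ * ((∫ s, |resolventKernel lam s|) * 1)), by
      rintro _ ⟨ρ, rfl⟩
      have h0 : 0 ≤ ∫ s, |resolventKernel lam s| := integral_nonneg fun s => abs_nonneg _
      change ‖((-(2 * lam) : ℝ) : ℂ) •
        (ρ.π b * ρ.flow.resolvent hlam * ρ.fixedSubspace.starProjection)‖ ≤ _
      rw [norm_smul, Complex.norm_real, norm_neg, Real.norm_of_nonneg (by positivity)]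
      gcongr
      rw [mul_assoc]
      refine (norm_mul_le _ _).trans ?_
      gcongr
      · exact NonUnitalStarAlgHom.norm_apply_le ρ.π b
      refine (norm_mul_le _ _).trans ?_
      gcongr
      · exact ρ.flow.norm_smear_le _
      · exact Submodule.starProjection_norm_le _⟩⟩

/-- The family belongs to the crossed product, as the resolvent kernel is an `L¹`-limit of
continuous functions with compact support. -/
theorem transitionElement_mem_crossedProduct (μ : Measure (K × Multiplicative ℝ)) [μ.IsHaarMeasure]
    (b : M) {lam : ℝ} (hlam : 0 < lam) : transitionElement α b hlam ∈ crossedProduct α μ := by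
  obtain ⟨c, hc0, hμ⟩ := exists_map_snd_toAdd_eq μ
  have hc0' : (c : ℝ) ≠ 0 := by exact_mod_cast hc0
  change transitionElement α b hlam ∈ closure
    ((NonUnitalStarAlgebra.adjoin ℂ (Set.range (universalIntegrated α μ)) :
      NonUnitalStarSubalgebra ℂ _) : Set (lp (fun ρ : CovariantRep α => ρ.H →L[ℂ] ρ.H) ∞))
  rw [Metric.mem_closure_iff]
  intro ε hε
  set δ := ε / (2 * (2 * lam * (‖b‖ + 1))) with hδ
  have hδpos : 0 < δ := by positivity
  obtain ⟨g, hgs, hgn, hgc, hgi⟩ :=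
    (integrable_resolventKernel hlam).exists_hasCompactSupport_integral_sub_le hδpos
  set r : ℝ := -(2 * lam) / c with hr
  have hfc : Continuous fun s => r * g s := continuous_const.mul hgc
  have hfs : HasCompactSupport fun s => r * g s := hgs.mul_left
  have hfi : Integrable fun s => r * g s := hgi.const_mul r
  refine ⟨universalIntegrated α μ (compactlySupportedTensor K b hfc hfs),
    NonUnitalStarAlgebra.subset_adjoin ℂ _ ⟨_, rfl⟩, ?_⟩
  rw [dist_eq_norm]
  refine lt_of_le_of_lt (lp.norm_le_of_forall_le (C := ε / 2) (by positivity) fun ρ => ?_)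
    (half_lt_self hε)
  refine ContinuousLinearMap.opNorm_le_bound _ (by positivity) fun ξ => ?_
  change ‖ρ.transitionOp b hlam ξ - ρ.integrated μ (compactlySupportedTensor K b hfc hfs) ξ‖ ≤ _
  rw [ρ.integrated_compactlySupportedTensor μ hμ b hfc hfs hfi, ρ.transitionOp_apply]
  set η := ρ.fixedSubspace.starProjection ξ with hη
  have hsm : ρ.flow.smear (fun s => r * g s) hfi η = r • ρ.flow.smear g hgi η := by
    rw [UnitaryFlow.smear_apply, UnitaryFlow.smear_apply, ← integral_smul]
    simp only [mul_smul]
  have e : -((2 * lam) • ρ.π b (ρ.flow.resolvent hlam η))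
      - (c : ℝ) • ρ.π b (ρ.flow.smear (fun s => r * g s) hfi η)
      = (-(2 * lam)) • ρ.π b (ρ.flow.resolvent hlam η - ρ.flow.smear g hgi η) := by
    have e1 : ρ.π b (r • ρ.flow.smear g hgi η) = r • ρ.π b (ρ.flow.smear g hgi η) := by
      rw [← Complex.coe_smul, map_smul, Complex.coe_smul]
    have e2 : (c : ℝ) * r = -(2 * lam) := by rw [hr]; field_simp
    rw [hsm, e1, smul_smul, e2, map_sub]
    module
  have hn : ‖η‖ ≤ ‖ξ‖ := Submodule.norm_starProjection_apply_le _ _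
  have h1 := ρ.flow.norm_smear_sub_apply_le (integrable_resolventKernel hlam) hgi η
  have h2 : ‖ρ.π b (ρ.flow.resolvent hlam η - ρ.flow.smear g hgi η)‖ ≤ ‖b‖ * (δ * ‖ξ‖) := by
    refine ((ρ.π b).le_opNorm _).trans ?_
    gcongr
    · exact NonUnitalStarAlgHom.norm_apply_le ρ.π b
    · refine h1.trans ?_
      gcongr
      exact hgn
  rw [e, norm_smul, norm_neg, Real.norm_of_nonneg (by positivity)]
  calc 2 * lam * ‖ρ.π b (ρ.flow.resolvent hlam η - ρ.flow.smear g hgi η)‖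
      ≤ 2 * lam * (‖b‖ * (δ * ‖ξ‖)) := by gcongr
    _ ≤ 2 * lam * ((‖b‖ + 1) * (δ * ‖ξ‖)) := by gcongr; linarith
    _ = ε / 2 * ‖ξ‖ := by
      rw [hδ]
      have : ‖b‖ + 1 ≠ 0 := by positivity
      field_simp

end Membership

/-! ### Isometries from operators that are bounded below -/

section Isometry

/-- The hypotheses say that `1 + x` is a nonunitary isometry. It lives in the unitization of `A`
unless `A` has a unit element `e`; then it is `e + x`. -/
theorem unitizationHasNonunitaryIsometry_of_exists {A : Type*} [NonUnitalRing A] [StarRing A]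
    [Module ℂ A] [IsScalarTower ℂ A A] [SMulCommClass ℂ A A] [StarModule ℂ A] (x : A)
    (h1 : x + star x + star x * x = 0) (h2 : x + star x + x * star x ≠ 0) :
    UnitizationHasNonunitaryIsometry A := by
  by_cases he : ∃ e : A, IsUnitElement e
  · left
    obtain ⟨e, he⟩ := he
    have hse : star e = e := by
      have h3 : e * star e = star e := (he (star e)).1
      have h4 := congrArg star h3
      rw [star_mul, star_star, h3] at h4
      exact h4
    refine ⟨e, he, e + x, ?_, fun h => h2 ?_⟩
    · rw [star_add, hse, add_mul, mul_add, mul_add, (he e).1, (he x).1, (he (star x)).2]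
      rw [add_assoc, ← add_assoc x, h1, add_zero]
    · rw [star_add, hse, add_mul, mul_add, mul_add, (he e).1, (he x).2, (he (star x)).1,
        add_assoc] at h
      have h5 := add_eq_left.1 h
      rw [← h5]
      abel
  · refine Or.inr ⟨he, 1 + (x : Unitization ℂ A), ?_, fun h => h2 ?_⟩
    · have : star (1 + (x : Unitization ℂ A)) * (1 + (x : Unitization ℂ A))
          = 1 + ((x + star x + star x * x : A) : Unitization ℂ A) := by
        rw [star_add, star_one, Unitization.inr_add, Unitization.inr_add, Unitization.inr_mul,
          Unitization.inr_star]
        noncomm_ring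
      rw [this, h1, Unitization.inr_zero, add_zero]
    · have : (1 + (x : Unitization ℂ A)) * star (1 + (x : Unitization ℂ A))
          = 1 + ((x + star x + x * star x : A) : Unitization ℂ A) := by
        rw [star_add, star_one, Unitization.inr_add, Unitization.inr_add, Unitization.inr_mul,
          Unitization.inr_star]
        noncomm_ring
      rw [this] at h
      have h5 := add_eq_left.1 h
      rwa [← Unitization.inr_zero ℂ, Unitization.inr_injective.eq_iff] at h5

theorem algebraMap_neg_half_le_of_bounded_below {H : Type*} [NormedAddCommGroup H]
    [InnerProductSpace ℂ H] [CompleteSpace H] {y : H →L[ℂ] H}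
    (h : ∀ ξ, 1 / 2 * ‖ξ‖ ^ 2 ≤ ‖ξ + y ξ‖ ^ 2) :
    algebraMap ℝ (H →L[ℂ] H) (-(1 / 2)) ≤ y + star y + star y * y := by
  rw [ContinuousLinearMap.le_def, ContinuousLinearMap.isPositive_def']
  have e : y + star y + star y * y - algebraMap ℝ (H →L[ℂ] H) (-(1 / 2))
      = star (1 + y) * (1 + y) - (1 / 2 : ℝ) • 1 := by
    rw [Algebra.algebraMap_eq_smul_one, star_add, star_one]
    simp only [add_mul, mul_add, one_mul, mul_one]
    module
  rw [e]
  refine ⟨?_, fun ξ => ?_⟩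
  · exact (IsSelfAdjoint.star_mul_self _).sub
      (IsSelfAdjoint.smul (by simp [IsSelfAdjoint]) (IsSelfAdjoint.one _))
  · rw [ContinuousLinearMap.reApplyInnerSelf_apply, sub_apply, inner_sub_left,
      inner_apply_star_mul, map_sub, inner_self_eq_norm_sq, smul_apply, one_apply_eq_self,
      ← Complex.coe_smul, inner_smul_left, Complex.conj_ofReal]
    have : RCLike.re (((1 / 2 : ℝ) : ℂ) * inner ℂ ξ ξ) = 1 / 2 * ‖ξ‖ ^ 2 := by
      rw [← inner_self_eq_norm_sq (𝕜 := ℂ)]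
      exact RCLike.re_ofReal_mul _ _
    rw [this]
    have := h ξ
    rw [add_apply, one_apply_eq_self]
    linarith

/-- The function `r ↦ (1 + r)^(-1/2) - 1` for `r ≥ -1/2`, continued by a constant. It vanishes at
`0`, so that it can be applied to elements of a nonunital algebra. -/
noncomputable def invSqrtSubOne (r : ℝ) : ℝ := (√(max (1 + r) (1 / 2)))⁻¹ - 1

theorem sqrt_max_pos (r : ℝ) : 0 < √(max (1 + r) (1 / 2)) :=
  Real.sqrt_pos.2 (lt_max_of_lt_right (by norm_num))

theorem continuous_invSqrtSubOne : Continuous invSqrtSubOne := by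
  refine Continuous.sub (Continuous.inv₀ (by fun_prop) fun r => ?_) continuous_const
  exact (sqrt_max_pos r).ne'

theorem invSqrtSubOne_zero : invSqrtSubOne 0 = 0 := by
  rw [invSqrtSubOne, add_zero, max_eq_left (by norm_num)]; simp

theorem invSqrtSubOne_spec {r : ℝ} (hr : -(1 / 2) ≤ r) :
    (1 + invSqrtSubOne r) * ((1 + r) * (1 + invSqrtSubOne r)) = 1 := by
  have h : 1 + invSqrtSubOne r = (√(1 + r))⁻¹ := by
    rw [invSqrtSubOne, max_eq_left (by linarith)]; ring
  have hpos : 0 < √(1 + r) := Real.sqrt_pos.2 (by linarith)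
  rw [h]
  have h2 : 1 + r = √(1 + r) * √(1 + r) := (Real.mul_self_sqrt (by linarith)).symm
  conv_lhs => rw [h2]
  rw [Real.sqrt_mul_self hpos.le]
  field_simp

/-- The polar decomposition of an operator `1 + y` that is bounded below: with
`w = (1 + y)* (1 + y) - 1`, the operator `(1 + y) (1 + w)^(-1/2)` is an isometry. -/
theorem isometry_of_bounded_below {H : Type*} [NormedAddCommGroup H]
    [InnerProductSpace ℂ H] [CompleteSpace H] {y q : H →L[ℂ] H}
    (h : ∀ ξ, 1 / 2 * ‖ξ‖ ^ 2 ≤ ‖ξ + y ξ‖ ^ 2)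
    (hq : q = cfc invSqrtSubOne (y + star y + star y * y)) :
    star ((1 + y) * (1 + q)) * ((1 + y) * (1 + q)) = 1 := by
  set w := y + star y + star y * y with hw
  have hwsa : IsSelfAdjoint w := by
    rw [hw]
    exact (IsSelfAdjoint.add_star_self y).add (IsSelfAdjoint.star_mul_self y)
  have hspec : ∀ r ∈ spectrum ℝ w, -(1 / 2) ≤ r :=
    (algebraMap_le_iff_le_spectrum (a := w) (r := -(1 / 2))).1
      (algebraMap_neg_half_le_of_bounded_below h)
  have hc := continuous_invSqrtSubOne
  have h1q : 1 + q = cfc (fun r => 1 + invSqrtSubOne r) w := by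
    rw [cfc_const_add (1 : ℝ) invSqrtSubOne w hc.continuousOn hwsa, ← hq, map_one]
  have hqsa : star (1 + q) = 1 + q := by
    rw [h1q]; exact cfc_predicate (R := ℝ) (p := IsSelfAdjoint) _ w
  have h1w : star (1 + y) * (1 + y) = cfc (fun r : ℝ => 1 + r) w := by
    rw [cfc_const_add (1 : ℝ) (fun r => r) w (by fun_prop) hwsa, cfc_id' ℝ w hwsa, map_one, hw, star_add, star_one]
    noncomm_ring
  rw [star_mul, hqsa, mul_assoc, ← mul_assoc (star (1 + y)), h1w, h1q,
    ← cfc_mul _ _ w (by fun_prop) (by fun_prop), ← cfc_mul _ _ w (by fun_prop) (by fun_prop)]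
  rw [← cfc_one ℝ w]
  exact cfc_congr fun r hr => invSqrtSubOne_spec (hspec r hr)

/-- If a C*-algebra `A` has a jointly faithful family of representations `e i`, and contains an
element `y` such that the operators `1 + e i y` are uniformly bounded below and not all of them are
surjective, then `A¹` contains a nonunitary isometry. -/
theorem unitizationHasNonunitaryIsometry_of_bounded_below {A : Type*} [NonUnitalCStarAlgebra A]
    {ι : Type*} {H : ι → Type*}
    [∀ i, NormedAddCommGroup (H i)] [∀ i, InnerProductSpace ℂ (H i)] [∀ i, CompleteSpace (H i)]
    (e : ∀ i, A →⋆ₙₐ[ℂ] (H i →L[ℂ] H i)) (hinj : ∀ z : A, (∀ i, e i z = 0) → z = 0) (y : A)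
    (hlow : ∀ i ξ, 1 / 2 * ‖ξ‖ ^ 2 ≤ ‖ξ + e i y ξ‖ ^ 2)
    (hns : ∃ i, ¬ Function.Surjective fun ξ => ξ + e i y ξ) :
    UnitizationHasNonunitaryIsometry A := by
  let w : A := y + star y + star y * y
  have hwsa : IsSelfAdjoint w :=
    (IsSelfAdjoint.add_star_self y).add (IsSelfAdjoint.star_mul_self y)
  let q : A := cfcₙ invSqrtSubOne w
  have hew : ∀ i, e i w = e i y + star (e i y) + star (e i y) * e i y := fun i => by
    simp only [w, map_add, map_mul, map_star]
  have heq : ∀ i, e i q = cfc invSqrtSubOne (e i y + star (e i y) + star (e i y) * e i y) := by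
    intro i
    have hcont : Continuous (e i) := AddMonoidHomClass.continuous_of_bound (e i) 1 fun x => by
      rw [one_mul]; exact NonUnitalStarAlgHom.norm_apply_le (e i) x
    have h1 : e i q = cfcₙ invSqrtSubOne (e i w) :=
      NonUnitalStarAlgHomClass.map_cfcₙ (R := ℝ) (S := ℂ) (e i) invSqrtSubOne w
        continuous_invSqrtSubOne.continuousOn invSqrtSubOne_zero hcont hwsa (hwsa.map (e i))
    rw [h1, cfcₙ_eq_cfc continuous_invSqrtSubOne.continuousOn invSqrtSubOne_zero, hew]
  let x : A := y + q + y * q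
  have hx : ∀ i, 1 + e i x = (1 + e i y) * (1 + e i q) := fun i => by
    simp only [x, map_add, map_mul]
    noncomm_ring
  have hiso : ∀ i, star (1 + e i x) * (1 + e i x) = 1 := fun i => by
    rw [hx]; exact isometry_of_bounded_below (hlow i) (heq i)
  refine unitizationHasNonunitaryIsometry_of_exists x (hinj _ fun i => ?_) fun h0 => ?_
  · have h1 := hiso i
    have h2 : star (1 + e i x) * (1 + e i x) = 1 + e i (x + star x + star x * x) := by
      simp only [map_add, map_mul, map_star, star_add, star_one]
      noncomm_ring
    rw [h2] at h1
    exact add_eq_left.1 h1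
  · obtain ⟨i, hi⟩ := hns
    apply hi
    have h2 : (1 + e i x) * star (1 + e i x) = 1 + e i (x + star x + x * star x) := by
      simp only [map_add, map_mul, map_star, star_add, star_one]
      noncomm_ring
    rw [h0, map_zero, add_zero, hx, mul_assoc] at h2
    rw [← hx] at h2
    intro ζ
    refine ⟨(1 + e i q) (star (1 + e i x) ζ), ?_⟩
    have h3 := congrArg (fun T : H i →L[ℂ] H i => T ζ) h2
    exact h3

/-- The coordinate map of an `ℓ^∞`-product of operator algebras. -/
def lpEval {ι : Type*} (H : ι → Type*) [∀ i, NormedAddCommGroup (H i)]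
    [∀ i, InnerProductSpace ℂ (H i)] [∀ i, CompleteSpace (H i)] (i : ι) :
    lp (fun i => H i →L[ℂ] H i) ∞ →⋆ₙₐ[ℂ] (H i →L[ℂ] H i) where
  toFun x := x i
  map_smul' _ _ := rfl
  map_zero' := rfl
  map_add' _ _ := rfl
  map_mul' _ _ := rfl
  map_star' _ := rfl

/-- The crossed product is faithfully represented by its coordinates, the covariant representations;
so a criterion for a nonunitary isometry can be checked in these. -/
theorem crossedProduct_hasNonunitaryIsometry {G : Type v} [Group G] [TopologicalSpace G]
    {M : Type u} [CStarAlgebra M] [MeasurableSpace G] [BorelSpace G] (α : CStarAction G M)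
    (μ : Measure G) [μ.IsHaarMeasure] (y : lp (fun ρ : CovariantRep α => ρ.H →L[ℂ] ρ.H) ∞)
    (hy : y ∈ crossedProduct α μ)
    (hlow : ∀ (ρ : CovariantRep α) ξ, 1 / 2 * ‖ξ‖ ^ 2 ≤ ‖ξ + y ρ ξ‖ ^ 2)
    (hns : ∃ ρ : CovariantRep α, ¬ Function.Surjective fun ξ => ξ + y ρ ξ) :
    UnitizationHasNonunitaryIsometry (crossedProduct α μ) := by
  let i : NonUnitalCStarAlgebra (crossedProduct α μ) :=
    NonUnitalStarSubalgebra.nonUnitalCStarAlgebra _ (h_closed := isClosed_closure)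
  exact @unitizationHasNonunitaryIsometry_of_bounded_below _ i _ _ _ _ _
    (fun ρ => (lpEval _ ρ).comp (NonUnitalStarSubalgebraClass.subtype (crossedProduct α μ)))
    (fun z hz => Subtype.ext (lp.ext (funext hz))) ⟨y, hy⟩ hlow hns

end Isometry

/-! ### The regular representation -/

section RegularRepresentation

variable {K : Type v} [TopologicalSpace K]
  [MeasurableSpace (K × Multiplicative ℝ)] [BorelSpace (K × Multiplicative ℝ)]

/-- No countability assumption on `K` is needed, as `K × ℝ` is `σ`-compact. -/
theorem Continuous.stronglyMeasurable_of_compactSpace_prod [CompactSpace K] {X : Type*}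
    [TopologicalSpace X] [TopologicalSpace.PseudoMetrizableSpace X] {F : K × Multiplicative ℝ → X}
    (hF : Continuous F) : StronglyMeasurable F := by
  borelize X
  refine stronglyMeasurable_iff_measurable_separable.2 ⟨hF.measurable, ?_⟩
  have h : Set.range F = ⋃ n : ℕ,
      F '' ((fun p : K × Multiplicative ℝ => p.2.toAdd) ⁻¹' Set.Icc (-(n : ℝ)) n) := by
    rw [← Set.image_iUnion, ← Set.preimage_iUnion, ← Set.image_univ]
    congr 1
    symm
    refine Set.eq_univ_of_forall fun p => ?_
    obtain ⟨n, hn⟩ := exists_nat_ge |p.2.toAdd|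
    exact Set.mem_iUnion.2 ⟨n, abs_le.1 hn⟩
  rw [h]
  refine TopologicalSpace.IsSeparable.iUnion fun n => ?_
  let := TopologicalSpace.pseudoMetrizableSpacePseudoMetric X
  exact ((isCompact_preimage_snd_toAdd isCompact_Icc).image hF).isSeparable

variable [Group K] [IsTopologicalGroup K] [CompactSpace K] {M : Type u} [CStarAlgebra M]
  (α : CStarAction (K × Multiplicative ℝ) M) {H₀ : Type u} [NormedAddCommGroup H₀]
  [InnerProductSpace ℂ H₀] [CompleteSpace H₀] (π : M →⋆ₐ[ℂ] (H₀ →L[ℂ] H₀))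

/-- The field of operators `g ↦ π(g⁻¹ · x)`. -/
noncomputable def CStarAction.operatorField (x : M) (g : K × Multiplicative ℝ) : H₀ →L[ℂ] H₀ :=
  π (α.toHom g⁻¹ x)

omit [MeasurableSpace (K × Multiplicative ℝ)] [BorelSpace (K × Multiplicative ℝ)]
  [CompactSpace K] in
theorem CStarAction.continuous_operatorField (x : M) : Continuous (α.operatorField π x) := by
  have h1 : Continuous π := AddMonoidHomClass.continuous_of_bound π 1 fun x => by
    rw [one_mul]; exact NonUnitalStarAlgHom.norm_apply_le π x
  exact h1.comp (α.continuous_act.comp (continuous_inv.prodMk continuous_const))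

omit [MeasurableSpace (K × Multiplicative ℝ)] [BorelSpace (K × Multiplicative ℝ)]
  [CompactSpace K] [IsTopologicalGroup K] in
theorem CStarAction.norm_operatorField_le (x : M) (g : K × Multiplicative ℝ) :
    ‖α.operatorField π x g‖ ≤ ‖x‖ :=
  (NonUnitalStarAlgHom.norm_apply_le π _).trans (NonUnitalStarAlgHom.norm_apply_le (α.toHom g⁻¹) x)

variable (μ : Measure (K × Multiplicative ℝ))

theorem CStarAction.memLp_operatorField (x : M) (ψ : Lp H₀ 2 μ) :
    MemLp (fun g => α.operatorField π x g (ψ g)) 2 μ := by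
  refine (Lp.memLp ψ).of_le_mul (c := ‖x‖) ?_ (ae_of_all _ fun g => ?_)
  · exact (ContinuousLinearMap.id ℂ (H₀ →L[ℂ] H₀)).aestronglyMeasurable_comp₂
      (α.continuous_operatorField π x).stronglyMeasurable_of_compactSpace_prod.aestronglyMeasurable
      (Lp.aestronglyMeasurable ψ)
  · exact (ContinuousLinearMap.le_opNorm _ _).trans
      (mul_le_mul_of_nonneg_right (α.norm_operatorField_le π x g) (norm_nonneg _))

/-- The operator on `L²(G, H₀)` of pointwise multiplication by `g ↦ π(g⁻¹ · x)`. -/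
noncomputable def CStarAction.multiplicationOp (x : M) : Lp H₀ 2 μ →L[ℂ] Lp H₀ 2 μ :=
  LinearMap.mkContinuous
    { toFun := fun ψ => (α.memLp_operatorField π μ x ψ).toLp
      map_add' := fun ψ ψ' => by
        rw [← MemLp.toLp_add]
        refine MemLp.toLp_congr _ _ ?_
        filter_upwards [Lp.coeFn_add ψ ψ'] with g hg
        rw [hg, Pi.add_apply, Pi.add_apply, map_add]
      map_smul' := fun c ψ => by
        rw [RingHom.id_apply, ← MemLp.toLp_const_smul]
        refine MemLp.toLp_congr _ _ ?_
        filter_upwards [Lp.coeFn_smul c ψ] with g hg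
        rw [hg, Pi.smul_apply, Pi.smul_apply, map_smul] }
    ‖x‖ (fun ψ => by
      refine Lp.norm_le_mul_norm_of_ae_le_mul ?_
      filter_upwards [(α.memLp_operatorField π μ x ψ).coeFn_toLp] with g hg
      change ‖((α.memLp_operatorField π μ x ψ).toLp : Lp H₀ 2 μ) g‖ ≤ _
      rw [hg]
      exact (ContinuousLinearMap.le_opNorm _ _).trans
        (mul_le_mul_of_nonneg_right (α.norm_operatorField_le π x g) (norm_nonneg _)))

theorem CStarAction.multiplicationOp_ae_eq (x : M) (ψ : Lp H₀ 2 μ) :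
    α.multiplicationOp π μ x ψ =ᵐ[μ] fun g => α.operatorField π x g (ψ g) :=
  (α.memLp_operatorField π μ x ψ).coeFn_toLp

/-- The representation of `M` on `L²(G, H₀)` by the operators of multiplication by
`g ↦ π(g⁻¹ · x)`. -/
noncomputable def CStarAction.multiplicationRep : M →⋆ₐ[ℂ] (Lp H₀ 2 μ →L[ℂ] Lp H₀ 2 μ) where
  toFun := α.multiplicationOp π μ
  map_one' := by
    ext1 ψ
    refine Lp.ext ?_
    filter_upwards [α.multiplicationOp_ae_eq π μ 1 ψ] with g hg
    rw [hg, operatorField, map_one, map_one]; rfl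
  map_mul' x y := by
    ext1 ψ
    refine Lp.ext ?_
    filter_upwards [α.multiplicationOp_ae_eq π μ (x * y) ψ, α.multiplicationOp_ae_eq π μ y ψ,
      α.multiplicationOp_ae_eq π μ x (α.multiplicationOp π μ y ψ)] with g h1 h2 h3
    rw [h1, mul_apply_eq_comp, h3, h2, operatorField, map_mul, map_mul]; rfl
  map_zero' := by
    ext1 ψ
    refine Lp.ext ?_
    filter_upwards [α.multiplicationOp_ae_eq π μ 0 ψ, Lp.coeFn_zero H₀ 2 μ] with g h1 h2
    rw [h1, operatorField, map_zero, map_zero, zero_apply, zero_apply, h2]; rfl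
  map_add' x y := by
    ext1 ψ
    refine Lp.ext ?_
    rw [add_apply]
    filter_upwards [α.multiplicationOp_ae_eq π μ (x + y) ψ, α.multiplicationOp_ae_eq π μ y ψ,
      α.multiplicationOp_ae_eq π μ x ψ, Lp.coeFn_add (α.multiplicationOp π μ x ψ)
        (α.multiplicationOp π μ y ψ)] with g h1 h2 h3 h4
    rw [h1, h4, Pi.add_apply, h3, h2, operatorField, map_add, map_add]; rfl
  commutes' c := by
    ext1 ψ
    refine Lp.ext ?_
    rw [Algebra.algebraMap_eq_smul_one, Algebra.algebraMap_eq_smul_one, smul_apply,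
      one_apply_eq_self]
    filter_upwards [α.multiplicationOp_ae_eq π μ (c • 1) ψ, Lp.coeFn_smul c ψ] with g h1 h2
    rw [h1, h2, operatorField, map_smul, map_smul, map_one, map_one]; rfl
  map_star' x := by
    rw [ContinuousLinearMap.star_eq_adjoint, ContinuousLinearMap.eq_adjoint_iff]
    intro ψ ζ
    rw [L2.inner_def, L2.inner_def]
    refine integral_congr_ae ?_
    filter_upwards [α.multiplicationOp_ae_eq π μ (star x) ψ,
      α.multiplicationOp_ae_eq π μ x ζ] with g h1 h2
    rw [h1, h2, operatorField, operatorField, map_star, map_star,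
      ContinuousLinearMap.star_eq_adjoint, ContinuousLinearMap.adjoint_inner_left]

section Translation

variable [μ.IsMulLeftInvariant]

omit [CompactSpace K] in
/-- The left translation `(U_h ψ)(g) = ψ(h⁻¹ g)` of `L²(G, H₀)`. -/
noncomputable def translation (H₀ : Type u) [NormedAddCommGroup H₀]
    [InnerProductSpace ℂ H₀] :
    K × Multiplicative ℝ →* (Lp H₀ 2 μ ≃ₗᵢ[ℂ] Lp H₀ 2 μ) where
  toFun h :=
    { toFun := fun ψ => DomMulAct.mk h⁻¹ • ψ
      invFun := fun ψ => DomMulAct.mk h • ψ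
      map_add' := fun ψ ψ' => smul_add _ _ _
      map_smul' := fun c ψ => smul_comm _ c ψ
      left_inv := fun ψ => by
        change DomMulAct.mk h • DomMulAct.mk h⁻¹ • ψ = ψ
        rw [smul_smul, ← DomMulAct.mk_mul, inv_mul_cancel, DomMulAct.mk_one, one_smul]
      right_inv := fun ψ => by
        change DomMulAct.mk h⁻¹ • DomMulAct.mk h • ψ = ψ
        rw [smul_smul, ← DomMulAct.mk_mul, mul_inv_cancel, DomMulAct.mk_one, one_smul]
      norm_map' := fun ψ => DomMulAct.norm_smul_Lp _ ψ }
  map_one' := by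
    ext1 ψ
    change DomMulAct.mk (1 : K × Multiplicative ℝ)⁻¹ • ψ = ψ
    rw [inv_one, DomMulAct.mk_one, one_smul]
  map_mul' h h' := by
    ext1 ψ
    change DomMulAct.mk (h * h')⁻¹ • ψ = DomMulAct.mk h⁻¹ • DomMulAct.mk h'⁻¹ • ψ
    rw [smul_smul, ← DomMulAct.mk_mul, mul_inv_rev]

end Translation

variable [μ.IsHaarMeasure] [μ.Regular]

/-- The covariant representation on `L²(G, H₀)` induced by a representation `π` of `M` on `H₀`:
the group acts by left translations and `x ∈ M` by multiplication by `g ↦ π(g⁻¹ · x)`. -/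
noncomputable def CStarAction.regularRep : CovariantRep α where
  H := Lp H₀ 2 μ
  π := α.multiplicationRep π μ
  U := Unitary.linearIsometryEquiv.symm.toMonoidHom.comp (translation μ H₀)
  continuous_U ψ := by
    change Continuous fun g : K × Multiplicative ℝ => DomMulAct.mk g⁻¹ • ψ
    have : Fact ((2 : ℝ≥0∞) ≠ ∞) := ⟨ENNReal.ofNat_ne_top⟩
    exact (DomMulAct.continuous_mk.comp continuous_inv).smul continuous_const
  covariant h x := by
    set U := Unitary.linearIsometryEquiv.symm.toMonoidHom.comp (translation μ H₀) h with hU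
    have key : (U : Lp H₀ 2 μ →L[ℂ] Lp H₀ 2 μ) * α.multiplicationRep π μ x
        = α.multiplicationRep π μ (α.toHom h x) * U := by
      ext1 ψ
      refine Lp.ext ?_
      change (DomMulAct.mk h⁻¹ • α.multiplicationOp π μ x ψ : Lp H₀ 2 μ) =ᵐ[μ]
        α.multiplicationOp π μ (α.toHom h x) (DomMulAct.mk h⁻¹ • ψ : Lp H₀ 2 μ)
      have h1 := (measurePreserving_smul h⁻¹ μ).quasiMeasurePreserving.ae
        (α.multiplicationOp_ae_eq π μ x ψ)
      filter_upwards [h1, DomMulAct.smul_Lp_ae_eq (DomMulAct.mk h⁻¹) (α.multiplicationOp π μ x ψ),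
        DomMulAct.smul_Lp_ae_eq (DomMulAct.mk h⁻¹) ψ,
        α.multiplicationOp_ae_eq π μ (α.toHom h x) (DomMulAct.mk h⁻¹ • ψ)] with g h1 h2 h3 h4
      rw [h2, h4, h3]
      change α.multiplicationOp π μ x ψ (h⁻¹ • g) = α.operatorField π (α.toHom h x) g (ψ (h⁻¹ • g))
      rw [h1, operatorField, operatorField, smul_eq_mul, mul_inv_rev, inv_inv, map_mul]
      rfl
    rw [key, mul_assoc, show (U : Lp H₀ 2 μ →L[ℂ] Lp H₀ 2 μ) * star (U : Lp H₀ 2 μ →L[ℂ] Lp H₀ 2 μ)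
      = 1 from U.2.2, mul_one]

end RegularRepresentation

/-! ### The exponentially decaying test function -/

section Decay

/-- The profile `u ↦ exp(-lam |u|)`. -/
noncomputable def decay (lam u : ℝ) : ℝ := Real.exp (-(lam * |u|))

theorem decay_pos (lam u : ℝ) : 0 < decay lam u := Real.exp_pos _

theorem continuous_decay (lam : ℝ) : Continuous (decay lam) := by unfold decay; fun_prop

theorem decay_le_one {lam : ℝ} (hlam : 0 < lam) (u : ℝ) : decay lam u ≤ 1 :=
  Real.exp_le_one_iff.2 (neg_nonpos.2 (by positivity))

theorem decay_sq (lam u : ℝ) : decay lam u ^ 2 = Real.exp (-(2 * lam) * |u|) := by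
  rw [decay, sq, ← Real.exp_add]; congr 1; ring

theorem integral_decay_sq {lam : ℝ} (hlam : 0 < lam) : ∫ u, decay lam u ^ 2 = 1 / lam := by
  simp only [decay_sq]
  rw [integral_comp_abs (f := fun u => Real.exp (-(2 * lam) * u)),
    integral_exp_mul_Ioi (by linarith)]
  simp
  field_simp

theorem integrable_decay_sq {lam : ℝ} (hlam : 0 < lam) : Integrable fun u => decay lam u ^ 2 :=
  .of_integral_ne_zero (by rw [integral_decay_sq hlam]; positivity)

/-- Away from `0`, the derivative of the profile is `± lam` times the profile. -/
theorem hasDerivAt_decay_sub (lam : ℝ) {u : ℝ} (hu : u ≠ 0) :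
    HasDerivAt (fun t => decay lam (u - t)) ((if u ≤ 0 then -lam else lam) * decay lam u) 0 := by
  have h1 : HasDerivAt (fun t : ℝ => u - t) (-1) 0 := (hasDerivAt_id (0 : ℝ)).const_sub u
  have h2 : HasDerivAt (fun t : ℝ => |u - t|) (if u ≤ 0 then 1 else -1) 0 := by
    rcases lt_or_gt_of_ne hu with h | h
    · have := (hasDerivAt_abs_neg (show u - 0 < 0 by linarith)).comp (0 : ℝ) h1
      rw [if_pos h.le]
      simpa [Function.comp_def] using this
    · have := (hasDerivAt_abs_pos (show 0 < u - 0 by linarith)).comp (0 : ℝ) h1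
      rw [if_neg h.not_ge]
      simpa [Function.comp_def] using this
  have h3 := (h2.const_mul lam).neg.exp
  refine h3.congr_deriv ?_
  change Real.exp (-(lam * |u - 0|)) * _ = _ * Real.exp (-(lam * |u|))
  rw [sub_zero]
  split_ifs <;> ring

theorem abs_decay_sub_le {lam : ℝ} (hlam : 0 < lam) (u : ℝ) {s t : ℝ} (hs : |s| ≤ 1)
    (ht : |t| ≤ 1) :
    |decay lam (u - s) - decay lam (u - t)| ≤ lam * Real.exp lam * decay lam u * |s - t| := by
  wlog h : decay lam (u - t) ≤ decay lam (u - s) generalizing s t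
  · rw [abs_sub_comm, abs_sub_comm s]
    exact this ht hs (le_of_not_ge h)
  rw [abs_of_nonneg (sub_nonneg.2 h)]
  have h1 : decay lam (u - s) - decay lam (u - t)
      ≤ decay lam (u - s) * (lam * (|u - t| - |u - s|)) := by
    have h2 : decay lam (u - t) = decay lam (u - s) * Real.exp (-(lam * (|u - t| - |u - s|))) := by
      rw [decay, decay, ← Real.exp_add]; congr 1; ring
    have h3 := Real.add_one_le_exp (-(lam * (|u - t| - |u - s|)))
    rw [h2]
    nlinarith [decay_pos lam (u - s)]
  have h4 : |u - t| - |u - s| ≤ |s - t| := by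
    have := abs_sub_abs_le_abs_sub (u - t) (u - s)
    rwa [show u - t - (u - s) = s - t by ring] at this
  have h5 : decay lam (u - s) ≤ Real.exp lam * decay lam u := by
    rw [decay, decay, ← Real.exp_add]
    refine Real.exp_le_exp.2 ?_
    have h6 : |u| ≤ |u - s| + |s| := by
      have := abs_add_le (u - s) s
      rwa [sub_add_cancel] at this
    nlinarith
  calc _ ≤ decay lam (u - s) * (lam * (|u - t| - |u - s|)) := h1
    _ ≤ decay lam (u - s) * (lam * |s - t|) := by
      gcongr
      exact (decay_pos _ _).le
    _ ≤ (Real.exp lam * decay lam u) * (lam * |s - t|) := by gcongr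
    _ = _ := by ring

end Decay

namespace CovariantRep

variable {K : Type v} [Group K] [TopologicalSpace K] {M : Type u} [CStarAlgebra M]
  {α : CStarAction (K × Multiplicative ℝ) M} (ρ : CovariantRep α)

/-- Let `T = 1 - 2 lam b (lam + δ)⁻¹ P` and `T ξ = ψ`, where `ψ` is fixed by `K` and `δ ψ = φ` in the
weak sense. As `δ` is skew-adjoint, `‖ψ‖²` is the inner product of `(lam + δ)⁻¹ P ξ`, which has norm
at most `‖ξ‖ / lam`, with the vector `lam ψ - φ - 2 lam b ψ`. So the latter cannot be small. -/
theorem sq_norm_le_of_transitionOp_eq {b : M} {lam : ℝ} (hlam : 0 < lam) (hb : IsSelfAdjoint b)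
    {ψ φ ξ : ρ.H} (hψ : ψ ∈ ρ.fixedSubspace) (hψ0 : ψ ≠ 0)
    (hφ : ∀ η, HasDerivAt (fun t => inner ℂ η (ρ.flow.op t ψ)) (inner ℂ η φ) 0)
    (hξ : ξ + ρ.transitionOp b hlam ξ = ψ) (hle : 1 / 2 * ‖ξ‖ ^ 2 ≤ ‖ψ‖ ^ 2) :
    lam ^ 2 * ‖ψ‖ ^ 2 ≤ 2 * ‖lam • ψ - φ - (2 * lam) • ρ.π b ψ‖ ^ 2 := by
  set P := ρ.fixedSubspace.starProjection with hP
  set η := ρ.flow.resolvent hlam (P ξ) with hη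
  set θ := lam • ψ - φ - (2 * lam) • ρ.π b ψ with hθ
  have hder : HasDerivAt (fun t => ρ.flow.op t η) (P ξ - lam • η) 0 :=
    ρ.flow.hasDerivAt_op_resolvent hlam (P ξ)
  have hskew : inner ℂ (P ξ - lam • η) ψ = -inner ℂ η φ := by
    have h1 := hder.inner ℂ (hasDerivAt_const (0 : ℝ) ψ)
    have h2 : (fun t => inner ℂ (ρ.flow.op t η) ψ) = fun t => inner ℂ η (ρ.flow.op (-t) ψ) := by
      funext t
      rw [← ρ.flow.inner_op (-t), ρ.flow.op_neg_op]
    rw [h2] at h1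
    have h3 := (show HasDerivAt (fun t => inner ℂ η (ρ.flow.op t ψ)) (inner ℂ η φ) (-0) by
      rw [neg_zero]; exact hφ η).scomp 0 (hasDerivAt_neg (0 : ℝ))
    have h4 := h1.unique (by simpa [Function.comp_def] using h3)
    rw [inner_zero_right, zero_add] at h4
    exact h4
  have hPψ : inner ℂ (P ξ) ψ = inner ℂ ξ ψ := by
    rw [hP, Submodule.inner_starProjection_left_eq_right,
      Submodule.starProjection_eq_self_iff.2 hψ]
  have hbη : inner ℂ (ρ.π b η) ψ = inner ℂ η (ρ.π b ψ) := by
    conv_lhs => rw [← (hb.map ρ.π).star_eq]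
    rw [ContinuousLinearMap.star_eq_adjoint, ContinuousLinearMap.adjoint_inner_left]
  have hkey : inner ℂ ψ ψ = inner ℂ η θ := by
    have h0 : inner ℂ ψ ψ = inner ℂ (ξ + ρ.transitionOp b hlam ξ) ψ := by rw [hξ]
    rw [h0, transitionOp_apply, inner_add_left, inner_neg_left, ← hP, ← hη, ← Complex.coe_smul,
      inner_smul_left, Complex.conj_ofReal, hbη, ← hPψ,
      show P ξ = (P ξ - lam • η) + lam • η by abel, inner_add_left, hskew, hθ, inner_sub_right,
      inner_sub_right, ← Complex.coe_smul, ← Complex.coe_smul, ← Complex.coe_smul, inner_smul_left,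
      Complex.conj_ofReal, inner_smul_right, inner_smul_right]
    ring
  have h1 : ‖ψ‖ ^ 2 ≤ ‖η‖ * ‖θ‖ := by
    rw [← inner_self_eq_norm_sq (𝕜 := ℂ), hkey]
    exact re_inner_le_norm _ _
  have h2 : lam ^ 2 * ‖η‖ ^ 2 ≤ ‖ξ‖ ^ 2 := by
    have h3 := ρ.flow.norm_sq_eq_of_hasDerivAt (lam := lam) hder
    rw [sub_add_cancel] at h3
    have h4 : ‖P ξ‖ ≤ ‖ξ‖ := Submodule.norm_starProjection_apply_le _ _
    nlinarith [sq_nonneg ‖P ξ - lam • η‖, norm_nonneg (P ξ)]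
  have hpos : 0 < ‖ψ‖ ^ 2 := by positivity
  have h5 : (‖ψ‖ ^ 2) ^ 2 ≤ (‖η‖ * ‖θ‖) ^ 2 := by gcongr
  have h6 : lam ^ 2 * (‖ψ‖ ^ 2) ^ 2 ≤ 2 * ‖ψ‖ ^ 2 * ‖θ‖ ^ 2 := by
    calc lam ^ 2 * (‖ψ‖ ^ 2) ^ 2 ≤ lam ^ 2 * (‖η‖ * ‖θ‖) ^ 2 := by gcongr
      _ = (lam ^ 2 * ‖η‖ ^ 2) * ‖θ‖ ^ 2 := by ring
      _ ≤ (2 * ‖ψ‖ ^ 2) * ‖θ‖ ^ 2 := mul_le_mul_of_nonneg_right (by linarith) (sq_nonneg _)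
  refine le_of_mul_le_mul_right ?_ hpos
  linarith

end CovariantRep

/-! ### The range of the transition operator in the regular representation -/

section SquareIntegrableProfile

variable {K : Type v} [TopologicalSpace K]
  [MeasurableSpace (K × Multiplicative ℝ)] [BorelSpace (K × Multiplicative ℝ)]
  {μ : Measure (K × Multiplicative ℝ)} {c : NNReal}

theorem integrable_comp_snd_toAdd (hμ : μ.map (fun p => p.2.toAdd) = c • (volume : Measure ℝ))
    {E : Type*} [NormedAddCommGroup E] {F : ℝ → E} (hF : Integrable F) :
    Integrable (fun p : K × Multiplicative ℝ => F p.2.toAdd) μ := by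
  have h : Integrable F (μ.map fun p => p.2.toAdd) := by
    rw [hμ]; exact hF.smul_measure_nnreal
  exact h.comp_measurable continuous_snd_toAdd.measurable

theorem memLp_comp_snd_toAdd (hμ : μ.map (fun p => p.2.toAdd) = c • (volume : Measure ℝ))
    {E : Type*} [NormedAddCommGroup E] [NormedSpace ℝ E] {F : ℝ → ℝ} (hF : Measurable F)
    (hF2 : Integrable fun s => F s ^ 2) (ξ₀ : E) :
    MemLp (fun p : K × Multiplicative ℝ => F p.2.toAdd • ξ₀) 2 μ := by
  have hm : StronglyMeasurable fun p : K × Multiplicative ℝ => F p.2.toAdd • ξ₀ :=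
    (hF.comp continuous_snd_toAdd.measurable).stronglyMeasurable.smul_const ξ₀
  rw [memLp_two_iff_integrable_sq_norm hm.aestronglyMeasurable]
  refine ((integrable_comp_snd_toAdd hμ hF2).mul_const (‖ξ₀‖ ^ 2)).congr (ae_of_all _ fun p => ?_)
  change F p.2.toAdd ^ 2 * ‖ξ₀‖ ^ 2 = ‖F p.2.toAdd • ξ₀‖ ^ 2
  rw [norm_smul, mul_pow, Real.norm_eq_abs, sq_abs]

theorem L2_norm_sq_eq_integral {X : Type*} [MeasurableSpace X] {μ : Measure X} {E : Type*}
    [NormedAddCommGroup E] [InnerProductSpace ℂ E] (f : Lp E 2 μ) :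
    ‖f‖ ^ 2 = ∫ a, ‖f a‖ ^ 2 ∂μ := by
  rw [← inner_self_eq_norm_sq (𝕜 := ℂ), L2.inner_def]
  have h : ∀ a, (inner ℂ (f a) (f a) : ℂ) = ((‖f a‖ ^ 2 : ℝ) : ℂ) := fun a => by
    rw [inner_self_eq_norm_sq_to_K]; push_cast; rfl
  simp only [h]
  rw [integral_complex_ofReal]
  exact Complex.ofReal_re _

theorem L2_integrable_norm_sq {X : Type*} [MeasurableSpace X] {μ : Measure X} {E : Type*}
    [NormedAddCommGroup E] (f : Lp E 2 μ) : Integrable (fun a => ‖f a‖ ^ 2) μ :=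
  (memLp_two_iff_integrable_sq_norm (Lp.aestronglyMeasurable f)).1 (Lp.memLp f)

end SquareIntegrableProfile

section RegularRepresentation

variable {K : Type v} [TopologicalSpace K]
  [MeasurableSpace (K × Multiplicative ℝ)] [BorelSpace (K × Multiplicative ℝ)]
  [Group K] [IsTopologicalGroup K] [CompactSpace K] {M : Type u} [CStarAlgebra M]
  {α : CStarAction (K × Multiplicative ℝ) M} {H₀ : Type u} [NormedAddCommGroup H₀]
  [InnerProductSpace ℂ H₀] [CompleteSpace H₀] {π : M →⋆ₐ[ℂ] (H₀ →L[ℂ] H₀)}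
  {μ : Measure (K × Multiplicative ℝ)} [μ.IsHaarMeasure]
  {c : NNReal}

omit [CompactSpace K] [CompleteSpace H₀] in
/-- The vector `(k, r) ↦ exp(-lam |r + r₀|) ξ₀` of `L²(G, H₀)` is in the domain of the generator of
translations, in the weak sense. -/
theorem hasDerivAt_inner_translation_decay
    (hμ : μ.map (fun p => p.2.toAdd) = c • (volume : Measure ℝ)) {lam r₀ : ℝ} (hlam : 0 < lam)
    {ξ₀ : H₀} {φ : Lp H₀ 2 μ}
    (hψ : MemLp (fun p : K × Multiplicative ℝ => decay lam (p.2.toAdd + r₀) • ξ₀) 2 μ)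
    (hφ : φ =ᵐ[μ] fun p => ((if p.2.toAdd + r₀ ≤ 0 then -lam else lam)
      * decay lam (p.2.toAdd + r₀)) • ξ₀) (η : Lp H₀ 2 μ) :
    HasDerivAt (fun t : ℝ => inner ℂ η
      (translation μ H₀ ((1 : K), Multiplicative.ofAdd t) hψ.toLp)) (inner ℂ η φ) 0 := by
  let F : ℝ → K × Multiplicative ℝ → ℂ := fun t p =>
    ((decay lam (p.2.toAdd + r₀ - t) : ℝ) : ℂ) * inner ℂ (η p) ξ₀
  let F' : K × Multiplicative ℝ → ℂ := fun p =>
    (((if p.2.toAdd + r₀ ≤ 0 then -lam else lam) * decay lam (p.2.toAdd + r₀) : ℝ) : ℂ)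
      * inner ℂ (η p) ξ₀
  have hF : (fun t : ℝ => inner ℂ η
      (translation μ H₀ ((1 : K), Multiplicative.ofAdd t) hψ.toLp)) = fun t => ∫ p, F t p ∂μ := by
    funext t
    have h1 : translation μ H₀ ((1 : K), Multiplicative.ofAdd t) hψ.toLp =ᵐ[μ]
        fun p => decay lam (p.2.toAdd + r₀ - t) • ξ₀ := by
      refine ((hψ.comp_measurePreserving
        (measurePreserving_smul ((1 : K), Multiplicative.ofAdd t)⁻¹ μ)).coeFn_toLp).trans
        (ae_of_all _ fun p => ?_)
      change decay lam (-t + p.2.toAdd + r₀) • ξ₀ = _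
      congr 2
      ring
    rw [L2.inner_def]
    refine integral_congr_ae ?_
    filter_upwards [h1] with p hp
    rw [hp, ← Complex.coe_smul, inner_smul_right]
  have hF' : inner ℂ η φ = ∫ p, F' p ∂μ := by
    rw [L2.inner_def]
    refine integral_congr_ae ?_
    filter_upwards [hφ] with p hp
    rw [hp, ← Complex.coe_smul, inner_smul_right]
  have hF0 : Integrable (F 0) μ := by
    refine (L2.integrable_inner (𝕜 := ℂ) η hψ.toLp).congr ?_
    filter_upwards [hψ.coeFn_toLp] with p hp
    rw [hp, ← Complex.coe_smul, inner_smul_right]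
    change _ = ((decay lam (p.2.toAdd + r₀ - 0) : ℝ) : ℂ) * inner ℂ (η p) ξ₀
    rw [sub_zero]
  have hinner : AEStronglyMeasurable (fun p => inner ℂ (η p) ξ₀) μ :=
    (Lp.aestronglyMeasurable η).inner aestronglyMeasurable_const
  have hmeas : ∀ t, AEStronglyMeasurable (F t) μ := fun t => by
    refine AEStronglyMeasurable.mul ?_ hinner
    have h1 : Continuous fun p : K × Multiplicative ℝ => decay lam (p.2.toAdd + r₀ - t) :=
      (continuous_decay lam).comp ((continuous_snd_toAdd.add continuous_const).sub continuous_const)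
    exact (Complex.measurable_ofReal.comp h1.measurable).aestronglyMeasurable
  have hmeas' : AEStronglyMeasurable F' μ := by
    have h1 : Integrable (fun p => inner ℂ (η p) (φ p)) μ := L2.integrable_inner η φ
    refine h1.aestronglyMeasurable.congr ?_
    filter_upwards [hφ] with p hp
    rw [hp, ← Complex.coe_smul, inner_smul_right]
  have hnull : ∀ᵐ p ∂μ, p.2.toAdd + r₀ ≠ 0 := by
    refine ae_of_ae_map (p := fun s : ℝ => s + r₀ ≠ 0)
      (continuous_snd_toAdd (K := K)).measurable.aemeasurable ?_
    rw [hμ]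
    refine Measure.ae_smul_measure ?_ c
    filter_upwards [Measure.ae_ne volume (-r₀)] with s hs h
    exact hs (by linarith)
  rw [hF, hF']
  refine (hasDerivAt_integral_of_dominated_loc_of_lip (𝕜 := ℝ) (s := Metric.ball (0 : ℝ) 1)
    (bound := fun p => lam * Real.exp lam * ‖F 0 p‖)
    (Metric.ball_mem_nhds _ one_pos) (Eventually.of_forall hmeas) hF0 hmeas'
    (ae_of_all _ fun p => ?_) (hF0.norm.const_mul _) ?_).2
  · refine LipschitzOnWith.of_dist_le_mul fun s hs t ht => ?_
    rw [mem_ball_zero_iff, Real.norm_eq_abs] at hs ht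
    rw [Real.coe_nnabs, abs_of_nonneg (by positivity), dist_eq_norm, ← sub_mul, norm_mul,
      ← Complex.ofReal_sub, Complex.norm_real, Real.norm_eq_abs, Real.dist_eq]
    change _ ≤ lam * Real.exp lam
      * ‖((decay lam (p.2.toAdd + r₀ - 0) : ℝ) : ℂ) * inner ℂ (η p) ξ₀‖ * |s - t|
    rw [sub_zero, norm_mul, Complex.norm_real, Real.norm_of_nonneg (decay_pos _ _).le]
    calc _ ≤ lam * Real.exp lam * decay lam (p.2.toAdd + r₀) * |s - t| * ‖inner ℂ (η p) ξ₀‖ := by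
          gcongr
          exact abs_decay_sub_le hlam _ hs.le ht.le
      _ = _ := by ring
  · filter_upwards [hnull] with p hp
    exact ((hasDerivAt_decay_sub lam hp).ofReal_comp).mul_const _

omit [MeasurableSpace (K × Multiplicative ℝ)] [BorelSpace (K × Multiplicative ℝ)]
  [IsTopologicalGroup K] [CompactSpace K] in
/-- The pointwise size of `lam ψ - δ ψ - 2 lam b ψ` for `ψ(u) = exp(-lam |u|) ξ₀`. This vector is
`2 lam (χ - b) ψ` for the indicator function `χ` of the negative half line, and `χ - b` has norm at
most `1 / 8` except on the transition interval. -/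
theorem CStarAction.StepLike.norm_sub_le {b : M} {W r₀ lam : ℝ} (hW0 : 0 < W) (hlam : 0 < lam)
    (h : α.StepLike π b W r₀) (u : ℝ) (ξ₀ : H₀) :
    ‖(lam * decay lam u) • ξ₀ - ((if u ≤ 0 then -lam else lam) * decay lam u) • ξ₀
        - (2 * lam) • π (α.actR (r₀ - u) b) (decay lam u • ξ₀)‖ ^ 2
      ≤ 4 * lam ^ 2 * ‖ξ₀‖ ^ 2
        * (decay lam u ^ 2 / 64 + (Set.Ioo (-W) W).indicator (fun _ => 1) u) := by
  set B := π (α.actR (r₀ - u) b) with hB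
  have hd := decay_pos lam u
  have hd1 := decay_le_one hlam u
  have hlin : B (decay lam u • ξ₀) = decay lam u • B ξ₀ := by
    rw [← Complex.coe_smul, map_smul, Complex.coe_smul]
  set m : ℝ := if u ≤ 0 then ‖1 - B‖ else ‖B‖ with hm
  have hm0 : 0 ≤ m := by rw [hm]; split_ifs <;> positivity
  have hnorm : ‖(lam * decay lam u) • ξ₀ - ((if u ≤ 0 then -lam else lam) * decay lam u) • ξ₀
        - (2 * lam) • B (decay lam u • ξ₀)‖ ≤ 2 * lam * decay lam u * (m * ‖ξ₀‖) := by
    rw [hlin]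
    by_cases hu : u ≤ 0
    · have e : (lam * decay lam u) • ξ₀ - ((if u ≤ 0 then -lam else lam) * decay lam u) • ξ₀
          - (2 * lam) • decay lam u • B ξ₀ = (2 * lam * decay lam u) • (1 - B) ξ₀ := by
        rw [if_pos hu, sub_apply, one_apply_eq_self]
        module
      rw [e, norm_smul, Real.norm_of_nonneg (by positivity), hm, if_pos hu]
      gcongr
      exact ContinuousLinearMap.le_opNorm _ _
    · have e : (lam * decay lam u) • ξ₀ - ((if u ≤ 0 then -lam else lam) * decay lam u) • ξ₀
          - (2 * lam) • decay lam u • B ξ₀ = -((2 * lam * decay lam u) • B ξ₀) := by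
        rw [if_neg hu]
        module
      rw [e, norm_neg, norm_smul, Real.norm_of_nonneg (by positivity), hm, if_neg hu]
      gcongr
      exact ContinuousLinearMap.le_opNorm _ _
  have hmain : decay lam u ^ 2 * m ^ 2
      ≤ decay lam u ^ 2 / 64 + (Set.Ioo (-W) W).indicator (fun _ => 1) u := by
    by_cases hW : u ∈ Set.Ioo (-W) W
    · rw [Set.indicator_of_mem hW]
      have hm1 : m ≤ 1 := by
        rw [hm]
        split_ifs
        · exact h.norm_one_sub_le _
        · exact h.norm_le _
      have h1 : decay lam u ^ 2 ≤ 1 := pow_le_one₀ hd.le hd1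
      have h2 : m ^ 2 ≤ 1 := pow_le_one₀ hm0 hm1
      nlinarith [sq_nonneg (decay lam u)]
    · rw [Set.indicator_of_notMem hW, add_zero]
      have hm1 : m ≤ 1 / 8 := by
        rw [hm]
        split_ifs with hu
        · refine h.right _ ?_
          by_contra! h1
          exact hW ⟨by linarith, by linarith⟩
        · refine h.left _ ?_
          by_contra! h1
          exact hW ⟨by linarith, by linarith⟩
      have h2 : m ^ 2 ≤ (1 / 8) ^ 2 := by gcongr
      nlinarith [sq_nonneg (decay lam u)]
  calc _ ≤ (2 * lam * decay lam u * (m * ‖ξ₀‖)) ^ 2 := by gcongr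
    _ = 4 * lam ^ 2 * ‖ξ₀‖ ^ 2 * (decay lam u ^ 2 * m ^ 2) := by ring
    _ ≤ _ := by gcongr

/-- The operator `T = 1 - 2 lam b (lam + δ)⁻¹ P` of the regular representation is not surjective: its
range does not contain the vector `(k, r) ↦ exp(-lam |r + r₀|) ξ₀`. -/
theorem CStarAction.StepLike.not_surjective_transitionOp [μ.Regular] {b : M} {W r₀ lam : ℝ}
    (hW : 0 < W) (hlam : 0 < lam) (hlamW : lam * W = 1 / 64) (h : α.StepLike π b W r₀)
    (hb : IsSelfAdjoint b) (hbK : ∀ k, α.actK k b = b) {ξ₀ : H₀} (hξ₀ : ξ₀ ≠ 0)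
    (hlow : ∀ ξ, 1 / 2 * ‖ξ‖ ^ 2 ≤ ‖ξ + (α.regularRep π μ).transitionOp b hlam ξ‖ ^ 2) :
    ¬ Function.Surjective fun ξ => ξ + (α.regularRep π μ).transitionOp b hlam ξ := by
  intro hsurj
  obtain ⟨c, hc0, hμ⟩ := exists_map_snd_toAdd_eq μ
  set ρ := α.regularRep π μ with hρ
  have hFm : Measurable fun s => decay lam (s + r₀) :=
    ((continuous_decay lam).comp (continuous_id.add continuous_const)).measurable
  have hF2 : Integrable fun s => decay lam (s + r₀) ^ 2 :=
    (integrable_decay_sq hlam).comp_add_right r₀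
  have hψ : MemLp (fun p : K × Multiplicative ℝ => decay lam (p.2.toAdd + r₀) • ξ₀) 2 μ :=
    memLp_comp_snd_toAdd hμ hFm hF2 ξ₀
  have hsm : Measurable fun s : ℝ => (if s + r₀ ≤ 0 then -lam else lam) * decay lam (s + r₀) :=
    (Measurable.ite (measurableSet_le (measurable_id.add_const r₀) measurable_const)
      measurable_const measurable_const).mul hFm
  have hφ : MemLp (fun p : K × Multiplicative ℝ => ((if p.2.toAdd + r₀ ≤ 0 then -lam else lam)
      * decay lam (p.2.toAdd + r₀)) • ξ₀) 2 μ := by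
    refine memLp_comp_snd_toAdd hμ hsm ((hF2.const_mul (lam ^ 2)).congr (ae_of_all _ fun s => ?_)) ξ₀
    change lam ^ 2 * decay lam (s + r₀) ^ 2 = ((if s + r₀ ≤ 0 then -lam else lam)
      * decay lam (s + r₀)) ^ 2
    split_ifs <;> ring
  let ψ : Lp H₀ 2 μ := hψ.toLp
  let φ : Lp H₀ 2 μ := hφ.toLp
  have hψnorm : ‖ψ‖ ^ 2 = c * (1 / lam) * ‖ξ₀‖ ^ 2 := by
    have h1 : ∫ p, ‖ψ p‖ ^ 2 ∂μ = ∫ p, (fun s => decay lam (s + r₀) ^ 2 * ‖ξ₀‖ ^ 2) p.2.toAdd ∂μ := by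
      refine integral_congr_ae ?_
      filter_upwards [hψ.coeFn_toLp] with p hp
      change ‖(hψ.toLp : Lp H₀ 2 μ) p‖ ^ 2 = _
      rw [hp, norm_smul, mul_pow, Real.norm_eq_abs, sq_abs]
    rw [L2_norm_sq_eq_integral, h1, integral_comp_snd_toAdd hμ
      (hF2.mul_const _).aestronglyMeasurable, integral_mul_const,
      integral_add_right_eq_self (fun s => decay lam s ^ 2), integral_decay_sq hlam, smul_eq_mul,
      mul_assoc]
  have hcpos : (0 : ℝ) < c := lt_of_le_of_ne c.2 (by exact_mod_cast hc0.symm)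
  have hψpos : 0 < ‖ψ‖ ^ 2 := by rw [hψnorm]; positivity
  have hψ0 : ψ ≠ 0 := by
    intro h0
    rw [h0] at hψpos
    simp at hψpos
  have hfix : ψ ∈ ρ.fixedSubspace := by
    intro k
    refine MemLp.toLp_congr (hψ.comp_measurePreserving
      (measurePreserving_smul ((k, 1) : K × Multiplicative ℝ)⁻¹ μ)) hψ (ae_of_all _ fun p => ?_)
    change decay lam ((((k, 1) : K × Multiplicative ℝ)⁻¹ • p).2.toAdd + r₀) • ξ₀ = _
    simp
  obtain ⟨ξ, hξ⟩ := hsurj ψ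
  have hbound := ρ.sq_norm_le_of_transitionOp_eq hlam hb (ψ := ψ) (φ := φ) hfix hψ0
    (hasDerivAt_inner_translation_decay hμ hlam hψ hφ.coeFn_toLp) hξ (by
      have := hlow ξ
      rwa [show ξ + ρ.transitionOp b hlam ξ = ψ from hξ] at this)
  set θ : Lp H₀ 2 μ := lam • ψ - φ - (2 * lam) • α.multiplicationOp π μ b ψ with hθ
  have hbound' : lam ^ 2 * ‖ψ‖ ^ 2 ≤ 2 * ‖θ‖ ^ 2 := hbound
  set G : ℝ → ℝ := fun u => decay lam u ^ 2 / 64 + (Set.Ioo (-W) W).indicator (fun _ => 1) u with hG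
  have hGi1 : Integrable fun u => decay lam u ^ 2 / 64 := (integrable_decay_sq hlam).div_const _
  have hGi2 : Integrable ((Set.Ioo (-W) W).indicator fun _ => (1 : ℝ)) :=
    (integrable_indicator_iff measurableSet_Ioo).2 (integrableOn_const (by simp))
  have hGi : Integrable G := hGi1.add hGi2
  have hGint : ∫ u, G u = 1 / lam / 64 + 2 * W := by
    rw [hG, integral_add hGi1 hGi2, integral_div, integral_decay_sq hlam,
      integral_indicator measurableSet_Ioo]
    simp
    rw [max_eq_left (by positivity)]
    ring
  have hθle : ∀ᵐ p ∂μ, ‖θ p‖ ^ 2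
      ≤ (fun s => 4 * lam ^ 2 * ‖ξ₀‖ ^ 2 * G (s + r₀)) p.2.toAdd := by
    filter_upwards [Lp.coeFn_sub (lam • ψ - φ) ((2 * lam) • α.multiplicationOp π μ b ψ),
      Lp.coeFn_sub (lam • ψ) φ, Lp.coeFn_smul lam ψ,
      Lp.coeFn_smul (2 * lam) (α.multiplicationOp π μ b ψ), α.multiplicationOp_ae_eq π μ b ψ,
      hψ.coeFn_toLp, hφ.coeFn_toLp] with p h1 h2 h3 h4 h5 h6 h7
    have h6' : ψ p = decay lam (p.2.toAdd + r₀) • ξ₀ := h6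
    have hfield : α.operatorField π b p = π (α.actR (r₀ - (p.2.toAdd + r₀)) b) := by
      obtain ⟨k, t⟩ := p
      rw [operatorField, Prod.inv_mk, α.toHom_eq, hbK]
      congr 2
      change -t.toAdd = r₀ - (t.toAdd + r₀)
      ring
    rw [hθ, h1, Pi.sub_apply, h2, Pi.sub_apply, h3, h4, Pi.smul_apply, Pi.smul_apply, h5, h6', h7,
      hfield, smul_smul]
    exact h.norm_sub_le hW hlam (p.2.toAdd + r₀) ξ₀
  have hθnorm : ‖θ‖ ^ 2 ≤ c * (4 * lam ^ 2 * ‖ξ₀‖ ^ 2 * (1 / lam / 64 + 2 * W)) := by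
    have hi : Integrable fun s => 4 * lam ^ 2 * ‖ξ₀‖ ^ 2 * G (s + r₀) :=
      (hGi.comp_add_right r₀).const_mul _
    rw [L2_norm_sq_eq_integral]
    refine (integral_mono_ae (L2_integrable_norm_sq θ) (integrable_comp_snd_toAdd hμ hi) hθle).trans
      (le_of_eq ?_)
    rw [integral_comp_snd_toAdd hμ hi.aestronglyMeasurable, integral_const_mul,
      integral_add_right_eq_self G, hGint, smul_eq_mul]
  have hWeq : W = 1 / lam / 64 := by
    field_simp
    linarith
  -- the bounds leave a factor `24 / 64 < 1`
  have hfinal : 2 * (c * (4 * lam ^ 2 * ‖ξ₀‖ ^ 2 * (1 / lam / 64 + 2 * W)))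
      = 24 / 64 * (lam ^ 2 * ‖ψ‖ ^ 2) := by
    rw [hψnorm, hWeq]
    ring
  have : 0 < lam ^ 2 * ‖ψ‖ ^ 2 := by positivity
  linarith

end RegularRepresentation

/-! ### Existence of a nonunitary isometry -/

theorem exists_isIrreducibleRep_mem_idealSpectrum {M : Type u} [CStarAlgebra M] [PartialOrder M]
    [StarOrderedRing M] {Y : Type*} [TopologicalSpace Y] {H₀ : Type u} [NormedAddCommGroup H₀]
    [InnerProductSpace ℂ H₀] [CompleteSpace H₀] {φ : C₀(Y, compactOperators H₀) →⋆ₙₐ[ℂ] M}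
    {I : TwoSidedIdeal M} (hφ : Function.Injective φ) (hrange : Set.range φ = (I : Set M)) {x : M}
    (hx : x ∈ I) (hx0 : x ≠ 0) :
    ∃ (π : M →⋆ₐ[ℂ] (H₀ →L[ℂ] H₀)) (hπ : IsIrreducibleRep π),
      spectrumClass π hπ ∈ idealSpectrum I := by
  by_contra! h
  exact hx0 (eq_zero_of_forall_rep_eq_zero hφ hrange hx fun π hπ hc => absurd hc (h π hπ))

theorem theorem2p2
    {M : Type u} [CStarAlgebra M] [PartialOrder M] [StarOrderedRing M]
    {K : Type v} [Group K] [TopologicalSpace K] [IsTopologicalGroup K] [CompactSpace K] [T2Space K]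
    -- a Haar measure on `K × ℝ`, used in the construction of the crossed product
    [MeasurableSpace (K × Multiplicative ℝ)] [BorelSpace (K × Multiplicative ℝ)]
    (μ : Measure (K × Multiplicative ℝ)) [μ.IsHaarMeasure]
    (α : CStarAction (K × Multiplicative ℝ) M)
    -- the closed two-sided invariant ideals
    (J₁ J₂ : TwoSidedIdeal M)
    (hJ₁_closed : IsClosed (J₁ : Set M)) (hJ₂_closed : IsClosed (J₂ : Set M))
    (hJ₁_inv : ∀ g, ∀ x ∈ J₁, α.toHom g x ∈ J₁) (hJ₂_inv : ∀ g, ∀ x ∈ J₂, α.toHom g x ∈ J₂)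
    (h_sum : ∀ x : M, ∃ x₁ ∈ J₁, ∃ x₂ ∈ J₂, x₁ + x₂ = x)
    -- the ideal `J = J₁ ∩ J₂` and its spectrum `Y`
    (h_nonunital : ¬ ∃ e ∈ J₁ ⊓ J₂, ∀ x ∈ J₁ ⊓ J₂, e * x = x ∧ x * e = x)
    (Y : Set (CStarSpectrum M)) (hY : Y = idealSpectrum (J₁ ⊓ J₂))
    (hY_metrizable : TopologicalSpace.MetrizableSpace Y) (hY_hausdorff : T2Space Y)
    (H₀ : Type u) [NormedAddCommGroup H₀] [InnerProductSpace ℂ H₀] [CompleteSpace H₀]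
    [TopologicalSpace.SeparableSpace H₀]
    (h_iso : ∃ φ : C₀(Y, compactOperators H₀) →⋆ₙₐ[ℂ] M,
      Function.Injective φ ∧ Set.range φ = ((J₁ ⊓ J₂ : TwoSidedIdeal M) : Set M))
    -- the action of `ℝ` on `Y`
    (h_proper : α.IsProperOn Y) (h_orbit : CompactSpace (α.OrbitSpace Y))
    -- the element `a`
    (a : M) (ha_mem : a ∈ J₁) (ha_nonneg : 0 ≤ a) (ha_le : a ≤ 1) (ha_mem' : 1 - a ∈ J₂)
    (ha : ∀ (π : M →⋆ₐ[ℂ] (H₀ →L[ℂ] H₀)) (hπ : IsIrreducibleRep π), spectrumClass π hπ ∈ Y →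
      (∀ t : ℝ, ∃ c : ℂ, π (α.actR t a) - c • 1 ∈ compactOperators H₀) ∧
      Tendsto (fun t : ℝ => ‖π (α.actR t (1 - a))‖) atTop (𝓝 0) ∧
      Tendsto (fun t : ℝ => ‖π (α.actR t a)‖) atBot (𝓝 0))
    (ha_inv : ∀ k : K, α.actK k a = a) :
    UnitizationHasNonunitaryIsometry (crossedProduct α μ) := by
  subst hY
  obtain ⟨φ, hφ, hrange⟩ := h_iso
  obtain ⟨b, d, lam, W, hlam, hW, hlamW, hb, hbK, hd, hpos, hstep⟩ :=
    α.exists_smooth_transition hJ₁_closed hJ₂_closed hJ₁_inv hJ₂_inv hφ hrange h_proper h_orbit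
      ha_mem ha_nonneg ha_le ha_mem' (fun π hπ hc => (ha π hπ hc).2) ha_inv
  have hlow : ∀ (ρ : CovariantRep α) ξ, 1 / 2 * ‖ξ‖ ^ 2 ≤ ‖ξ + ρ.transitionOp b hlam ξ‖ ^ 2 :=
    fun ρ ξ => ρ.half_norm_sq_le_transitionOp hlam hb hbK hd hpos ξ
  refine crossedProduct_hasNonunitaryIsometry α μ (transitionElement α b hlam)
    (transitionElement_mem_crossedProduct μ b hlam) hlow ?_
  -- the zero ideal would have the unit element `0`
  obtain ⟨x, hx, hx0⟩ : ∃ x ∈ J₁ ⊓ J₂, x ≠ 0 := by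
    by_contra! h
    refine h_nonunital ⟨0, (J₁ ⊓ J₂).zero_mem, fun x hx => ?_⟩
    rw [h x hx, mul_zero]
    exact ⟨rfl, rfl⟩
  obtain ⟨π, hπ, hc⟩ := exists_isIrreducibleRep_mem_idealSpectrum hφ hrange hx hx0
  obtain ⟨r₀, hr₀⟩ := hstep π hπ hc
  have := hπ.1
  obtain ⟨ξ₀, hξ₀⟩ := exists_ne (0 : H₀)
  -- `μ` itself need not be regular
  exact ⟨α.regularRep π Measure.haar,
    hr₀.not_surjective_transitionOp hW hlam hlamW hb hbK hξ₀ (hlow _)⟩
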